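/- Let $n\ge 3$, $\mathfrak g=\mathfrak{so}(n^2)$ with Killing form $B$, let $K\subset G=\mathrm{SO}(n^2)$ be the image of $\mathrm{SO}(n)\times\mathrm{SO}(n)$ under the representation $\mathbb R^n\otimes\mathbb R^n$, with Lie algebra $\mathfrak k=\{A\otimes 1+1\otimes A'\}$, let $\mathfrak p$ be the $B$-orthogonal complement of $\mathfrak k$, and let $g_B=-B|_{\mathfrak p}$ be the standard metric on $G/K$. $G$-invariant metrics are identified with $\mathrm{Ad}(K)$-invariant inner products on $\mathfrak p$. Let $\mathrm{Sym}_0(n)$ be the space of trace-free symmetric $n\times n$ matrices and $$\mathfrak p_1=\mathfrak{so}(n)\otimes \mathrm{Sym}_0(n),\qquad \mathfrak p_2=\mathrm{Sym}_0(n)\otimes\mathfrak{so}(n).$$ Then: 1. $\mathfrak p=\mathfrak p_1\oplus\mathfrak p_2$ is a $B$-orthogonal decomposition into $\mathrm{Ad}(K)$-invariant subspaces, $\dim\mathfrak p_1=\dim\mathfrak p_2=\frac{n(n-1)^2(n+2)}{4}$. 2. The structural constants $[ijk]=\sum_{\alpha,\beta,\gamma}B([X^i_\alpha,X^j_\beta],X^k_\gamma)^2$,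 where $\{X^i_\alpha\}$ is any $(-B)$-orthonormal basis of $\mathfrak p_i$, satisfy $$[112]=[122]=\frac{n(n-1)^2(n-2)(n+2)^2}{16(n^2-2)}.$$ 3. $g_B$ is Einstein, $\mathrm{Rc}(g_B)=\rho\, g_B$ with $\rho=\frac14+\frac{n-1}{n(n^2-2)}$. The smallest eigenvalue of the Lichnerowicz Laplacian of $g_B$ on the space of $G$-invariant TT-tensors (symmetric, trace-free, divergence-free 2-tensors) is $$\lambda_{\mathfrak p}=\frac{n^2-4}{n^2-2}>2\rho,$$ so $g_B$ is $G$-stable. 4. If $n\ne 4$, every $G$-invariant metric on $G/K$ is of the form $x_1\,g_B|_{\mathfrak p_1}+x_2\,g_B|_{\mathfrak p_2}$ with $x_1,x_2>0$; $g_B$ is, up to scaling, the unique $G$-invariant Einstein metric on $G/K$; and $g_B$ is the global maximum of the scalar curvature on the set of $G$-invariant metrics having the same volume as $g_B$, attained only at $g_B$. If $n=4$, the last two assertions (uniqueness and global maximum) hold within the family of metrics $x_1\,g_B|_{\mathfrak p_1}+x_2\,g_B|_{\mathfrak p_2}$, $x_1,x_2>0$. -/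

import Mathlib

open scoped Kronecker Matrix

noncomputable section

/-! ## Invariant metrics on a reductive homogeneous space

A homogeneous space `G/K` with reductive decomposition `𝔤 = 𝔨 ⊕ 𝔭` is encoded at the base point
`o = eK`, where `T_o(G/K) = 𝔭`.  A `G`-invariant metric is an `Ad(K)`-invariant inner product on
`𝔭`; a `G`-invariant symmetric 2-tensor is `g(A·,·)` with `A` an `Ad(K)`-equivariant `g`-symmetric
endomorphism of `𝔭`.  The Levi-Civita connection is given by its Nomizu map
`Λ : 𝔭 → End(𝔭)`, so that `(∇_X T)_o = Λ(X) · T` for every `G`-invariant tensor field `T`. -/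

/-- A reductive decomposition `𝔤 = 𝔨 ⊕ 𝔭`, with the automorphisms `Ad(k)`, `k ∈ K`, of `𝔤`. -/
structure ReductivePair (L : Type*) [LieRing L] [LieAlgebra ℝ L] where
  isotropy : LieSubalgebra ℝ L
  compl : Submodule ℝ L
  isCompl : IsCompl isotropy.toSubmodule compl
  lie_mem : ∀ Z ∈ isotropy, ∀ X ∈ compl, ⁅Z, X⁆ ∈ compl
  AdK : Set (L ≃ₗ⁅ℝ⁆ L)
  Ad_isotropy : ∀ φ ∈ AdK, ∀ X ∈ isotropy, φ X ∈ isotropy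
  Ad_compl : ∀ φ ∈ AdK, ∀ X ∈ compl, φ X ∈ compl

namespace ReductivePair

variable {L : Type*} [LieRing L] [LieAlgebra ℝ L] (D : ReductivePair L)

/-- The projection `𝔤 → 𝔭` along `𝔨`. -/
def projP : L →ₗ[ℝ] D.compl :=
  D.compl.projectionOnto D.isotropy.toSubmodule D.isCompl.symm

/-- The projection `𝔤 → 𝔨` along `𝔭`, with values in `𝔤`. -/
def projK : L →ₗ[ℝ] L :=
  D.isotropy.toSubmodule.projection D.compl D.isCompl

/-- The Lie bracket of two elements of `𝔭`, as a bilinear map with values in `𝔤`. -/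
def lieP : D.compl →ₗ[ℝ] D.compl →ₗ[ℝ] L :=
  LinearMap.mk₂ ℝ (fun X Y => ⁅(X : L), (Y : L)⁆)
    (by intros; simp) (by intros; simp) (by intros; simp) (by intros; simp)

/-- `[X, Y]_𝔭` for `X, Y ∈ 𝔭`. -/
def bracketP : D.compl →ₗ[ℝ] D.compl →ₗ[ℝ] D.compl := D.lieP.compr₂ D.projP

/-- `[X, Y]_𝔨` for `X, Y ∈ 𝔭`. -/
def bracketK : D.compl →ₗ[ℝ] D.compl →ₗ[ℝ] L := D.lieP.compr₂ D.projK

lemma bracketP_swap (X Y : D.compl) : D.bracketP X Y = - D.bracketP Y X := by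
  simp only [bracketP, lieP, LinearMap.compr₂_apply, LinearMap.mk₂_apply]
  rw [← lie_skew, map_neg]

/-- The map `Z ↦ (X ↦ [Z, X]_𝔭)` from `𝔤` to `End(𝔭)`; for `Z ∈ 𝔨` it is `ad(Z)|_𝔭`. -/
def adP : L →ₗ[ℝ] Module.End ℝ D.compl :=
  LinearMap.mk₂ ℝ (fun Z X => D.projP ⁅Z, (X : L)⁆)
    (by intros; simp) (by intros; simp) (by intros; simp) (by intros; simp)

/-- A `G`-invariant Riemannian metric: an `Ad(K)`-invariant inner product on `𝔭`. -/
@[ext]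
structure InvMetric where
  form : LinearMap.BilinForm ℝ D.compl
  symm : ∀ X Y, form X Y = form Y X
  posDef : ∀ X, X ≠ 0 → 0 < form X X
  inv : ∀ φ (hφ : φ ∈ D.AdK) (X Y : D.compl),
    form ⟨φ X, D.Ad_compl φ hφ X X.2⟩ ⟨φ Y, D.Ad_compl φ hφ Y Y.2⟩ = form X Y

namespace InvMetric

variable {D} (g g' : D.InvMetric)

lemma nondegenerate : g.form.Nondegenerate := by
  constructor
  · intro X h
    by_contra hX
    exact (g.posDef X hX).ne' (h X)
  · intro X h
    by_contra hX
    exact (g.posDef X hX).ne' (h X)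

variable [FiniteDimensional ℝ L]

/-- The isomorphism `𝔭 ≃ 𝔭*` given by the metric. -/
def dual : D.compl ≃ₗ[ℝ] Module.Dual ℝ D.compl := g.form.toDual g.nondegenerate

/-- The `g`-trace `∑ᵢ F(eᵢ, eᵢ)` (`eᵢ` a `g`-orthonormal basis) of a bilinear expression `F`,
computed in an arbitrary basis of `𝔭` and its `g`-dual basis. -/
def gTrace {V : Type*} [AddCommMonoid V] (F : D.compl → D.compl → V) : V :=
  ∑ i, F (Module.finBasis ℝ D.compl i)
    (g.form.dualBasis g.nondegenerate (Module.finBasis ℝ D.compl) i)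

/-- The trilinear form
`2 g(Λ(X)Y, Z) = g([X,Y]_𝔭, Z) + g([Z,X]_𝔭, Y) + g(X, [Z,Y]_𝔭)` (Koszul's formula). -/
def koszul : D.compl →ₗ[ℝ] D.compl →ₗ[ℝ] Module.Dual ℝ D.compl :=
  LinearMap.mk₂ ℝ
    (fun X Y => g.form (D.bracketP X Y) + (g.form.flip Y) ∘ₗ (D.bracketP.flip X)
      + (g.form X) ∘ₗ (D.bracketP.flip Y))
    (by intros; ext; simp; ring) (by intros; ext; simp)
    (by intros; ext; simp; ring) (by intros; ext; simp)

/-- The Nomizu map `Λ` of the Levi-Civita connection of `g`. -/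
def nomizu : D.compl →ₗ[ℝ] Module.End ℝ D.compl :=
  (1 / 2 : ℝ) • g.koszul.compr₂ g.dual.symm.toLinearMap

lemma form_nomizu (X Y Z : D.compl) : g.form (g.nomizu X Y) Z =
    (1 / 2 : ℝ) * (g.form (D.bracketP X Y) Z + g.form (D.bracketP Z X) Y
      + g.form X (D.bracketP Z Y)) := by
  simp [nomizu, dual, koszul]
  ring

/-- `Λ(X)` is `g`-skew: the connection is metric. -/
lemma nomizu_skew (X Y Z : D.compl) :
    g.form (g.nomizu X Y) Z + g.form Y (g.nomizu X Z) = 0 := by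
  rw [g.symm Y, form_nomizu, form_nomizu, D.bracketP_swap X Z, D.bracketP_swap Y X,
    D.bracketP_swap Z Y, g.symm X, g.symm X]
  simp; ring

/-- `Λ(X)Y - Λ(Y)X = [X,Y]_𝔭`: the connection is torsion free. -/
lemma nomizu_torsion (X Y : D.compl) :
    g.nomizu X Y - g.nomizu Y X = D.bracketP X Y := by
  apply g.dual.injective
  ext Z
  change g.form _ Z = g.form _ Z
  rw [map_sub, LinearMap.sub_apply, form_nomizu, form_nomizu, D.bracketP_swap Y X,
    g.symm X, g.symm Y]
  simp; ring

/-- The curvature tensor `R(X,Y) = [Λ(X),Λ(Y)] - Λ([X,Y]_𝔭) - ad([X,Y]_𝔨)|_𝔭`. -/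
def curvature : D.compl →ₗ[ℝ] D.compl →ₗ[ℝ] Module.End ℝ D.compl :=
  LinearMap.mk₂ ℝ (fun X Y => g.nomizu X * g.nomizu Y - g.nomizu Y * g.nomizu X
      - g.nomizu (D.bracketP X Y) - D.adP (D.bracketK X Y))
    (by intros; simp only [map_add, LinearMap.add_apply, add_mul, mul_add]; abel)
    (by intros; simp only [map_smul, LinearMap.smul_apply, smul_mul_assoc, mul_smul_comm,
      smul_sub])
    (by intros; simp only [map_add, add_mul, mul_add]; abel)
    (by intros; simp only [map_smul, smul_mul_assoc, mul_smul_comm, smul_sub])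

/-- The Ricci tensor `Rc(Y,Z) = tr(X ↦ R(X,Y)Z)`. -/
def ricci (Y Z : D.compl) : ℝ :=
  LinearMap.trace ℝ D.compl ((g.curvature.flip Y).flip Z)

/-- The scalar curvature, the `g`-trace of the Ricci tensor. -/
def scal : ℝ := g.gTrace g.ricci

/-- `Rc(g) = ρ g`. -/
def IsEinsteinWith (ρ : ℝ) : Prop := ∀ X Y, g.ricci X Y = ρ * g.form X Y

/-- `g` is an Einstein metric. -/
def IsEinstein : Prop := ∃ ρ : ℝ, g.IsEinsteinWith ρ

/-- The invariant metrics `g` and `g'` have the same volume: the determinant of `g` relative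
to `g'` is `1`. -/
def SameVolume : Prop :=
  LinearMap.det (g'.dual.symm.toLinearMap ∘ₗ g.dual.toLinearMap) = 1

/-- The covariant derivative `∇_X A` of a `G`-invariant field of endomorphisms. -/
def nabla (X : D.compl) (A : Module.End ℝ D.compl) : Module.End ℝ D.compl :=
  g.nomizu X * A - A * g.nomizu X

/-- The second covariant derivative `∇²_{X,Y} A` of a `G`-invariant field of endomorphisms. -/
def nabla₂ (X Y : D.compl) (A : Module.End ℝ D.compl) : Module.End ℝ D.compl :=
  g.nabla X (g.nabla Y A) - g.nabla (g.nomizu X Y) A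

/-- The rough Laplacian `∇*∇ A = - ∑ᵢ ∇²_{eᵢ,eᵢ} A`. -/
def roughLaplacian (A : Module.End ℝ D.compl) : Module.End ℝ D.compl :=
  - g.gTrace (fun X Y => g.nabla₂ X Y A)

/-- The curvature term `∑ᵢ T(R(eᵢ,Y)Z, eᵢ)` for the 2-tensor `T = g(A·,·)`, `A` being
`g`-symmetric, written as the trace of `X ↦ A(R(X,Y)Z)`. -/
def curvatureAction (A : Module.End ℝ D.compl) (Y Z : D.compl) : ℝ :=
  LinearMap.trace ℝ D.compl (A ∘ₗ ((g.curvature.flip Y).flip Z))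

/-- The Lichnerowicz Laplacian `Δ_L T = ∇*∇T + T ∘ Ric + Ric ∘ T - 2 R°T` of the `G`-invariant
symmetric 2-tensor `T = g(A·,·)`. -/
def lichnerowicz (A : Module.End ℝ D.compl) (Y Z : D.compl) : ℝ :=
  g.form (g.roughLaplacian A Y) Z + g.ricci (A Y) Z + g.ricci Y (A Z)
    - 2 * g.curvatureAction A Y Z

/-- The 2-tensor `g(A·,·)` is a `G`-invariant TT-tensor: symmetric, invariant, trace-free and
divergence-free. -/
structure IsTT (A : Module.End ℝ D.compl) : Prop where
  symm : ∀ X Y, g.form (A X) Y = g.form X (A Y)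
  inv : ∀ φ (hφ : φ ∈ D.AdK) (X : D.compl),
    A ⟨φ X, D.Ad_compl φ hφ X X.2⟩ = ⟨φ (A X), D.Ad_compl φ hφ (A X) (A X).2⟩
  trace : LinearMap.trace ℝ D.compl A = 0
  div : g.gTrace (fun X Y => g.nabla X A Y) = 0

/-- The eigenvalues of the Lichnerowicz Laplacian on the `G`-invariant TT-tensors. -/
def ttSpectrum : Set ℝ :=
  {μ | ∃ A, g.IsTT A ∧ A ≠ 0 ∧ ∀ Y Z, g.lichnerowicz A Y Z = μ * g.form (A Y) Z}

/-- `g` is Einstein, `Rc(g) = ρ g`, and `2ρ < λ` for the smallest eigenvalue `λ` of the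
Lichnerowicz Laplacian on the `G`-invariant TT-tensors. -/
def IsGStable : Prop :=
  ∃ ρ μ : ℝ, g.IsEinsteinWith ρ ∧ IsLeast g.ttSpectrum μ ∧ 2 * ρ < μ

end InvMetric

end ReductivePair

/-! ## The structural constants of a homogeneous space -/

/-- `b` is a basis of the subspace `V`, orthonormal for minus the Killing form. -/
def IsKillingOrthonormal {L : Type*} [LieRing L] [LieAlgebra ℝ L] {V : Submodule ℝ L}
    {ι : Type*} [DecidableEq ι] (b : Module.Basis ι ℝ V) : Prop :=
  ∀ α β, - killingForm ℝ L (b α) (b β) = if α = β then 1 else 0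

/-- The structural constant `[ijk] = ∑ ⟨[X_α, Y_β], Z_γ⟩²` computed in the bases `X`, `Y`, `Z` of
three subspaces of `𝔤`, with `⟨·,·⟩` minus the Killing form. -/
def structuralConstant {L : Type*} [LieRing L] [LieAlgebra ℝ L] {V₁ V₂ V₃ : Submodule ℝ L}
    {ι₁ ι₂ ι₃ : Type*} [Fintype ι₁] [Fintype ι₂] [Fintype ι₃] (X : Module.Basis ι₁ ℝ V₁)
    (Y : Module.Basis ι₂ ℝ V₂) (Z : Module.Basis ι₃ ℝ V₃) : ℝ :=
  ∑ α, ∑ β, ∑ γ, (- killingForm ℝ L ⁅(X α : L), (Y β : L)⁆ (Z γ)) ^ 2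

/-! ## The space `SO(n²)/SO(n)×SO(n)` -/

namespace TensorSO

open LieAlgebra.Orthogonal

section Ad

variable {ι : Type*} [Fintype ι] [DecidableEq ι]

lemma mul_transpose_self (Q : Matrix.specialOrthogonalGroup ι ℝ) :
    (Q : Matrix ι ι ℝ) * (Q : Matrix ι ι ℝ)ᵀ = 1 :=
  (Matrix.mem_orthogonalGroup_iff _ _).1 (Matrix.mem_specialOrthogonalGroup_iff.1 Q.2).1

lemma transpose_mul_self (Q : Matrix.specialOrthogonalGroup ι ℝ) :
    (Q : Matrix ι ι ℝ)ᵀ * (Q : Matrix ι ι ℝ) = 1 :=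
  (Matrix.mem_orthogonalGroup_iff' _ _).1 (Matrix.mem_specialOrthogonalGroup_iff.1 Q.2).1

/-- `Ad(Q) X = Q X Q⁻¹ = Q X Qᵀ` for `Q ∈ SO(N)` and `X ∈ so(N)`. -/
def Ad (Q : Matrix.specialOrthogonalGroup ι ℝ) : so ι ℝ ≃ₗ⁅ℝ⁆ so ι ℝ where
  toFun X := ⟨(Q : Matrix ι ι ℝ) * (X : Matrix ι ι ℝ) * (Q : Matrix ι ι ℝ)ᵀ, by
    have hX := (mem_so _ _ _).1 X.2
    rw [mem_so]
    simp [Matrix.transpose_mul, hX, Matrix.mul_assoc]⟩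
  invFun X := ⟨(Q : Matrix ι ι ℝ)ᵀ * (X : Matrix ι ι ℝ) * (Q : Matrix ι ι ℝ), by
    have hX := (mem_so _ _ _).1 X.2
    rw [mem_so]
    simp [Matrix.transpose_mul, hX, Matrix.mul_assoc]⟩
  map_add' X Y := by
    apply Subtype.ext
    simp [Matrix.mul_add, Matrix.add_mul]
  map_smul' c X := by
    apply Subtype.ext
    simp
  map_lie' := by
    intro X Y
    apply Subtype.ext
    have h := transpose_mul_self Q
    have key : ∀ A B : Matrix ι ι ℝ, (Q : Matrix ι ι ℝ) * A * (Q : Matrix ι ι ℝ)ᵀ *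
        ((Q : Matrix ι ι ℝ) * B * (Q : Matrix ι ι ℝ)ᵀ)
        = (Q : Matrix ι ι ℝ) * (A * B) * (Q : Matrix ι ι ℝ)ᵀ := by
      intro A B
      calc _ = (Q : Matrix ι ι ℝ) * A * ((Q : Matrix ι ι ℝ)ᵀ * (Q : Matrix ι ι ℝ)) * B *
            (Q : Matrix ι ι ℝ)ᵀ := by simp only [Matrix.mul_assoc]
        _ = _ := by rw [h]; simp only [Matrix.mul_assoc, Matrix.one_mul]
    simp [Ring.lie_def, key, Matrix.mul_sub, Matrix.sub_mul]
  left_inv X := by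
    apply Subtype.ext
    have h := transpose_mul_self Q
    calc (Q : Matrix ι ι ℝ)ᵀ * ((Q : Matrix ι ι ℝ) * (X : Matrix ι ι ℝ) * (Q : Matrix ι ι ℝ)ᵀ) *
          (Q : Matrix ι ι ℝ)
        = ((Q : Matrix ι ι ℝ)ᵀ * (Q : Matrix ι ι ℝ)) * (X : Matrix ι ι ℝ) *
          ((Q : Matrix ι ι ℝ)ᵀ * (Q : Matrix ι ι ℝ)) := by simp only [Matrix.mul_assoc]
      _ = X := by rw [h]; simp
  right_inv X := by
    apply Subtype.ext
    have h := mul_transpose_self Q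
    calc (Q : Matrix ι ι ℝ) * ((Q : Matrix ι ι ℝ)ᵀ * (X : Matrix ι ι ℝ) * (Q : Matrix ι ι ℝ)) *
          (Q : Matrix ι ι ℝ)ᵀ
        = ((Q : Matrix ι ι ℝ) * (Q : Matrix ι ι ℝ)ᵀ) * (X : Matrix ι ι ℝ) *
          ((Q : Matrix ι ι ℝ) * (Q : Matrix ι ι ℝ)ᵀ) := by simp only [Matrix.mul_assoc]
      _ = X := by rw [h]; simp

/-! The Killing form of `so(N)` is negative definite for `N ≥ 3`. -/

/-- The inner product `tr(X Yᵀ)` on `so(N)`. -/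
abbrev frobCore : InnerProductSpace.Core ℝ (so ι ℝ) where
  inner X Y := ((X : Matrix ι ι ℝ) * (Y : Matrix ι ι ℝ)ᵀ).trace
  conj_inner_symm X Y := by
    simp only [conj_trivial]
    rw [← Matrix.trace_transpose, Matrix.transpose_mul, Matrix.transpose_transpose]
  re_inner_nonneg X := by
    simp only [RCLike.re_to_real, Matrix.trace, Matrix.diag, Matrix.mul_apply,
      Matrix.transpose_apply]
    exact Finset.sum_nonneg fun i _ => Finset.sum_nonneg fun j _ => mul_self_nonneg _
  add_left X Y Z := by simp [Matrix.add_mul]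
  smul_left X Y r := by simp
  definite X h := by
    simp only [Matrix.trace, Matrix.diag, Matrix.mul_apply, Matrix.transpose_apply] at h
    apply Subtype.ext
    ext i j
    have h1 := (Finset.sum_eq_zero_iff_of_nonneg
      (fun i _ => Finset.sum_nonneg fun j _ => mul_self_nonneg _)).1 h i (Finset.mem_univ i)
    have h2 := (Finset.sum_eq_zero_iff_of_nonneg
      (fun j _ => mul_self_nonneg _)).1 h1 j (Finset.mem_univ j)
    simpa using h2

lemma ad_skew (X Y Z : so ι ℝ) :
    (((⁅X, Y⁆ : so ι ℝ) : Matrix ι ι ℝ) * (Z : Matrix ι ι ℝ)ᵀ).trace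
      = - ((Y : Matrix ι ι ℝ) * ((⁅X, Z⁆ : so ι ℝ) : Matrix ι ι ℝ)ᵀ).trace := by
  have hX := (mem_so _ _ _).1 X.2
  have hZ := (mem_so _ _ _).1 Z.2
  simp only [LieSubalgebra.coe_bracket, Ring.lie_def, Matrix.transpose_sub, Matrix.transpose_mul,
    hX, hZ, Matrix.sub_mul, Matrix.mul_sub, Matrix.trace_sub, Matrix.mul_neg, Matrix.neg_mul,
    Matrix.trace_neg, neg_neg]
  have h : ((X : Matrix ι ι ℝ) * (Y : Matrix ι ι ℝ) * (Z : Matrix ι ι ℝ)).trace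
      = ((Y : Matrix ι ι ℝ) * ((Z : Matrix ι ι ℝ) * (X : Matrix ι ι ℝ))).trace := by
    rw [Matrix.mul_assoc, Matrix.trace_mul_comm, Matrix.mul_assoc]
  rw [h, Matrix.mul_assoc (Y : Matrix ι ι ℝ)]

lemma eq_zero_of_central (hι : 3 ≤ Fintype.card ι) (X : so ι ℝ)
    (h : ∀ Y : so ι ℝ, ⁅X, Y⁆ = 0) : X = 0 := by
  have hX := (mem_so _ _ _).1 X.2
  apply Subtype.ext
  ext i j
  by_cases hij : i = j
  · subst hij
    have := congrFun (congrFun hX i) i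
    simp only [Matrix.transpose_apply, Matrix.neg_apply] at this
    simp only [ZeroMemClass.coe_zero, Matrix.zero_apply]
    linarith
  obtain ⟨k, hk⟩ : ∃ k, k ∉ ({i, j} : Finset ι) := by
    by_contra! hc
    have : Fintype.card ι ≤ ({i, j} : Finset ι).card :=
      Finset.card_le_card (fun x _ => hc x)
    have := Finset.card_le_two (a := i) (b := j)
    omega
  simp only [Finset.mem_insert, Finset.mem_singleton, not_or] at hk
  obtain ⟨hki, hkj⟩ := hk
  have hY : Matrix.single j k (1 : ℝ) - Matrix.single k j 1 ∈ so ι ℝ := by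
    rw [mem_so]; simp
  have h1 := congrArg (fun Z : so ι ℝ => (Z : Matrix ι ι ℝ) i k) (h ⟨_, hY⟩)
  simpa [Ring.lie_def, Matrix.mul_sub, Matrix.sub_mul, Matrix.mul_single_apply_same,
    Matrix.mul_single_apply_of_ne, Matrix.single_mul_apply_of_ne, hij, hki, hkj,
    Ne.symm hij, Ne.symm hki, Ne.symm hkj] using h1

lemma killingForm_self_neg (hι : 3 ≤ Fintype.card ι) (X : so ι ℝ) (hX : X ≠ 0) :
    killingForm ℝ (so ι ℝ) X X < 0 := by
  let _ : NormedAddCommGroup (so ι ℝ) := frobCore.toNormedAddCommGroup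
  let _ : InnerProductSpace ℝ (so ι ℝ) := InnerProductSpace.ofCore frobCore.toCore
  have hinner : ∀ Y Z : so ι ℝ, inner ℝ Y Z = ((Y : Matrix ι ι ℝ) * (Z : Matrix ι ι ℝ)ᵀ).trace :=
    fun _ _ => rfl
  have hskew : ∀ Y Z : so ι ℝ, inner ℝ Y ⁅X, Z⁆ = - inner ℝ ⁅X, Y⁆ Z := by
    intro Y Z
    rw [hinner, hinner, ad_skew, neg_neg]
  let e := stdOrthonormalBasis ℝ (so ι ℝ)
  have htr : killingForm ℝ (so ι ℝ) X X = - ∑ i, ‖⁅X, e i⁆‖ ^ 2 := by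
    rw [killingForm_apply_apply, LinearMap.trace_eq_sum_inner _ e, ← Finset.sum_neg_distrib]
    refine Finset.sum_congr rfl fun i _ => ?_
    simp only [LinearMap.comp_apply, LieAlgebra.ad_apply]
    rw [hskew, real_inner_self_eq_norm_sq]
  rw [htr, neg_lt_zero]
  refine lt_of_le_of_ne (Finset.sum_nonneg fun i _ => sq_nonneg _) fun h0 => hX ?_
  have hz : LieAlgebra.ad ℝ (so ι ℝ) X = 0 := by
    refine e.toBasis.ext fun i => ?_
    have := (Finset.sum_eq_zero_iff_of_nonneg (fun i _ => sq_nonneg _)).1 h0.symm i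
      (Finset.mem_univ i)
    simpa using this
  refine eq_zero_of_central hι X fun Y => ?_
  have := LinearMap.congr_fun hz Y
  simpa using this

end Ad

/-- The representation `ℝⁿ ⊗ ℝⁿ` of `SO(n) × SO(n)`, as a homomorphism into `SO(n²)`. -/
def tensorRep (n : ℕ) :
    Matrix.specialOrthogonalGroup (Fin n) ℝ × Matrix.specialOrthogonalGroup (Fin n) ℝ →*
      Matrix.specialOrthogonalGroup (Fin n × Fin n) ℝ where
  toFun q := ⟨(q.1 : Matrix (Fin n) (Fin n) ℝ) ⊗ₖ (q.2 : Matrix (Fin n) (Fin n) ℝ), by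
    rw [Matrix.mem_specialOrthogonalGroup_iff, Matrix.mem_orthogonalGroup_iff,
      ← Matrix.kroneckerMap_transpose, ← Matrix.mul_kronecker_mul, mul_transpose_self,
      mul_transpose_self, Matrix.one_kronecker_one, Matrix.det_kronecker,
      (Matrix.mem_specialOrthogonalGroup_iff.1 q.1.2).2,
      (Matrix.mem_specialOrthogonalGroup_iff.1 q.2.2).2]
    simp⟩
  map_one' := by
    apply Subtype.ext
    simp
  map_mul' q r := by
    apply Subtype.ext
    simp [Matrix.mul_kronecker_mul]

/-- The isotropy group `K ⊂ SO(n²)`, the image of `SO(n) × SO(n)`. -/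
def K (n : ℕ) : Subgroup (Matrix.specialOrthogonalGroup (Fin n × Fin n) ℝ) :=
  (tensorRep n).range

/-- The Lie algebra `{A ⊗ 1 + 1 ⊗ B : A, B ∈ so(n)}` of `K`. -/
def isotropyAlgebra (n : ℕ) : LieSubalgebra ℝ (so (Fin n × Fin n) ℝ) where
  carrier := {X | ∃ A ∈ so (Fin n) ℝ, ∃ B ∈ so (Fin n) ℝ,
    (X : Matrix (Fin n × Fin n) (Fin n × Fin n) ℝ) = A ⊗ₖ (1 : Matrix (Fin n) (Fin n) ℝ)
      + (1 : Matrix (Fin n) (Fin n) ℝ) ⊗ₖ B}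
  add_mem' := by
    rintro X Y ⟨A, hA, B, hB, hX⟩ ⟨A', hA', B', hB', hY⟩
    refine ⟨A + A', add_mem hA hA', B + B', add_mem hB hB', ?_⟩
    change (X : Matrix (Fin n × Fin n) (Fin n × Fin n) ℝ) + Y = _
    rw [hX, hY, Matrix.add_kronecker, Matrix.kronecker_add]
    abel
  zero_mem' := ⟨0, zero_mem _, 0, zero_mem _, by simp⟩
  smul_mem' := by
    rintro c X ⟨A, hA, B, hB, hX⟩
    refine ⟨c • A, SMulMemClass.smul_mem c hA, c • B, SMulMemClass.smul_mem c hB, ?_⟩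
    change c • (X : Matrix (Fin n × Fin n) (Fin n × Fin n) ℝ) = _
    rw [hX, Matrix.smul_kronecker, Matrix.kronecker_smul, smul_add]
  lie_mem' := by
    rintro X Y ⟨A, hA, B, hB, hX⟩ ⟨A', hA', B', hB', hY⟩
    refine ⟨A * A' - A' * A, (⁅(⟨A, hA⟩ : so (Fin n) ℝ), ⟨A', hA'⟩⁆ : so (Fin n) ℝ).2,
      B * B' - B' * B, (⁅(⟨B, hB⟩ : so (Fin n) ℝ), ⟨B', hB'⟩⁆ : so (Fin n) ℝ).2, ?_⟩
    change (X : Matrix (Fin n × Fin n) (Fin n × Fin n) ℝ) * Y - Y * X = _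
    rw [hX, hY, sub_eq_add_neg (A * A'), sub_eq_add_neg (B * B'), ← neg_one_smul ℝ (A' * A),
      ← neg_one_smul ℝ (B' * B), Matrix.add_kronecker, Matrix.kronecker_add,
      Matrix.smul_kronecker, Matrix.kronecker_smul]
    simp only [Matrix.mul_add, Matrix.add_mul, ← Matrix.mul_kronecker_mul, Matrix.one_mul,
      Matrix.mul_one, neg_one_smul]
    abel

/-- `𝔭`, the orthogonal complement of `𝔨` with respect to the Killing form of `so(n²)`. -/
def complement (n : ℕ) : Submodule ℝ (so (Fin n × Fin n) ℝ) :=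
  LinearMap.BilinForm.orthogonal (killingForm ℝ (so (Fin n × Fin n) ℝ))
    (isotropyAlgebra n).toSubmodule

/-- The first summand `𝔭₁ = so(n) ⊗ Sym₀(n)` of `𝔭`. -/
def p₁ (n : ℕ) : Submodule ℝ (so (Fin n × Fin n) ℝ) :=
  Submodule.span ℝ {X | ∃ A S : Matrix (Fin n) (Fin n) ℝ, Aᵀ = -A ∧ Sᵀ = S ∧ S.trace = 0 ∧
    (X : Matrix (Fin n × Fin n) (Fin n × Fin n) ℝ) = A ⊗ₖ S}

/-- The second summand `𝔭₂ = Sym₀(n) ⊗ so(n)` of `𝔭`. -/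
def p₂ (n : ℕ) : Submodule ℝ (so (Fin n × Fin n) ℝ) :=
  Submodule.span ℝ {X | ∃ S A : Matrix (Fin n) (Fin n) ℝ, Sᵀ = S ∧ S.trace = 0 ∧ Aᵀ = -A ∧
    (X : Matrix (Fin n × Fin n) (Fin n × Fin n) ℝ) = S ⊗ₖ A}

lemma three_le_card {n : ℕ} (hn : 3 ≤ n) : 3 ≤ Fintype.card (Fin n × Fin n) := by
  simp only [Fintype.card_prod, Fintype.card_fin]
  nlinarith

lemma mem_complement {n : ℕ} (X : so (Fin n × Fin n) ℝ) : X ∈ complement n ↔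
    ∀ Z ∈ isotropyAlgebra n, killingForm ℝ (so (Fin n × Fin n) ℝ) Z X = 0 := by
  simp [complement, LinearMap.BilinForm.mem_orthogonal_iff]

lemma isCompl_complement {n : ℕ} (hn : 3 ≤ n) :
    IsCompl (isotropyAlgebra n).toSubmodule (complement n) := by
  have hsymm : ∀ X Y, killingForm ℝ (so (Fin n × Fin n) ℝ) X Y = killingForm ℝ _ Y X :=
    fun X Y => LieModule.traceForm_comm ℝ _ _ X Y
  refine LinearMap.BilinForm.isCompl_orthogonal_of_restrict_nondegenerate
    (fun X Y h => by rw [hsymm, h]) ⟨fun X h => ?_, fun X h => ?_⟩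
  all_goals
    by_contra hX
    exact (killingForm_self_neg (three_le_card hn) (X : so (Fin n × Fin n) ℝ)
      (fun h0 => hX (Subtype.ext h0))).ne (h X)

lemma Ad_isotropy {n : ℕ} {k : Matrix.specialOrthogonalGroup (Fin n × Fin n) ℝ} (hk : k ∈ K n) :
    ∀ X ∈ isotropyAlgebra n, Ad k X ∈ isotropyAlgebra n := by
  obtain ⟨⟨P, Q⟩, rfl⟩ := hk
  rintro X ⟨A, hA, B, hB, hX⟩
  refine ⟨_, (Ad P ⟨A, hA⟩).2, _, (Ad Q ⟨B, hB⟩).2, ?_⟩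
  change (P : Matrix (Fin n) (Fin n) ℝ) ⊗ₖ (Q : Matrix (Fin n) (Fin n) ℝ) *
    (X : Matrix (Fin n × Fin n) (Fin n × Fin n) ℝ) *
    ((P : Matrix (Fin n) (Fin n) ℝ) ⊗ₖ (Q : Matrix (Fin n) (Fin n) ℝ))ᵀ
    = ((P : Matrix (Fin n) (Fin n) ℝ) * A * (P : Matrix (Fin n) (Fin n) ℝ)ᵀ) ⊗ₖ 1
      + 1 ⊗ₖ ((Q : Matrix (Fin n) (Fin n) ℝ) * B * (Q : Matrix (Fin n) (Fin n) ℝ)ᵀ)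
  rw [hX, ← Matrix.kroneckerMap_transpose, Matrix.mul_add, Matrix.add_mul]
  simp only [← Matrix.mul_kronecker_mul, Matrix.mul_one, mul_transpose_self]

lemma Ad_complement {n : ℕ} {k : Matrix.specialOrthogonalGroup (Fin n × Fin n) ℝ} (hk : k ∈ K n) :
    ∀ X ∈ complement n, Ad k X ∈ complement n := by
  intro X hX
  rw [mem_complement] at hX ⊢
  intro Z hZ
  have hZ' : Ad k⁻¹ Z ∈ isotropyAlgebra n := Ad_isotropy ((K n).inv_mem hk) Z hZ
  have : Ad k (Ad k⁻¹ Z) = Z := by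
    have h := mul_transpose_self k
    have hinv : ((k⁻¹ : Matrix.specialOrthogonalGroup (Fin n × Fin n) ℝ) :
        Matrix (Fin n × Fin n) (Fin n × Fin n) ℝ) =
        (k : Matrix (Fin n × Fin n) (Fin n × Fin n) ℝ)ᵀ := rfl
    have : Ad k⁻¹ Z = (Ad k).symm Z := by
      apply Subtype.ext
      change ((k⁻¹ : Matrix.specialOrthogonalGroup (Fin n × Fin n) ℝ) :
        Matrix (Fin n × Fin n) (Fin n × Fin n) ℝ) * _ * _ᵀ = _ * _ * _
      rw [hinv, Matrix.transpose_transpose]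
    rw [this, LieEquiv.apply_symm_apply]
  rw [← this, LieAlgebra.killingForm_of_equiv_apply]
  exact hX _ hZ'

/-- The reductive decomposition `so(n²) = 𝔨 ⊕ 𝔭` of `SO(n²)/SO(n)×SO(n)`. -/
def pair {n : ℕ} (hn : 3 ≤ n) : ReductivePair (so (Fin n × Fin n) ℝ) where
  isotropy := isotropyAlgebra n
  compl := complement n
  isCompl := isCompl_complement hn
  lie_mem := by
    intro Z hZ X hX
    rw [mem_complement] at hX ⊢
    intro W hW
    have := LieModule.traceForm_apply_lie_apply ℝ (so (Fin n × Fin n) ℝ)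
      (so (Fin n × Fin n) ℝ) W Z X
    rw [← this]
    exact hX _ ((isotropyAlgebra n).lie_mem hW hZ)
  AdK := {φ | ∃ k ∈ K n, φ = Ad k}
  Ad_isotropy := by
    rintro _ ⟨k, hk, rfl⟩
    exact Ad_isotropy hk
  Ad_compl := by
    rintro _ ⟨k, hk, rfl⟩
    exact Ad_complement hk

/-- The standard (Killing) metric `g_B`, minus the Killing form of `so(n²)` restricted to `𝔭`. -/
def standardMetric {n : ℕ} (hn : 3 ≤ n) : (pair hn).InvMetric where
  form := - (killingForm ℝ (so (Fin n × Fin n) ℝ)).restrict (complement n)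
  symm X Y := congrArg Neg.neg (LieModule.traceForm_comm ℝ _ _ (X : so (Fin n × Fin n) ℝ) Y)
  posDef _ hX := neg_pos.2 (killingForm_self_neg (three_le_card hn) _
    (fun h0 => hX (Subtype.ext h0)))
  inv φ _ X Y := congrArg Neg.neg
    (LieAlgebra.killingForm_of_equiv_apply φ (X : so (Fin n × Fin n) ℝ) (Y : so (Fin n × Fin n) ℝ))

/-- The metric `g` is of the form `x₁ g_B|_𝔭₁ + x₂ g_B|_𝔭₂`. -/
def IsDiagonal {n : ℕ} {hn : 3 ≤ n} (g : (pair hn).InvMetric) : Prop :=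
  ∃ x₁ x₂ : ℝ, ∀ X Y : (pair hn).compl,
    ((X : so (Fin n × Fin n) ℝ) ∈ p₁ n → (Y : so (Fin n × Fin n) ℝ) ∈ p₁ n →
      g.form X Y = x₁ * (standardMetric hn).form X Y) ∧
    ((X : so (Fin n × Fin n) ℝ) ∈ p₂ n → (Y : so (Fin n × Fin n) ℝ) ∈ p₂ n →
      g.form X Y = x₂ * (standardMetric hn).form X Y) ∧
    ((X : so (Fin n × Fin n) ℝ) ∈ p₁ n → (Y : so (Fin n × Fin n) ℝ) ∈ p₂ n → g.form X Y = 0)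

end TensorSO

end

/-! ### Endomorphisms of matrix spaces -/

namespace MatrixEnd

set_option linter.unusedSectionVars false

variable {ι : Type*} [Fintype ι] [DecidableEq ι]

/-! Everything is computed inside the matrix algebra M_n ⊗ M_n. Split M_n into skew, trace-free
symmetric and scalar matrices, with projections `sk`, `sy`, `sc`. Then so(n²) is the sum of 𝔭₁ (`sk`
⊗ `sy`), 𝔭₂ (`sy` ⊗ `sk`) and 𝔨 (`sk` ⊗ `sc` plus `sc` ⊗ `sk`), and the commutator with a pure
tensor is half of ad ⊗ jor + jor ⊗ ad (`adj_kronecker`). Traces of compressed products of two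
commutators thus factor into traces on M_n, where parity under transposition kills most of them.
What survives (`trace_prj_adj_prj_adj`, `trace_prj_adj_prjK_adj`) is a multiple of tr(UV). Divided
by the factor n² - 2 of the Killing form, it involves only three numbers: a = `bracketCoeff n 0 0
0`, b = `bracketCoeff n 0 1 0` and c = `casimirConst n`, with a + 3b + 2c = 1 (`coeff_sum`). The
structural constants [112] and [122] are b times the common dimension of the summands.

The standard metric is naturally reductive, so its Nomizu map is half the bracket, and the Ricci
tensor and the Lichnerowicz Laplacian become traces of products of brackets (`ricci_eq`,
`lichnerowicz_eq`). The Nomizu map of a metric x₁ ⊕ x₂ rescales each block of the bracket by an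
explicit factor, which gives the Ricci tensor (`ricci_diagonal`). On trace-free diagonal tensors the
Lichnerowicz Laplacian is multiplication by 4b = (n² - 4)/(n² - 2).

Invariant tensors are classified by testing SO(n)-invariant bilinear forms on signed permutation
matrices, and on diagonalized symmetric matrices (`apply_symm`, `apply_skew`). For n ≠ 4 every
invariant form on 𝔭 is scalar on each summand. For n = 4 the Hodge star of so(4) adds one invariant
per summand (`form_eq_diagEnd_add_star`). It is compatible with the brackets up to a sign on each
block, and the corresponding tensors have the same eigenvalue 4b. The spectrum on invariant
TT-tensors is therefore one point for every n.

One inequality, 1 + 2c < 8b, equivalent to n³ - 10n + 4 > 0, gives the rest. It says 2ρ < 4b, which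
is stability. It also makes the second factor of the Einstein equation in x₁, x₂ negative, so x₁ =
x₂ (`eq_of_ricciCoeff_eq`). Finally, on x₁x₂ = 1 the scalar curvature is a cubic in x₁ + x₂ ≥ 2, and
the same inequality makes 2 its only maximum point (`scal_le`). -/

lemma trace_eq_sum (f : Module.End ℝ (Matrix ι ι ℝ)) :
    LinearMap.trace ℝ _ f = ∑ i, ∑ j, f (Matrix.single i j 1) i j := by
  rw [LinearMap.trace_eq_matrix_trace ℝ (Matrix.stdBasis ℝ ι ι), Matrix.trace,
    Fintype.sum_prod_type]
  refine Finset.sum_congr rfl fun i _ => Finset.sum_congr rfl fun j _ => ?_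
  rw [Matrix.diag, LinearMap.toMatrix_apply, Matrix.stdBasis_eq_single]
  simp [Matrix.stdBasis, Pi.basis_repr]

/-- The transposition, as an endomorphism. -/
noncomputable def transp : Module.End ℝ (Matrix ι ι ℝ) :=
  (Matrix.transposeLinearEquiv ι ι ℝ ℝ).toLinearMap

@[simp] lemma transp_apply (X : Matrix ι ι ℝ) : transp X = Xᵀ := rfl

/-- The commutator with `C`. -/
noncomputable def adj (C : Matrix ι ι ℝ) : Module.End ℝ (Matrix ι ι ℝ) :=
  LinearMap.mulLeft ℝ C - LinearMap.mulRight ℝ C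

/-- The anticommutator with `C`. -/
noncomputable def jor (C : Matrix ι ι ℝ) : Module.End ℝ (Matrix ι ι ℝ) :=
  LinearMap.mulLeft ℝ C + LinearMap.mulRight ℝ C

@[simp] lemma adj_apply (C X : Matrix ι ι ℝ) : adj C X = C * X - X * C := rfl

@[simp] lemma jor_apply (C X : Matrix ι ι ℝ) : jor C X = C * X + X * C := rfl

/-- The projection onto the skew-symmetric matrices. -/
noncomputable def sk : Module.End ℝ (Matrix ι ι ℝ) := (1 / 2 : ℝ) • (1 - transp)

/-- The projection onto the scalar matrices. -/
noncomputable def sc : Module.End ℝ (Matrix ι ι ℝ) :=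
  LinearMap.smulRight ((Fintype.card ι : ℝ)⁻¹ • Matrix.traceLinearMap ι ℝ ℝ) 1

/-- The projection onto the trace-free symmetric matrices. -/
noncomputable def sy : Module.End ℝ (Matrix ι ι ℝ) := (1 / 2 : ℝ) • (1 + transp) - sc

lemma sk_apply (X : Matrix ι ι ℝ) : sk X = (1 / 2 : ℝ) • (X - Xᵀ) := rfl

lemma sc_apply (X : Matrix ι ι ℝ) : sc X = ((Fintype.card ι : ℝ)⁻¹ * X.trace) • (1 : Matrix ι ι ℝ) :=
  rfl

lemma sy_apply (X : Matrix ι ι ℝ) : sy X = (1 / 2 : ℝ) • (X + Xᵀ) - sc X := rfl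

lemma mul_single_mul_apply (A B : Matrix ι ι ℝ) (i j k l : ι) :
    (A * ((Matrix.single i j 1 : Matrix ι ι ℝ) * B)) k l = A k i * B j l := by
  simp [Matrix.mul_apply, Matrix.single_apply, ite_and]

/-- Every trace of a product of commutators and anticommutators expands into this one and its
variant twisted by the transposition. -/
lemma trace_sandwich (A B : Matrix ι ι ℝ) :
    LinearMap.trace ℝ _ (LinearMap.mulLeft ℝ A * LinearMap.mulRight ℝ B) = A.trace * B.trace := by
  rw [trace_eq_sum, Matrix.trace, Matrix.trace, Finset.sum_mul_sum]
  exact Finset.sum_congr rfl fun i _ => Finset.sum_congr rfl fun j _ =>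
    mul_single_mul_apply A B i j i j

lemma trace_transp_sandwich (A B : Matrix ι ι ℝ) :
    LinearMap.trace ℝ _ (transp * (LinearMap.mulLeft ℝ A * LinearMap.mulRight ℝ B)) =
      (A * Bᵀ).trace := by
  rw [trace_eq_sum, Matrix.trace, Finset.sum_comm]
  refine Finset.sum_congr rfl fun i _ => ?_
  rw [Matrix.diag, Matrix.mul_apply]
  exact Finset.sum_congr rfl fun j _ => mul_single_mul_apply A B j i i j

lemma trace_mulLeft (A : Matrix ι ι ℝ) :
    LinearMap.trace ℝ _ (LinearMap.mulLeft ℝ A) = Fintype.card ι * A.trace := by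
  have := trace_sandwich A 1
  rwa [LinearMap.mulRight_one, Matrix.trace_one, ← Module.End.one_eq_id, mul_one, mul_comm] at this

lemma trace_mulRight (B : Matrix ι ι ℝ) :
    LinearMap.trace ℝ _ (LinearMap.mulRight ℝ B) = Fintype.card ι * B.trace := by
  have := trace_sandwich 1 B
  rwa [LinearMap.mulLeft_one, Matrix.trace_one, ← Module.End.one_eq_id, one_mul] at this

lemma trace_transp_mulLeft (A : Matrix ι ι ℝ) :
    LinearMap.trace ℝ _ (transp * LinearMap.mulLeft ℝ A) = A.trace := by
  have := trace_transp_sandwich A 1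
  rwa [LinearMap.mulRight_one, ← Module.End.one_eq_id, mul_one, Matrix.transpose_one, mul_one]
    at this

lemma trace_transp_mulRight (B : Matrix ι ι ℝ) :
    LinearMap.trace ℝ _ (transp * LinearMap.mulRight ℝ B) = B.trace := by
  have := trace_transp_sandwich 1 B
  rwa [LinearMap.mulLeft_one, ← Module.End.one_eq_id, one_mul, one_mul, Matrix.trace_transpose]
    at this

lemma trace_sc_mul (f : Module.End ℝ (Matrix ι ι ℝ)) :
    LinearMap.trace ℝ _ (sc * f) = (Fintype.card ι : ℝ)⁻¹ * (f 1).trace := by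
  have : sc * f = LinearMap.smulRight
      (((Fintype.card ι : ℝ)⁻¹ • Matrix.traceLinearMap ι ℝ ℝ) ∘ₗ f) (1 : Matrix ι ι ℝ) := rfl
  rw [this, LinearMap.trace_smulRight]
  rfl

lemma adj_mul_adj (C D : Matrix ι ι ℝ) : adj C * adj D =
    LinearMap.mulLeft ℝ (C * D) - LinearMap.mulLeft ℝ C * LinearMap.mulRight ℝ D
      - LinearMap.mulLeft ℝ D * LinearMap.mulRight ℝ C + LinearMap.mulRight ℝ (D * C) := by
  ext1 X
  simp [mul_sub, sub_mul, mul_assoc]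
  abel

lemma jor_mul_jor (C D : Matrix ι ι ℝ) : jor C * jor D =
    LinearMap.mulLeft ℝ (C * D) + LinearMap.mulLeft ℝ C * LinearMap.mulRight ℝ D
      + LinearMap.mulLeft ℝ D * LinearMap.mulRight ℝ C + LinearMap.mulRight ℝ (D * C) := by
  ext1 X
  simp [mul_add, add_mul, mul_assoc]
  abel

lemma adj_mul_jor (C D : Matrix ι ι ℝ) : adj C * jor D =
    LinearMap.mulLeft ℝ (C * D) + LinearMap.mulLeft ℝ C * LinearMap.mulRight ℝ D
      - LinearMap.mulLeft ℝ D * LinearMap.mulRight ℝ C - LinearMap.mulRight ℝ (D * C) := by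
  ext1 X
  simp [mul_add, add_mul, mul_assoc]
  abel

lemma trace_adj_mul_adj (C D : Matrix ι ι ℝ) : LinearMap.trace ℝ _ (adj C * adj D) =
    2 * Fintype.card ι * (C * D).trace - 2 * (C.trace * D.trace) := by
  rw [adj_mul_adj, map_add, map_sub, map_sub, trace_mulLeft, trace_mulRight, trace_sandwich,
    trace_sandwich, Matrix.trace_mul_comm D]
  ring

lemma trace_jor_mul_jor (C D : Matrix ι ι ℝ) : LinearMap.trace ℝ _ (jor C * jor D) =
    2 * Fintype.card ι * (C * D).trace + 2 * (C.trace * D.trace) := by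
  rw [jor_mul_jor, map_add, map_add, map_add, trace_mulLeft, trace_mulRight, trace_sandwich,
    trace_sandwich, Matrix.trace_mul_comm D]
  ring

lemma trace_adj_mul_jor (C D : Matrix ι ι ℝ) : LinearMap.trace ℝ _ (adj C * jor D) = 0 := by
  rw [adj_mul_jor, map_sub, map_sub, map_add, trace_mulLeft, trace_mulRight, trace_sandwich,
    trace_sandwich, Matrix.trace_mul_comm D]
  ring

lemma trace_mul_transpose_comm (C D : Matrix ι ι ℝ) : (C * Dᵀ).trace = (D * Cᵀ).trace := by
  rw [← Matrix.trace_transpose, Matrix.transpose_mul, Matrix.transpose_transpose]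

lemma trace_transp_adj_mul_adj (C D : Matrix ι ι ℝ) :
    LinearMap.trace ℝ _ (transp * (adj C * adj D)) = 2 * (C * D).trace - 2 * (C * Dᵀ).trace := by
  rw [adj_mul_adj, mul_add, mul_sub, mul_sub, map_add, map_sub, map_sub, trace_transp_mulLeft,
    trace_transp_mulRight, trace_transp_sandwich, trace_transp_sandwich, Matrix.trace_mul_comm D C,
    trace_mul_transpose_comm D]
  ring

lemma trace_transp_jor_mul_jor (C D : Matrix ι ι ℝ) :
    LinearMap.trace ℝ _ (transp * (jor C * jor D)) = 2 * (C * D).trace + 2 * (C * Dᵀ).trace := by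
  rw [jor_mul_jor, mul_add, mul_add, mul_add, map_add, map_add, map_add, trace_transp_mulLeft,
    trace_transp_mulRight, trace_transp_sandwich, trace_transp_sandwich, Matrix.trace_mul_comm D C,
    trace_mul_transpose_comm D]
  ring

lemma trace_transp_adj_mul_jor (C D : Matrix ι ι ℝ) :
    LinearMap.trace ℝ _ (transp * (adj C * jor D)) = 0 := by
  rw [adj_mul_jor, mul_sub, mul_sub, mul_add, map_sub, map_sub, map_add, trace_transp_mulLeft,
    trace_transp_mulRight, trace_transp_sandwich, trace_transp_sandwich, Matrix.trace_mul_comm D C,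
    trace_mul_transpose_comm D]
  ring

lemma trace_jor_mul_adj (C D : Matrix ι ι ℝ) : LinearMap.trace ℝ _ (jor C * adj D) = 0 := by
  rw [LinearMap.trace_mul_comm, trace_adj_mul_jor]

lemma jor_mul_adj (C D : Matrix ι ι ℝ) : jor C * adj D =
    LinearMap.mulLeft ℝ (C * D) - LinearMap.mulLeft ℝ C * LinearMap.mulRight ℝ D
      + LinearMap.mulLeft ℝ D * LinearMap.mulRight ℝ C - LinearMap.mulRight ℝ (D * C) := by
  ext1 X
  simp [mul_sub, sub_mul, mul_add, mul_assoc]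
  abel

lemma trace_transp_jor_mul_adj (C D : Matrix ι ι ℝ) :
    LinearMap.trace ℝ _ (transp * (jor C * adj D)) = 0 := by
  rw [jor_mul_adj, mul_sub, mul_add, mul_sub, map_sub, map_add, map_sub, trace_transp_mulLeft,
    trace_transp_mulRight, trace_transp_sandwich, trace_transp_sandwich, Matrix.trace_mul_comm D C,
    trace_mul_transpose_comm D]
  ring

/-! Relations between the projections and the operators `adj`, `jor`. -/

lemma transp_mul_transp : (transp * transp : Module.End ℝ (Matrix ι ι ℝ)) = 1 := by
  ext1 X
  simp

lemma transp_mul_sc : (transp * sc : Module.End ℝ (Matrix ι ι ℝ)) = sc := by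
  ext1 X
  simp [sc_apply]

lemma sc_mul_transp : (sc * transp : Module.End ℝ (Matrix ι ι ℝ)) = sc := by
  ext1 X
  simp [sc_apply]

lemma sc_mul_sc [Nonempty ι] : (sc * sc : Module.End ℝ (Matrix ι ι ℝ)) = sc := by
  ext1 X
  simp [sc_apply]

lemma sk_mul_sk : (sk * sk : Module.End ℝ (Matrix ι ι ℝ)) = sk := by
  simp only [sk, smul_mul_smul_comm, sub_mul, mul_sub, transp_mul_transp, one_mul, mul_one]
  module

lemma sk_mul_sc : (sk * sc : Module.End ℝ (Matrix ι ι ℝ)) = 0 := by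
  simp [sk, sub_mul, transp_mul_sc]

lemma sc_mul_sk : (sc * sk : Module.End ℝ (Matrix ι ι ℝ)) = 0 := by
  simp [sk, mul_sub, sc_mul_transp]

lemma sk_mul_sy : (sk * sy : Module.End ℝ (Matrix ι ι ℝ)) = 0 := by
  rw [sy, mul_sub, sk_mul_sc, sk, smul_mul_smul_comm]
  simp [sub_mul, mul_add, transp_mul_transp]

lemma sy_mul_sk : (sy * sk : Module.End ℝ (Matrix ι ι ℝ)) = 0 := by
  rw [sy, sub_mul, sc_mul_sk, sk, smul_mul_smul_comm]
  simp [mul_sub, add_mul, transp_mul_transp, add_comm]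

lemma sy_mul_sc [Nonempty ι] : (sy * sc : Module.End ℝ (Matrix ι ι ℝ)) = 0 := by
  rw [sy, sub_mul, sc_mul_sc, smul_mul_assoc, add_mul, one_mul, transp_mul_sc]
  module

lemma sc_mul_sy [Nonempty ι] : (sc * sy : Module.End ℝ (Matrix ι ι ℝ)) = 0 := by
  rw [sy, mul_sub, sc_mul_sc, mul_smul_comm, mul_add, mul_one, sc_mul_transp]
  module

lemma sk_add_sy_add_sc : (sk + sy + sc : Module.End ℝ (Matrix ι ι ℝ)) = 1 := by
  rw [sk, sy]
  module

lemma sy_mul_sy [Nonempty ι] : (sy * sy : Module.End ℝ (Matrix ι ι ℝ)) = sy := by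
  have : (sy : Module.End ℝ (Matrix ι ι ℝ)) * (sk + sy + sc) = sy := by
    rw [sk_add_sy_add_sc, mul_one]
  rwa [mul_add, mul_add, sy_mul_sk, sy_mul_sc, zero_add, add_zero] at this

lemma adj_mul_sc (C : Matrix ι ι ℝ) : adj C * sc = 0 := by
  ext1 X
  simp [sc_apply]

lemma sc_mul_adj (C : Matrix ι ι ℝ) : sc * adj C = 0 := by
  ext1 X
  simp [sc_apply, Matrix.trace_mul_comm C]

lemma sk_mul (f : Module.End ℝ (Matrix ι ι ℝ)) : sk * f = (1 / 2 : ℝ) • (f - transp * f) := by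
  rw [sk, smul_mul_assoc, sub_mul, one_mul]

lemma sy_mul (f : Module.End ℝ (Matrix ι ι ℝ)) :
    sy * f = (1 / 2 : ℝ) • (f + transp * f) - sc * f := by
  rw [sy, sub_mul, smul_mul_assoc, add_mul, one_mul]

lemma trace_sk_mul (f : Module.End ℝ (Matrix ι ι ℝ)) : LinearMap.trace ℝ _ (sk * f) =
    1 / 2 * (LinearMap.trace ℝ _ f - LinearMap.trace ℝ _ (transp * f)) := by
  simp [sk_mul]

lemma trace_sy_mul (f : Module.End ℝ (Matrix ι ι ℝ)) : LinearMap.trace ℝ _ (sy * f) =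
    1 / 2 * (LinearMap.trace ℝ _ f + LinearMap.trace ℝ _ (transp * f))
      - (Fintype.card ι : ℝ)⁻¹ * (f 1).trace := by
  simp [sy_mul, trace_sc_mul, mul_add]

lemma sy_add_sc : (sy + sc : Module.End ℝ (Matrix ι ι ℝ)) = (1 / 2 : ℝ) • (1 + transp) := by
  rw [sy, sub_add_cancel]

lemma sy_add_sc_mul_sk : ((sy + sc) * sk : Module.End ℝ (Matrix ι ι ℝ)) = 0 := by
  rw [add_mul, sy_mul_sk, sc_mul_sk, add_zero]

lemma sy_add_sc_mul_sy [Nonempty ι] : ((sy + sc) * sy : Module.End ℝ (Matrix ι ι ℝ)) = sy := by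
  rw [add_mul, sy_mul_sy, sc_mul_sy, add_zero]

lemma sy_mul_sy_add_sc [Nonempty ι] : (sy * (sy + sc) : Module.End ℝ (Matrix ι ι ℝ)) = sy := by
  rw [mul_add, sy_mul_sy, sy_mul_sc, add_zero]

lemma sc_mul_sy_add_sc [Nonempty ι] : (sc * (sy + sc) : Module.End ℝ (Matrix ι ι ℝ)) = sc := by
  rw [mul_add, sc_mul_sc, sc_mul_sy, zero_add]

lemma sy_add_sc_mul_sc [Nonempty ι] : ((sy + sc) * sc : Module.End ℝ (Matrix ι ι ℝ)) = sc := by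
  rw [add_mul, sc_mul_sc, sy_mul_sc, zero_add]

/-- An operator commuting with the transposition commutes with the skew projection. -/
lemma sk_mul_of_comm {f : Module.End ℝ (Matrix ι ι ℝ)} (h : transp * f = f * transp) :
    sk * f = f * sk := by
  rw [sk_mul, sk, mul_smul_comm, mul_sub, mul_one, h]

/-- An operator anticommuting with the transposition exchanges skew and symmetric matrices. -/
lemma sk_mul_of_anticomm {f : Module.End ℝ (Matrix ι ι ℝ)} (h : transp * f = -(f * transp)) :
    sk * f = f * (sy + sc) := by
  rw [sk_mul, sy_add_sc, mul_smul_comm, mul_add, mul_one, h, sub_neg_eq_add]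

lemma sy_add_sc_mul_of_anticomm {f : Module.End ℝ (Matrix ι ι ℝ)}
    (h : transp * f = -(f * transp)) : (sy + sc) * f = f * sk := by
  rw [sy_add_sc, sk, mul_smul_comm, smul_mul_assoc, add_mul, one_mul, h, mul_sub, mul_one,
    sub_eq_add_neg]

/-! ### Blocks of operators that commute or anticommute with the transposition. -/

section Parity

variable [Nonempty ι] {f : Module.End ℝ (Matrix ι ι ℝ)}

section Even

variable (h : transp * f = f * transp)
include h

lemma sk_mul_mul_sy_of_comm : sk * f * sy = 0 := by
  rw [sk_mul_of_comm h, mul_assoc, sk_mul_sy, mul_zero]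

lemma sk_mul_mul_sc_of_comm : sk * f * sc = 0 := by
  rw [sk_mul_of_comm h, mul_assoc, sk_mul_sc, mul_zero]

lemma sk_mul_mul_sk_of_comm : sk * f * sk = sk * f := by
  rw [sk_mul_of_comm h, mul_assoc, sk_mul_sk]

lemma sy_mul_mul_sk_of_comm : sy * f * sk = 0 := by
  rw [mul_assoc, ← sk_mul_of_comm h, ← mul_assoc, sy_mul_sk, zero_mul]

lemma sc_mul_mul_sk_of_comm : sc * f * sk = 0 := by
  rw [mul_assoc, ← sk_mul_of_comm h, ← mul_assoc, sc_mul_sk, zero_mul]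

end Even

section Odd

variable (h : transp * f = -(f * transp))
include h

lemma sk_mul_mul_sk_of_anticomm : sk * f * sk = 0 := by
  rw [sk_mul_of_anticomm h, mul_assoc, sy_add_sc_mul_sk, mul_zero]

lemma sk_mul_mul_sy_of_anticomm : sk * f * sy = f * sy := by
  rw [sk_mul_of_anticomm h, mul_assoc, sy_add_sc_mul_sy]

lemma sk_mul_mul_sc_of_anticomm : sk * f * sc = f * sc := by
  rw [sk_mul_of_anticomm h, mul_assoc, sy_add_sc_mul_sc]

lemma sy_mul_mul_sk_of_anticomm : sy * f * sk = sy * f := by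
  rw [mul_assoc, ← sy_add_sc_mul_of_anticomm h, ← mul_assoc, sy_mul_sy_add_sc]

lemma sc_mul_mul_sk_of_anticomm : sc * f * sk = sc * f := by
  rw [mul_assoc, ← sy_add_sc_mul_of_anticomm h, ← mul_assoc, sc_mul_sy_add_sc]

lemma sy_mul_mul_sy_of_anticomm : sy * f * sy = 0 := by
  rw [← sy_mul_mul_sk_of_anticomm h, mul_assoc, sk_mul_sy, mul_zero]

lemma sy_mul_mul_sc_of_anticomm : sy * f * sc = 0 := by
  rw [← sy_mul_mul_sk_of_anticomm h, mul_assoc, sk_mul_sc, mul_zero]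

lemma sc_mul_mul_sy_of_anticomm : sc * f * sy = 0 := by
  rw [← sc_mul_mul_sk_of_anticomm h, mul_assoc, sk_mul_sy, mul_zero]

end Odd

end Parity

/-! Commutation with the transposition. -/

lemma transp_mul_adj_skew {A : Matrix ι ι ℝ} (hA : Aᵀ = -A) :
    transp * adj A = adj A * transp := by
  ext1 X
  simp [hA, add_comm, sub_eq_add_neg]

lemma transp_mul_jor_skew {A : Matrix ι ι ℝ} (hA : Aᵀ = -A) :
    transp * jor A = -(jor A * transp) := by
  ext1 X
  simp [hA, add_comm]

lemma transp_mul_adj_symm {S : Matrix ι ι ℝ} (hS : Sᵀ = S) :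
    transp * adj S = -(adj S * transp) := by
  ext1 X
  simp [hS]

lemma transp_mul_jor_symm {S : Matrix ι ι ℝ} (hS : Sᵀ = S) :
    transp * jor S = jor S * transp := by
  ext1 X
  simp [hS, add_comm]

/-! Traces of the compressions of products of two operators. -/

section Traces

variable [Nonempty ι] {A A' S S' : Matrix ι ι ℝ}

lemma trace_skew_mul_symm (hA : Aᵀ = -A) (hS : Sᵀ = S) : (A * S).trace = 0 := by
  have := Matrix.trace_transpose (A * S)
  rw [Matrix.transpose_mul, hA, hS, mul_neg, Matrix.trace_neg, Matrix.trace_mul_comm] at this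
  linarith

lemma trace_skew (hA : Aᵀ = -A) : A.trace = 0 := by
  simpa using trace_skew_mul_symm hA Matrix.transpose_one

/-- Cyclicity absorbs the repeated idempotents. The longer form has each operator enclosed by
projections on both sides, which is where parity and tensor factorization apply. -/
lemma trace_compress {V : Type*} [AddCommGroup V] [Module ℝ V] {q r : Module.End ℝ V}
    (hq : q * q = q) (hr : r * r = r) (f g : Module.End ℝ V) :
    LinearMap.trace ℝ V ((q * f * r) * (r * g * q)) = LinearMap.trace ℝ V (q * f * r * g) := by
  have : (q * f * r) * (r * g * q) = q * f * (r * r) * g * q := by noncomm_ring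
  rw [this, hr, LinearMap.trace_mul_comm]
  have : q * (q * f * r * g) = (q * q) * f * r * g := by noncomm_ring
  rw [this, hq]

section General

variable {f g : Module.End ℝ (Matrix ι ι ℝ)}

/-- An even operator commutes with `sk`, so the inner projection can be dropped. -/
lemma trace_compress_sk_sk (hf : transp * f = f * transp) :
    LinearMap.trace ℝ _ ((sk * f * sk) * (sk * g * sk)) = LinearMap.trace ℝ _ (sk * (f * g)) := by
  rw [trace_compress sk_mul_sk sk_mul_sk, sk_mul_mul_sk_of_comm hf, mul_assoc]

/-- An even operator need not preserve the splitting of symmetric matrices into trace-free and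
scalar ones; the correction is the path through the scalars, of rank one. -/
lemma trace_compress_sy_sy (hf : transp * f = f * transp) :
    LinearMap.trace ℝ _ ((sy * f * sy) * (sy * g * sy)) = LinearMap.trace ℝ _ (sy * (f * g))
      - (Fintype.card ι : ℝ)⁻¹ * (g (sy (f 1))).trace := by
  have h : sy * f * sy * g = sy * (f * g) - sy * f * (sc * g) := by
    calc sy * f * sy * g = sy * f * (sk + sy + sc) * g - sy * f * sk * g - sy * f * sc * g := by
          noncomm_ring
      _ = _ := by
          rw [sk_add_sy_add_sc, sy_mul_mul_sk_of_comm hf]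
          noncomm_ring
  rw [trace_compress sy_mul_sy sy_mul_sy, h, map_sub, LinearMap.trace_mul_comm _ (sy * f),
    mul_assoc sc, trace_sc_mul]
  rfl

lemma trace_compress_sk_sy (hf : transp * f = -(f * transp)) :
    LinearMap.trace ℝ _ ((sk * f * sy) * (sy * g * sk)) = LinearMap.trace ℝ _ (sy * (g * f)) := by
  rw [trace_compress sk_mul_sk sy_mul_sy, sk_mul_mul_sy_of_anticomm hf, mul_assoc,
    LinearMap.trace_mul_comm, mul_assoc]

lemma trace_compress_sy_sk (hg : transp * g = -(g * transp)) :
    LinearMap.trace ℝ _ ((sy * f * sk) * (sk * g * sy)) = LinearMap.trace ℝ _ (sy * (f * g)) := by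
  rw [LinearMap.trace_mul_comm, trace_compress_sk_sy hg]

lemma trace_compress_sk_sc (hf : transp * f = -(f * transp)) :
    LinearMap.trace ℝ _ ((sk * f * sc) * (sc * g * sk)) =
      (Fintype.card ι : ℝ)⁻¹ * (g (f 1)).trace := by
  rw [trace_compress sk_mul_sk sc_mul_sc, sk_mul_mul_sc_of_anticomm hf, mul_assoc,
    LinearMap.trace_mul_comm, mul_assoc, trace_sc_mul]
  rfl

lemma trace_compress_sy_sc :
    LinearMap.trace ℝ _ ((sy * f * sc) * (sc * g * sy)) =
      (Fintype.card ι : ℝ)⁻¹ * (g (sy (f 1))).trace := by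
  rw [trace_compress sy_mul_sy sc_mul_sc, mul_assoc, LinearMap.trace_mul_comm, mul_assoc,
    trace_sc_mul]
  rfl

end General

section SkewSkew

variable (hA : Aᵀ = -A) (hA' : A'ᵀ = -A')
include hA hA'

/-- This is the Killing form of so(n): half of 2n minus the 4 contributed by the transposition. -/
lemma trace_sk_adj_sk_adj :
    LinearMap.trace ℝ _ ((sk * adj A * sk) * (sk * adj A' * sk)) =
      (Fintype.card ι - 2) * (A * A').trace := by
  rw [trace_compress_sk_sk (transp_mul_adj_skew hA), trace_sk_mul, trace_adj_mul_adj,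
    trace_transp_adj_mul_adj, hA', trace_skew hA, Matrix.mul_neg, Matrix.trace_neg]
  ring

/-- This is the trace form of the representation of so(n) on Sym₀(n); the transposition now enters
with the opposite sign, and the scalar correction vanishes because commutators kill the identity. -/
lemma trace_sy_adj_sy_adj :
    LinearMap.trace ℝ _ ((sy * adj A * sy) * (sy * adj A' * sy)) =
      (Fintype.card ι + 2) * (A * A').trace := by
  rw [trace_compress_sy_sy (transp_mul_adj_skew hA), trace_sy_mul, trace_adj_mul_adj,
    trace_transp_adj_mul_adj, hA', trace_skew hA, Matrix.mul_neg, Matrix.trace_neg]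
  simp
  ring

/-- The anticommutator of two skew matrices may have a trace; removing that scalar component costs
4/n. -/
lemma trace_sy_jor_sk_jor :
    LinearMap.trace ℝ _ ((sy * jor A * sk) * (sk * jor A' * sy)) =
      (Fintype.card ι - 4 / Fintype.card ι) * (A * A').trace := by
  rw [trace_compress_sy_sk (transp_mul_jor_skew hA'), trace_sy_mul, trace_jor_mul_jor,
    trace_transp_jor_mul_jor, hA', trace_skew hA, Matrix.mul_neg, Matrix.trace_neg]
  simp [mul_add, add_mul, Matrix.trace_mul_comm A' A]
  ring

lemma trace_sk_jor_sy_jor :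
    LinearMap.trace ℝ _ ((sk * jor A * sy) * (sy * jor A' * sk)) =
      (Fintype.card ι - 4 / Fintype.card ι) * (A * A').trace := by
  rw [LinearMap.trace_mul_comm, trace_sy_jor_sk_jor hA' hA, Matrix.trace_mul_comm]

lemma trace_sk_jor_sc_jor :
    LinearMap.trace ℝ _ ((sk * jor A * sc) * (sc * jor A' * sk)) =
      4 / Fintype.card ι * (A * A').trace := by
  rw [trace_compress_sk_sc (transp_mul_jor_skew hA)]
  simp [mul_add, add_mul, Matrix.trace_mul_comm A' A]
  ring

end SkewSkew

section SymmSymm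

variable (hS : Sᵀ = S) (hS' : S'ᵀ = S')
include hS hS'

lemma trace_sk_adj_sy_adj :
    LinearMap.trace ℝ _ ((sk * adj S * sy) * (sy * adj S' * sk)) =
      Fintype.card ι * (S * S').trace - S.trace * S'.trace := by
  rw [trace_compress_sk_sy (transp_mul_adj_symm hS), trace_sy_mul, trace_adj_mul_adj,
    trace_transp_adj_mul_adj, hS, Matrix.trace_mul_comm S' S]
  simp
  ring

lemma trace_sy_adj_sk_adj :
    LinearMap.trace ℝ _ ((sy * adj S * sk) * (sk * adj S' * sy)) =
      Fintype.card ι * (S * S').trace - S.trace * S'.trace := by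
  rw [LinearMap.trace_mul_comm, trace_sk_adj_sy_adj hS' hS, Matrix.trace_mul_comm]
  ring

lemma trace_sk_jor_sk_jor :
    LinearMap.trace ℝ _ ((sk * jor S * sk) * (sk * jor S' * sk)) =
      (Fintype.card ι - 2) * (S * S').trace + S.trace * S'.trace := by
  rw [trace_compress_sk_sk (transp_mul_jor_symm hS), trace_sk_mul, trace_jor_mul_jor,
    trace_transp_jor_mul_jor, hS']
  ring

variable (hS0 : S.trace = 0)
include hS0

lemma sy_jor_one : sy (jor S 1) = (2 : ℝ) • S := by
  rw [jor_apply, mul_one, one_mul, sy_apply, sc_apply]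
  simp [hS, hS0]
  module

lemma trace_sy_jor_sy_jor :
    LinearMap.trace ℝ _ ((sy * jor S * sy) * (sy * jor S' * sy)) =
      (Fintype.card ι + 2 - 8 / Fintype.card ι) * (S * S').trace := by
  rw [trace_compress_sy_sy (transp_mul_jor_symm hS), trace_sy_mul, trace_jor_mul_jor,
    trace_transp_jor_mul_jor, hS', sy_jor_one hS hS' hS0, hS0]
  simp [mul_add, add_mul, Matrix.trace_mul_comm S' S]
  ring

lemma trace_sy_jor_sc_jor :
    LinearMap.trace ℝ _ ((sy * jor S * sc) * (sc * jor S' * sy)) =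
      4 / Fintype.card ι * (S * S').trace := by
  rw [trace_compress_sy_sc, sy_jor_one hS hS' hS0]
  simp [Matrix.trace_mul_comm S' S]
  ring

end SymmSymm

section SkewSymm

variable (hA : Aᵀ = -A) (hS : Sᵀ = S)
include hA hS

lemma trace_sk_adj_sk_jor :
    LinearMap.trace ℝ _ ((sk * adj A * sk) * (sk * jor S * sk)) = 0 := by
  rw [trace_compress_sk_sk (transp_mul_adj_skew hA), trace_sk_mul, trace_adj_mul_jor,
    trace_transp_adj_mul_jor]
  simp

lemma trace_sy_adj_sy_jor :
    LinearMap.trace ℝ _ ((sy * adj A * sy) * (sy * jor S * sy)) = 0 := by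
  rw [trace_compress_sy_sy (transp_mul_adj_skew hA), trace_sy_mul, trace_adj_mul_jor,
    trace_transp_adj_mul_jor]
  simp [mul_add, add_mul, Matrix.trace_mul_comm A S]

lemma trace_sk_jor_sy_adj :
    LinearMap.trace ℝ _ ((sk * jor A * sy) * (sy * adj S * sk)) = 0 := by
  rw [trace_compress_sk_sy (transp_mul_jor_skew hA), trace_sy_mul, trace_adj_mul_jor,
    trace_transp_adj_mul_jor]
  simp [mul_add, add_mul, Matrix.trace_mul_comm A S]

lemma trace_sy_jor_sk_adj :
    LinearMap.trace ℝ _ ((sy * jor A * sk) * (sk * adj S * sy)) = 0 := by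
  rw [trace_compress_sy_sk (transp_mul_adj_symm hS), trace_sy_mul, trace_jor_mul_adj,
    trace_transp_jor_mul_adj]
  simp

lemma trace_sk_jor_sk_adj :
    LinearMap.trace ℝ _ ((sk * jor S * sk) * (sk * adj A * sk)) = 0 := by
  rw [LinearMap.trace_mul_comm, trace_sk_adj_sk_jor hA hS]

lemma trace_sy_jor_sy_adj :
    LinearMap.trace ℝ _ ((sy * jor S * sy) * (sy * adj A * sy)) = 0 := by
  rw [LinearMap.trace_mul_comm, trace_sy_adj_sy_jor hA hS]

lemma trace_sy_adj_sk_jor :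
    LinearMap.trace ℝ _ ((sy * adj S * sk) * (sk * jor A * sy)) = 0 := by
  rw [LinearMap.trace_mul_comm, trace_sk_jor_sy_adj hA hS]

lemma trace_sk_adj_sy_jor :
    LinearMap.trace ℝ _ ((sk * adj S * sy) * (sy * jor A * sk)) = 0 := by
  rw [LinearMap.trace_mul_comm, trace_sy_jor_sk_adj hA hS]

end SkewSymm

end Traces

end MatrixEnd

/-! ### Vanishing blocks, and the passage from M_n to M_n ⊗ M_n. -/

namespace MatrixEnd

set_option linter.unusedSectionVars false

variable {ι : Type*} [Fintype ι] [DecidableEq ι]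

section Blocks

variable [Nonempty ι] {C : Matrix ι ι ℝ}

lemma mul_adj_mul_sc (f : Module.End ℝ (Matrix ι ι ℝ)) : f * adj C * sc = 0 := by
  rw [mul_assoc, adj_mul_sc, mul_zero]

lemma sk_adj_sy_skew (h : Cᵀ = -C) : sk * adj C * sy = 0 :=
  sk_mul_mul_sy_of_comm (transp_mul_adj_skew h)

lemma sy_adj_sk_skew (h : Cᵀ = -C) : sy * adj C * sk = 0 :=
  sy_mul_mul_sk_of_comm (transp_mul_adj_skew h)

lemma sk_jor_sk_skew (h : Cᵀ = -C) : sk * jor C * sk = 0 :=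
  sk_mul_mul_sk_of_anticomm (transp_mul_jor_skew h)

lemma sy_jor_sy_skew (h : Cᵀ = -C) : sy * jor C * sy = 0 :=
  sy_mul_mul_sy_of_anticomm (transp_mul_jor_skew h)

lemma sy_jor_sc_skew (h : Cᵀ = -C) : sy * jor C * sc = 0 :=
  sy_mul_mul_sc_of_anticomm (transp_mul_jor_skew h)

lemma sc_jor_sy_skew (h : Cᵀ = -C) : sc * jor C * sy = 0 :=
  sc_mul_mul_sy_of_anticomm (transp_mul_jor_skew h)

lemma sk_jor_sy_symm (h : Cᵀ = C) : sk * jor C * sy = 0 :=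
  sk_mul_mul_sy_of_comm (transp_mul_jor_symm h)

lemma sy_jor_sk_symm (h : Cᵀ = C) : sy * jor C * sk = 0 :=
  sy_mul_mul_sk_of_comm (transp_mul_jor_symm h)

lemma sk_jor_sc_symm (h : Cᵀ = C) : sk * jor C * sc = 0 :=
  sk_mul_mul_sc_of_comm (transp_mul_jor_symm h)

lemma sc_jor_sk_symm (h : Cᵀ = C) : sc * jor C * sk = 0 :=
  sc_mul_mul_sk_of_comm (transp_mul_jor_symm h)

lemma sk_adj_sk_symm (h : Cᵀ = C) : sk * adj C * sk = 0 :=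
  sk_mul_mul_sk_of_anticomm (transp_mul_adj_symm h)

lemma sy_adj_sy_symm (h : Cᵀ = C) : sy * adj C * sy = 0 :=
  sy_mul_mul_sy_of_anticomm (transp_mul_adj_symm h)

lemma transpose_sk (X : Matrix ι ι ℝ) : (sk X)ᵀ = -sk X := by
  simp [sk_apply]
  module

lemma transpose_sy (X : Matrix ι ι ℝ) : (sy X)ᵀ = sy X := by
  simp [sy_apply, sc_apply, add_comm]

lemma trace_sy (X : Matrix ι ι ℝ) : (sy X).trace = 0 := by
  have : (Fintype.card ι : ℝ) ≠ 0 := by simp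
  simp [sy_apply, sc_apply]
  field_simp
  ring

end Blocks

/-! ### Kronecker products of endomorphisms -/

/-- The endomorphism `X ⊗ Y ↦ f X ⊗ g Y`. -/
noncomputable def kmap (f g : Module.End ℝ (Matrix ι ι ℝ)) :
    Module.End ℝ (Matrix (ι × ι) (ι × ι) ℝ) :=
  (kroneckerLinearEquiv ι ι ι ι ℝ).conj (TensorProduct.map f g)

@[simp] lemma kmap_kronecker (f g : Module.End ℝ (Matrix ι ι ℝ)) (X Y : Matrix ι ι ℝ) :
    kmap f g (X ⊗ₖ Y) = f X ⊗ₖ g Y := by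
  simp [kmap, LinearEquiv.conj_apply]

lemma kmap_mul (f g f' g' : Module.End ℝ (Matrix ι ι ℝ)) :
    kmap f g * kmap f' g' = kmap (f * f') (g * g') := by
  rw [kmap, kmap, kmap, TensorProduct.map_mul]
  exact ((kroneckerLinearEquiv ι ι ι ι ℝ).conj_comp _ _).symm

lemma kmap_add_left (f f' g : Module.End ℝ (Matrix ι ι ℝ)) :
    kmap (f + f') g = kmap f g + kmap f' g := by
  simp [kmap, TensorProduct.map_add_left]

lemma kmap_add_right (f g g' : Module.End ℝ (Matrix ι ι ℝ)) :
    kmap f (g + g') = kmap f g + kmap f g' := by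
  simp [kmap, TensorProduct.map_add_right]

@[simp] lemma kmap_zero_left (g : Module.End ℝ (Matrix ι ι ℝ)) : kmap 0 g = 0 := by
  simp [kmap]

@[simp] lemma kmap_zero_right (f : Module.End ℝ (Matrix ι ι ℝ)) : kmap f 0 = 0 := by
  simp [kmap]

lemma trace_kmap (f g : Module.End ℝ (Matrix ι ι ℝ)) : LinearMap.trace ℝ _ (kmap f g) =
    LinearMap.trace ℝ _ f * LinearMap.trace ℝ _ g := by
  rw [kmap, LinearMap.trace_conj', LinearMap.trace_tensorProduct']

lemma kronecker_induction {p : Matrix (ι × ι) (ι × ι) ℝ → Prop}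
    (add : ∀ X Y, p X → p Y → p (X + Y)) (kron : ∀ X Y : Matrix ι ι ℝ, p (X ⊗ₖ Y))
    (X : Matrix (ι × ι) (ι × ι) ℝ) : p X := by
  obtain ⟨t, rfl⟩ := (kroneckerLinearEquiv ι ι ι ι ℝ).surjective X
  induction t with
  | zero => simpa using kron 0 0
  | tmul x y => simpa using kron x y
  | add x y hx hy => rw [map_add]; exact add _ _ hx hy

lemma kronecker_induction₂ {p : Matrix (ι × ι) (ι × ι) ℝ → Matrix (ι × ι) (ι × ι) ℝ → Prop}
    (add_left : ∀ X Y Z, p X Z → p Y Z → p (X + Y) Z)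
    (add_right : ∀ X Y Z, p X Y → p X Z → p X (Y + Z))
    (kron : ∀ X Y X' Y' : Matrix ι ι ℝ, p (X ⊗ₖ Y) (X' ⊗ₖ Y')) (X Y : Matrix (ι × ι) (ι × ι) ℝ) :
    p X Y :=
  kronecker_induction (p := fun X => ∀ Y, p X Y) (fun _ _ h h' Y => add_left _ _ _ (h Y) (h' Y))
    (fun X X' => kronecker_induction (add_right _) (kron X X')) X Y

lemma End_ext_kronecker {f g : Module.End ℝ (Matrix (ι × ι) (ι × ι) ℝ)}
    (h : ∀ X Y : Matrix ι ι ℝ, f (X ⊗ₖ Y) = g (X ⊗ₖ Y)) : f = g :=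
  LinearMap.ext (kronecker_induction (fun X Y hX hY => by rw [map_add, map_add, hX, hY]) h)

/-- In CX ⊗ DY - XC ⊗ YD, replace each one-sided product by half of commutator plus or minus
anticommutator: the terms ad ⊗ ad and jor ⊗ jor cancel. -/
lemma adj_kronecker (C D : Matrix ι ι ℝ) : adj (C ⊗ₖ D) =
    (1 / 2 : ℝ) • (kmap (adj C) (jor D) + kmap (jor C) (adj D)) := by
  refine End_ext_kronecker fun X Y => ?_
  simp only [adj_apply, LinearMap.smul_apply, LinearMap.add_apply, kmap_kronecker, jor_apply,
    ← Matrix.mul_kronecker_mul, sub_eq_add_neg, Matrix.add_kronecker, Matrix.kronecker_add,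
    ← neg_one_smul ℝ (_ * _ : Matrix ι ι ℝ), Matrix.smul_kronecker, Matrix.kronecker_smul]
  module

lemma kmap_mul_adj_mul_kmap (q q' r r' : Module.End ℝ (Matrix ι ι ℝ)) (C D : Matrix ι ι ℝ) :
    kmap q q' * adj (C ⊗ₖ D) * kmap r r' =
      (1 / 2 : ℝ) • (kmap (q * adj C * r) (q' * jor D * r')
        + kmap (q * jor C * r) (q' * adj D * r')) := by
  rw [adj_kronecker, mul_smul_comm, smul_mul_assoc, mul_add, add_mul]
  simp only [kmap_mul]

lemma adj_add (C D : Matrix ι ι ℝ) : adj (C + D) = adj C + adj D := by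
  ext1 X
  simp [add_mul, mul_add]
  abel

/-- The projections onto `so(n) ⊗ Sym₀(n)` and `Sym₀(n) ⊗ so(n)`. -/
noncomputable def prj : Fin 2 → Module.End ℝ (Matrix (ι × ι) (ι × ι) ℝ) :=
  ![kmap sk sy, kmap sy sk]

/-- The projection onto `so(n) ⊗ 1 + 1 ⊗ so(n)`. -/
noncomputable def prjK : Module.End ℝ (Matrix (ι × ι) (ι × ι) ℝ) := kmap sk sc + kmap sc sk

variable [Nonempty ι]

lemma prj_mul_self (i : Fin 2) :
    (prj i * prj i : Module.End ℝ (Matrix (ι × ι) (ι × ι) ℝ)) = prj i := by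
  fin_cases i <;> simp [prj, kmap_mul, sk_mul_sk, sy_mul_sy]

lemma prj_mul_of_ne {i j : Fin 2} (h : i ≠ j) :
    (prj i * prj j : Module.End ℝ (Matrix (ι × ι) (ι × ι) ℝ)) = 0 := by
  fin_cases i <;> fin_cases j <;> simp [prj, kmap_mul, sk_mul_sy, sy_mul_sk] at h ⊢

lemma prj_mul_prjK (i : Fin 2) :
    (prj i * prjK : Module.End ℝ (Matrix (ι × ι) (ι × ι) ℝ)) = 0 := by
  fin_cases i <;> simp [prj, prjK, mul_add, kmap_mul, sk_mul_sc, sy_mul_sk, sy_mul_sc]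

lemma prjK_mul_prj (i : Fin 2) :
    (prjK * prj i : Module.End ℝ (Matrix (ι × ι) (ι × ι) ℝ)) = 0 := by
  fin_cases i <;> simp [prj, prjK, add_mul, kmap_mul, sk_mul_sy, sc_mul_sk, sc_mul_sy]

lemma prjK_mul_self : (prjK * prjK : Module.End ℝ (Matrix (ι × ι) (ι × ι) ℝ)) = prjK := by
  simp [prjK, add_mul, mul_add, kmap_mul, sk_mul_sc, sc_mul_sk, sc_mul_sc, sk_mul_sk]

/-- The coefficients of the traces of compressed products of two commutators. -/
noncomputable def blockCoeff (n : ℝ) (i j m : Fin 2) : ℝ :=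
  if i = j ∧ i = m then (n - 2) ^ 2 * (n + 4) / (4 * n) else (n ^ 2 - 4) / 4

/-- The source of all curvature constants. On pure tensors each compressed commutator is a sum of
two Kronecker products of blocks, at least one of which vanishes by parity. The remaining traces
multiply factor by factor, and mixed traces of `adj` against `jor` vanish, which separates 𝔭₁ from
𝔭₂. -/
lemma trace_prj_adj_prj_adj (i j m l : Fin 2) (U V : Matrix (ι × ι) (ι × ι) ℝ) :
    LinearMap.trace ℝ _ (prj i * adj (prj m U) * prj j * adj (prj l V)) =
      if m = l then blockCoeff (Fintype.card ι) i j m * (prj m U * prj l V).trace else 0 := by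
  have hn : (Fintype.card ι : ℝ) ≠ 0 := by simp
  induction U, V using kronecker_induction₂ with
  | add_left X Y Z h h' | add_right X Y Z h h' =>
    simp only [map_add, adj_add, mul_add, add_mul, h, h', Matrix.trace_add]
    split_ifs <;> ring
  | kron X Y X' Y' =>
    -- Both commutators are enclosed by projections, so that the parity lemmas apply to each factor.
    rw [← trace_compress (prj_mul_self i) (prj_mul_self j)]
    have hX := transpose_sk X
    have hX' := transpose_sk X'
    have hY := transpose_sk Y
    have hY' := transpose_sk Y'
    have kX := transpose_sy X
    have kX' := transpose_sy X'
    have kY := transpose_sy Y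
    have kY' := transpose_sy Y'
    have tX := trace_sy X
    have tX' := trace_sy X'
    have tY := trace_sy Y
    have tY' := trace_sy Y'
    fin_cases i <;> fin_cases j <;> fin_cases m <;> fin_cases l <;>
    simp [prj, kmap_mul_adj_mul_kmap, kmap_mul, trace_kmap, sk_adj_sy_skew, sy_adj_sk_skew,
      sk_jor_sk_skew, sy_jor_sy_skew, sk_jor_sy_symm, sy_jor_sk_symm, sk_adj_sk_symm,
      sy_adj_sy_symm, hX, hX', hY, hY', kX, kX', kY, kY', blockCoeff, ← Matrix.mul_kronecker_mul,
      Matrix.trace_kronecker, trace_sk_adj_sk_adj, trace_sy_adj_sy_adj, trace_sy_jor_sk_jor,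
      trace_sk_jor_sy_jor, trace_sk_adj_sy_adj, trace_sy_adj_sk_adj, trace_sk_jor_sk_jor,
      trace_sy_jor_sy_jor, trace_sk_adj_sk_jor, trace_sy_adj_sy_jor, trace_sk_jor_sy_adj,
      trace_sy_jor_sk_adj, trace_sk_jor_sk_adj, trace_sy_jor_sy_adj, trace_sy_adj_sk_jor,
      trace_sk_adj_sy_jor, tX, tX', tY, tY'] <;> field_simp <;> ring

/-- The same computation with the isotropy algebra as intermediate space. A bracket of two elements
of different summands has no 𝔨-component, hence the condition that all indices agree. -/
lemma trace_prj_adj_prjK_adj (i m l : Fin 2) (U V : Matrix (ι × ι) (ι × ι) ℝ) :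
    LinearMap.trace ℝ _ (prj i * adj (prj m U) * prjK * adj (prj l V)) =
      if m = l ∧ i = m then (2 * Fintype.card ι - 2) / Fintype.card ι *
        (prj m U * prj l V).trace else 0 := by
  have hn : (Fintype.card ι : ℝ) ≠ 0 := by simp
  induction U, V using kronecker_induction₂ with
  | add_left X Y Z h h' | add_right X Y Z h h' =>
    simp only [map_add, adj_add, mul_add, add_mul, h, h', Matrix.trace_add]
    split_ifs <;> ring
  | kron X Y X' Y' =>
    have h₁ : (kmap sk sc * kmap sk sc : Module.End ℝ (Matrix (ι × ι) (ι × ι) ℝ)) = kmap sk sc := by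
      rw [kmap_mul, sk_mul_sk, sc_mul_sc]
    have h₂ : (kmap sc sk * kmap sc sk : Module.End ℝ (Matrix (ι × ι) (ι × ι) ℝ)) = kmap sc sk := by
      rw [kmap_mul, sk_mul_sk, sc_mul_sc]
    -- The projection to 𝔨 is not a Kronecker product; its two ideals are treated separately.
    rw [prjK, mul_add, add_mul, map_add, ← trace_compress (prj_mul_self i) h₁,
      ← trace_compress (prj_mul_self i) h₂]
    have hX := transpose_sk X
    have hX' := transpose_sk X'
    have hY := transpose_sk Y
    have hY' := transpose_sk Y'
    have kX := transpose_sy X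
    have kX' := transpose_sy X'
    have kY := transpose_sy Y
    have kY' := transpose_sy Y'
    have tX := trace_sy X
    have tX' := trace_sy X'
    have tY := trace_sy Y
    have tY' := trace_sy Y'
    fin_cases i <;> fin_cases m <;> fin_cases l <;>
    simp [prj, kmap_mul_adj_mul_kmap, kmap_mul, trace_kmap, sk_adj_sy_skew, sy_adj_sk_skew,
      sk_jor_sk_skew, sk_jor_sy_symm, sy_jor_sk_symm, sk_adj_sk_symm,
      mul_adj_mul_sc, sy_jor_sc_skew, sc_jor_sy_skew, sk_jor_sc_symm,
      sc_jor_sk_symm, sc_mul_adj, hX, hX', hY, hY', kX, kX', kY, kY',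
      ← Matrix.mul_kronecker_mul, Matrix.trace_kronecker, trace_sk_adj_sk_adj,
      trace_sy_adj_sk_adj, trace_sk_jor_sc_jor,
      trace_sy_jor_sc_jor, tX, tX', tY, tY'] <;> field_simp <;> ring

lemma trace_sk : LinearMap.trace ℝ _ (sk : Module.End ℝ (Matrix ι ι ℝ)) =
    Fintype.card ι * (Fintype.card ι - 1) / 2 := by
  have h := trace_transp_sandwich (1 : Matrix ι ι ℝ) 1
  have h' := trace_sandwich (1 : Matrix ι ι ℝ) 1
  simp only [LinearMap.mulLeft_one, LinearMap.mulRight_one, ← Module.End.one_eq_id, mul_one,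
    Matrix.transpose_one, Matrix.trace_one] at h h'
  rw [← mul_one sk, trace_sk_mul, mul_one, h, h']
  ring

lemma trace_sy_end : LinearMap.trace ℝ _ (sy : Module.End ℝ (Matrix ι ι ℝ)) =
    (Fintype.card ι - 1) * (Fintype.card ι + 2) / 2 := by
  have hn : (Fintype.card ι : ℝ) ≠ 0 := by simp
  have h := trace_transp_sandwich (1 : Matrix ι ι ℝ) 1
  have h' := trace_sandwich (1 : Matrix ι ι ℝ) 1
  simp only [LinearMap.mulLeft_one, LinearMap.mulRight_one, ← Module.End.one_eq_id, mul_one,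
    Matrix.transpose_one, Matrix.trace_one] at h h'
  rw [← mul_one sy, trace_sy_mul, mul_one, h, h', Module.End.one_apply, Matrix.trace_one]
  field_simp
  ring

lemma trace_prj (i : Fin 2) :
    LinearMap.trace ℝ _ (prj i : Module.End ℝ (Matrix (ι × ι) (ι × ι) ℝ)) =
      Fintype.card ι * (Fintype.card ι - 1) ^ 2 * (Fintype.card ι + 2) / 4 := by
  fin_cases i <;> simp [prj, trace_kmap, trace_sk, trace_sy_end] <;> ring

/-! The projections are self-adjoint for the trace pairing. -/

lemma trace_sk_apply_mul (X Y : Matrix ι ι ℝ) : (sk X * Y).trace = (X * sk Y).trace := by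
  have h : (Xᵀ * Y).trace = (X * Yᵀ).trace := by
    rw [trace_mul_transpose_comm, Matrix.trace_mul_comm]
  simp [sk_apply, sub_mul, mul_sub, h]

lemma trace_sc_apply_mul (X Y : Matrix ι ι ℝ) : (sc X * Y).trace = (X * sc Y).trace := by
  simp [sc_apply]
  ring

lemma trace_sy_apply_mul (X Y : Matrix ι ι ℝ) : (sy X * Y).trace = (X * sy Y).trace := by
  have h : (Xᵀ * Y).trace = (X * Yᵀ).trace := by
    rw [trace_mul_transpose_comm, Matrix.trace_mul_comm]
  simp [sy_apply, sub_mul, mul_sub, add_mul, mul_add, h, trace_sc_apply_mul]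

lemma trace_kmap_apply_mul {f f' g g' : Module.End ℝ (Matrix ι ι ℝ)}
    (hf : ∀ X Y, (f X * Y).trace = (X * f' Y).trace)
    (hg : ∀ X Y, (g X * Y).trace = (X * g' Y).trace) (U V : Matrix (ι × ι) (ι × ι) ℝ) :
    (kmap f g U * V).trace = (U * kmap f' g' V).trace := by
  induction U, V using kronecker_induction₂ with
  | add_left X Y Z h h' | add_right X Y Z h h' =>
    simp only [map_add, add_mul, mul_add, Matrix.trace_add, h, h']
  | kron X Y X' Y' =>
    simp [← Matrix.mul_kronecker_mul, Matrix.trace_kronecker, hf, hg]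

lemma trace_prj_apply_mul (i : Fin 2) (U V : Matrix (ι × ι) (ι × ι) ℝ) :
    (prj i U * V).trace = (U * prj i V).trace := by
  fin_cases i
  · exact trace_kmap_apply_mul trace_sk_apply_mul trace_sy_apply_mul U V
  · exact trace_kmap_apply_mul trace_sy_apply_mul trace_sk_apply_mul U V

lemma trace_prjK_apply_mul (U V : Matrix (ι × ι) (ι × ι) ℝ) :
    (prjK U * V).trace = (U * prjK V).trace := by
  rw [prjK, LinearMap.add_apply, LinearMap.add_apply, add_mul, mul_add, Matrix.trace_add,
    Matrix.trace_add, trace_kmap_apply_mul trace_sk_apply_mul trace_sc_apply_mul,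
    trace_kmap_apply_mul trace_sc_apply_mul trace_sk_apply_mul]

/-- The skew part of a tensor product. -/
lemma sk_eq_prj_add_prjK :
    (sk : Module.End ℝ (Matrix (ι × ι) (ι × ι) ℝ)) = prj 0 + prj 1 + prjK := by
  refine End_ext_kronecker fun X Y => ?_
  have h : (prj 0 + prj 1 + prjK : Module.End ℝ (Matrix (ι × ι) (ι × ι) ℝ)) =
      kmap sk (sy + sc) + kmap (sy + sc) sk := by
    rw [kmap_add_left, kmap_add_right, prjK]
    simp only [prj, Matrix.cons_val_zero, Matrix.cons_val_one]
    abel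
  rw [h, sy_add_sc]
  simp only [sk_apply, LinearMap.add_apply, kmap_kronecker, LinearMap.smul_apply,
    Module.End.one_apply, transp_apply, Matrix.smul_kronecker, Matrix.kronecker_smul,
    Matrix.add_kronecker, Matrix.kronecker_add, sub_eq_add_neg, ← neg_one_smul ℝ (_ᵀ),
    Matrix.kroneckerMap_transpose]
  module

end MatrixEnd

namespace TensorSO

open LieAlgebra.Orthogonal MatrixEnd

/-! ### The Killing form of `so(N)` -/

section Killing

variable {ι : Type*} [Fintype ι] [DecidableEq ι]

/-- The skew part of a matrix, as an element of `so(N)`. -/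
noncomputable def toSo : Matrix ι ι ℝ →ₗ[ℝ] so ι ℝ where
  toFun X := ⟨sk X, (mem_so _ _ _).2 (by rw [sk_apply]; simp; module)⟩
  map_add' X Y := Subtype.ext (map_add sk X Y)
  map_smul' c X := Subtype.ext (map_smul sk c X)

/-- The inclusion of `so(N)` into the matrices, as a linear map. -/
def coeSo : so ι ℝ →ₗ[ℝ] Matrix ι ι ℝ where
  toFun X := X
  map_add' _ _ := rfl
  map_smul' _ _ := rfl

lemma coe_toSo (X : Matrix ι ι ℝ) : (toSo X : Matrix ι ι ℝ) = sk X := rfl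

lemma sk_coe (X : so ι ℝ) : sk (X : Matrix ι ι ℝ) = X := by
  rw [sk_apply, (mem_so _ _ _).1 X.2]
  module

lemma toSo_coe (X : so ι ℝ) : toSo (X : Matrix ι ι ℝ) = X := Subtype.ext (sk_coe X)

lemma coe_lie (X Y : so ι ℝ) : ((⁅X, Y⁆ : so ι ℝ) : Matrix ι ι ℝ) = adj (X : Matrix ι ι ℝ) Y := rfl

/-- so(N) is a retract of the matrix space by `toSo` and `coeSo`, so cyclicity of the trace moves
the computation there. -/
lemma killingForm_eq [Nonempty ι] (X Y : so ι ℝ) : killingForm ℝ (so ι ℝ) X Y =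
    (Fintype.card ι - 2) * ((X : Matrix ι ι ℝ) * (Y : Matrix ι ι ℝ)).trace := by
  have hX := (mem_so _ _ _).1 X.2
  have hY := (mem_so _ _ _).1 Y.2
  have h : LieAlgebra.ad ℝ (so ι ℝ) X ∘ₗ LieAlgebra.ad ℝ (so ι ℝ) Y =
      (toSo ∘ₗ (adj (X : Matrix ι ι ℝ) * adj (Y : Matrix ι ι ℝ))) ∘ₗ coeSo := by
    ext1 Z
    exact (toSo_coe ⁅X, ⁅Y, Z⁆⁆).symm
  rw [killingForm_apply_apply, h, LinearMap.trace_comp_comm', ← trace_sk_adj_sk_adj hX hY,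
    trace_compress_sk_sk (transp_mul_adj_skew hX)]
  rfl

end Killing

variable {n : ℕ} [Nonempty (Fin n)]

lemma killingForm_pair_eq (X Y : so (Fin n × Fin n) ℝ) : killingForm ℝ (so (Fin n × Fin n) ℝ) X Y =
    ((n : ℝ) ^ 2 - 2) * ((X : Matrix (Fin n × Fin n) (Fin n × Fin n) ℝ) * Y).trace := by
  rw [killingForm_eq]
  simp [sq]

/-! ### The spaces `𝔨`, `𝔭`, `𝔭₁`, `𝔭₂` in terms of the projections -/

lemma coe_eq_prj_add_prjK (X : so (Fin n × Fin n) ℝ) :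
    prj 0 (X : Matrix (Fin n × Fin n) (Fin n × Fin n) ℝ) +
      prj 1 (X : Matrix (Fin n × Fin n) (Fin n × Fin n) ℝ) +
      prjK (X : Matrix (Fin n × Fin n) (Fin n × Fin n) ℝ) = X := by
  have := LinearMap.congr_fun (sk_eq_prj_add_prjK (ι := Fin n)) X
  rw [sk_coe] at this
  exact this.symm

lemma sk_prj (i : Fin 2) (U : Matrix (Fin n × Fin n) (Fin n × Fin n) ℝ) :
    sk (prj i U) = prj i U := by
  rw [sk_eq_prj_add_prjK, ← Module.End.mul_apply, add_mul, add_mul, prjK_mul_prj]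
  fin_cases i
  · simp [prj_mul_self, prj_mul_of_ne]
  · simp [prj_mul_self, prj_mul_of_ne]

lemma prjK_eq (U : Matrix (Fin n × Fin n) (Fin n × Fin n) ℝ) :
    ∃ A ∈ so (Fin n) ℝ, ∃ B ∈ so (Fin n) ℝ,
      prjK U = A ⊗ₖ (1 : Matrix (Fin n) (Fin n) ℝ) + (1 : Matrix (Fin n) (Fin n) ℝ) ⊗ₖ B := by
  induction U using kronecker_induction with
  | add U V hU hV =>
    obtain ⟨A, hA, B, hB, h⟩ := hU
    obtain ⟨A', hA', B', hB', h'⟩ := hV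
    refine ⟨A + A', add_mem hA hA', B + B', add_mem hB hB', ?_⟩
    rw [map_add, h, h', Matrix.add_kronecker, Matrix.kronecker_add]
    abel
  | kron X Y =>
    refine ⟨_, SMulMemClass.smul_mem ((Fintype.card (Fin n) : ℝ)⁻¹ * Y.trace) (toSo X).2, _,
      SMulMemClass.smul_mem ((Fintype.card (Fin n) : ℝ)⁻¹ * X.trace) (toSo Y).2, ?_⟩
    simp only [prjK, LinearMap.add_apply, kmap_kronecker, sc_apply, coe_toSo,
      Matrix.kronecker_smul, Matrix.smul_kronecker]

lemma prjK_of_mem {X : so (Fin n × Fin n) ℝ} (hX : X ∈ isotropyAlgebra n) :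
    prjK (X : Matrix (Fin n × Fin n) (Fin n × Fin n) ℝ) = X := by
  obtain ⟨A, hA, B, hB, h⟩ := hX
  have h1 : sc (1 : Matrix (Fin n) (Fin n) ℝ) = 1 := by 
    rw [sc_apply, Matrix.trace_one, inv_mul_cancel₀ (Nat.cast_ne_zero.2 Fintype.card_ne_zero), one_smul]
  have h2 : sk (1 : Matrix (Fin n) (Fin n) ℝ) = 0 := by simp [sk_apply]
  have hsc : ∀ A ∈ so (Fin n) ℝ, sc A = 0 := fun A hA => by
    rw [sc_apply, trace_skew ((mem_so _ _ _).1 hA), mul_zero, zero_smul]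
  rw [h, map_add]
  simp [prjK, h1, h2, sk_coe ⟨A, hA⟩, sk_coe ⟨B, hB⟩, hsc A hA, hsc B hB]

/-- The projection to `𝔨`, with values in `𝔨`. -/
lemma mem_isotropy_of_coe_eq {X : so (Fin n × Fin n) ℝ}
    {U : Matrix (Fin n × Fin n) (Fin n × Fin n) ℝ}
    (h : (X : Matrix (Fin n × Fin n) (Fin n × Fin n) ℝ) = prjK U) : X ∈ isotropyAlgebra n := by
  obtain ⟨A, hA, B, hB, hU⟩ := prjK_eq U
  exact ⟨A, hA, B, hB, h.trans hU⟩

lemma sk_prjK (U : Matrix (Fin n × Fin n) (Fin n × Fin n) ℝ) : sk (prjK U) = prjK U := by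
  rw [sk_eq_prj_add_prjK, ← Module.End.mul_apply, add_mul, add_mul, prjK_mul_self]
  simp [prj_mul_prjK]

lemma mem_complement_iff (hn : 3 ≤ n) (X : so (Fin n × Fin n) ℝ) :
    X ∈ complement n ↔ prjK (X : Matrix (Fin n × Fin n) (Fin n × Fin n) ℝ) = 0 := by
  rw [mem_complement]
  constructor
  · intro h
    -- The 𝔨-component of X is tested against X itself: orthogonality makes its Killing norm zero,
    -- and definiteness makes it vanish.
    have hZ : ((toSo (prjK (X : Matrix (Fin n × Fin n) (Fin n × Fin n) ℝ)) :
        so (Fin n × Fin n) ℝ) : Matrix (Fin n × Fin n) (Fin n × Fin n) ℝ) = prjK X := by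
      rw [coe_toSo, sk_prjK]
    have h0 := h _ (mem_isotropy_of_coe_eq hZ)
    by_contra hne
    have := killingForm_self_neg (three_le_card hn) _ fun h0 => hne
      (hZ.symm.trans (congrArg Subtype.val h0))
    rw [killingForm_pair_eq, hZ] at h0 this
    rw [trace_prjK_apply_mul, ← Module.End.mul_apply, prjK_mul_self, ← trace_prjK_apply_mul, h0]
      at this
    exact lt_irrefl _ this
  · intro h Z hZ
    rw [killingForm_pair_eq, ← prjK_of_mem hZ, trace_prjK_apply_mul, h]
    simp

lemma coe_mem_prj_zero (U : Matrix (Fin n × Fin n) (Fin n × Fin n) ℝ) :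
    toSo (prj 0 U) ∈ p₁ n := by
  induction U using kronecker_induction with
  | add U V hU hV => rw [map_add, map_add]; exact add_mem hU hV
  | kron X Y =>
    refine Submodule.subset_span ⟨sk X, sy Y, transpose_sk X, transpose_sy Y, trace_sy Y, ?_⟩
    rw [coe_toSo, sk_prj]
    simp [prj]

lemma coe_mem_prj_one (U : Matrix (Fin n × Fin n) (Fin n × Fin n) ℝ) :
    toSo (prj 1 U) ∈ p₂ n := by
  induction U using kronecker_induction with
  | add U V hU hV => rw [map_add, map_add]; exact add_mem hU hV
  | kron X Y =>
    refine Submodule.subset_span ⟨sy X, sk Y, transpose_sy X, trace_sy X, transpose_sk Y, ?_⟩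
    rw [coe_toSo, sk_prj]
    simp [prj]

lemma sk_of_skew {A : Matrix (Fin n) (Fin n) ℝ} (hA : Aᵀ = -A) : sk A = A :=
  sk_coe ⟨A, (mem_so _ _ _).2 hA⟩

lemma sy_of_symm {S : Matrix (Fin n) (Fin n) ℝ} (hS : Sᵀ = S) (h0 : S.trace = 0) : sy S = S := by
  rw [sy_apply, sc_apply, hS, h0]
  module

lemma mem_p₁_iff (X : so (Fin n × Fin n) ℝ) :
    X ∈ p₁ n ↔ prj 0 (X : Matrix (Fin n × Fin n) (Fin n × Fin n) ℝ) = X := by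
  constructor
  · intro h
    induction h using Submodule.span_induction with
    | mem X h =>
      obtain ⟨A, S, hA, hS, h0, h⟩ := h
      simp [h, prj, sk_of_skew hA, sy_of_symm hS h0]
    | zero => simp
    | add X Y _ _ hX hY =>
      change prj 0 ((X : Matrix (Fin n × Fin n) (Fin n × Fin n) ℝ) + (Y : Matrix (Fin n × Fin n) (Fin n × Fin n) ℝ)) = _ + _
      rw [map_add, hX, hY]
    | smul c X _ hX =>
      change prj 0 (c • (X : Matrix (Fin n × Fin n) (Fin n × Fin n) ℝ)) = c • _
      rw [map_smul, hX]
  · intro h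
    have := coe_mem_prj_zero (X : Matrix (Fin n × Fin n) (Fin n × Fin n) ℝ)
    rwa [h, toSo_coe] at this

lemma mem_p₂_iff (X : so (Fin n × Fin n) ℝ) :
    X ∈ p₂ n ↔ prj 1 (X : Matrix (Fin n × Fin n) (Fin n × Fin n) ℝ) = X := by
  constructor
  · intro h
    induction h using Submodule.span_induction with
    | mem X h =>
      obtain ⟨S, A, hS, h0, hA, h⟩ := h
      simp [h, prj, sk_of_skew hA, sy_of_symm hS h0]
    | zero => simp
    | add X Y _ _ hX hY =>
      change prj 1 ((X : Matrix (Fin n × Fin n) (Fin n × Fin n) ℝ) + (Y : Matrix (Fin n × Fin n) (Fin n × Fin n) ℝ)) = _ + _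
      rw [map_add, hX, hY]
    | smul c X _ hX =>
      change prj 1 (c • (X : Matrix (Fin n × Fin n) (Fin n × Fin n) ℝ)) = c • _
      rw [map_smul, hX]
  · intro h
    have := coe_mem_prj_one (X : Matrix (Fin n × Fin n) (Fin n × Fin n) ℝ)
    rwa [h, toSo_coe] at this

end TensorSO

/-! ### Conjugation by the isotropy group, invariance and dimension of the summands. -/

namespace TensorSO

open LieAlgebra.Orthogonal MatrixEnd

/-- Conjugation `X ↦ Q X Qᵀ`. -/
noncomputable def conjEnd {ι : Type*} [Fintype ι] (Q : Matrix ι ι ℝ) :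
    Module.End ℝ (Matrix ι ι ℝ) :=
  LinearMap.mulLeft ℝ Q * LinearMap.mulRight ℝ Qᵀ

lemma conjEnd_apply {ι : Type*} [Fintype ι] (Q X : Matrix ι ι ℝ) :
    conjEnd Q X = Q * X * Qᵀ := by
  simp [conjEnd, Matrix.mul_assoc]

lemma conjEnd_kronecker {ι : Type*} [Fintype ι] [DecidableEq ι] (P Q : Matrix ι ι ℝ) :
    conjEnd (P ⊗ₖ Q) = kmap (conjEnd P) (conjEnd Q) := by
  refine End_ext_kronecker fun X Y => ?_
  rw [kmap_kronecker, conjEnd_apply, conjEnd_apply, conjEnd_apply, ← Matrix.kroneckerMap_transpose]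
  simp only [← Matrix.mul_kronecker_mul]

variable {n : ℕ} [Nonempty (Fin n)]

lemma conjEnd_mul_sk (Q : Matrix (Fin n) (Fin n) ℝ) : conjEnd Q * sk = sk * conjEnd Q := by
  ext1 X
  simp [conjEnd_apply, sk_apply, Matrix.mul_sub, Matrix.sub_mul, Matrix.mul_assoc]

lemma conjEnd_mul_sy (Q : Matrix.specialOrthogonalGroup (Fin n) ℝ) :
    conjEnd (Q : Matrix (Fin n) (Fin n) ℝ) * sy = sy * conjEnd (Q : Matrix (Fin n) (Fin n) ℝ) := by
  ext1 X
  have h : ((Q : Matrix (Fin n) (Fin n) ℝ) * X * (Q : Matrix (Fin n) (Fin n) ℝ)ᵀ).trace =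
      X.trace := by
    rw [Matrix.trace_mul_comm, ← Matrix.mul_assoc, transpose_mul_self, Matrix.one_mul]
  simp [conjEnd_apply, sy_apply, sc_apply, Matrix.mul_sub, Matrix.sub_mul, Matrix.mul_add,
    Matrix.add_mul, h, mul_transpose_self]
  simp [Matrix.mul_assoc]

lemma conjEnd_mul_prj (P Q : Matrix.specialOrthogonalGroup (Fin n) ℝ) (i : Fin 2) :
    conjEnd ((P : Matrix (Fin n) (Fin n) ℝ) ⊗ₖ (Q : Matrix (Fin n) (Fin n) ℝ)) * prj i =
      prj i * conjEnd ((P : Matrix (Fin n) (Fin n) ℝ) ⊗ₖ (Q : Matrix (Fin n) (Fin n) ℝ)) := by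
  rw [conjEnd_kronecker]
  fin_cases i <;> simp [prj, kmap_mul, conjEnd_mul_sk, conjEnd_mul_sy]

lemma coe_Ad {ι : Type*} [Fintype ι] [DecidableEq ι] (Q : Matrix.specialOrthogonalGroup ι ℝ)
    (X : so ι ℝ) : (Ad Q X : Matrix ι ι ℝ) = conjEnd (Q : Matrix ι ι ℝ) X :=
  (conjEnd_apply _ _).symm

lemma prj_Ad {k : Matrix.specialOrthogonalGroup (Fin n × Fin n) ℝ} (hk : k ∈ K n) (i : Fin 2)
    (X : so (Fin n × Fin n) ℝ) :
    prj i (Ad k X : Matrix (Fin n × Fin n) (Fin n × Fin n) ℝ) =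
      conjEnd (k : Matrix (Fin n × Fin n) (Fin n × Fin n) ℝ) (prj i X) := by
  obtain ⟨⟨P, Q⟩, rfl⟩ := hk
  rw [coe_Ad]
  exact (LinearMap.congr_fun (conjEnd_mul_prj P Q i) _).symm

/-- The summands of `𝔭`. -/
def summand (n : ℕ) : Fin 2 → Submodule ℝ (so (Fin n × Fin n) ℝ) := ![p₁ n, p₂ n]

lemma mem_summand_iff (i : Fin 2) (X : so (Fin n × Fin n) ℝ) :
    X ∈ summand n i ↔ prj i (X : Matrix (Fin n × Fin n) (Fin n × Fin n) ℝ) = X := by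
  fin_cases i
  · exact mem_p₁_iff X
  · exact mem_p₂_iff X

lemma toSo_prj_mem (i : Fin 2) (U : Matrix (Fin n × Fin n) (Fin n × Fin n) ℝ) :
    toSo (prj i U) ∈ summand n i := by
  rw [mem_summand_iff, coe_toSo, sk_prj, ← Module.End.mul_apply, prj_mul_self]

lemma Ad_mem_summand {k : Matrix.specialOrthogonalGroup (Fin n × Fin n) ℝ} (hk : k ∈ K n)
    (i : Fin 2) {X : so (Fin n × Fin n) ℝ} (hX : X ∈ summand n i) : Ad k X ∈ summand n i := by
  rw [mem_summand_iff] at hX ⊢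
  rw [prj_Ad hk, hX, coe_Ad]

lemma p₁_sup_p₂ (hn : 3 ≤ n) : p₁ n ⊔ p₂ n = complement n := by
  apply le_antisymm
  · refine sup_le (fun X hX => ?_) (fun X hX => ?_)
    · rw [mem_p₁_iff] at hX
      rw [mem_complement_iff hn, ← hX, ← Module.End.mul_apply, prjK_mul_prj, LinearMap.zero_apply]
    · rw [mem_p₂_iff] at hX
      rw [mem_complement_iff hn, ← hX, ← Module.End.mul_apply, prjK_mul_prj, LinearMap.zero_apply]
  · intro X hX
    rw [mem_complement_iff hn] at hX
    have h := coe_eq_prj_add_prjK X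
    rw [hX, add_zero] at h
    rw [← toSo_coe X, ← h, map_add]
    exact Submodule.add_mem_sup (toSo_prj_mem 0 _) (toSo_prj_mem 1 _)

lemma killingForm_summand {X Y : so (Fin n × Fin n) ℝ} (hX : X ∈ p₁ n) (hY : Y ∈ p₂ n) :
    killingForm ℝ (so (Fin n × Fin n) ℝ) X Y = 0 := by
  rw [mem_p₁_iff] at hX
  rw [mem_p₂_iff] at hY
  rw [killingForm_pair_eq, ← hX, ← hY, trace_prj_apply_mul, ← Module.End.mul_apply,
    prj_mul_of_ne (by decide)]
  simp

/-- The inclusion of a summand of `𝔭` into the matrices. -/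
def coeSummand (i : Fin 2) : summand n i →ₗ[ℝ] Matrix (Fin n × Fin n) (Fin n × Fin n) ℝ :=
  coeSo ∘ₗ (summand n i).subtype

/-- The projection of the matrices onto a summand of `𝔭`. -/
noncomputable def toSummand (i : Fin 2) :
    Matrix (Fin n × Fin n) (Fin n × Fin n) ℝ →ₗ[ℝ] summand n i :=
  (toSo ∘ₗ prj i).codRestrict _ (toSo_prj_mem i)

lemma coe_toSummand (i : Fin 2) (U : Matrix (Fin n × Fin n) (Fin n × Fin n) ℝ) :
    ((toSummand i U : so (Fin n × Fin n) ℝ) : Matrix (Fin n × Fin n) (Fin n × Fin n) ℝ) =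
      prj i U :=
  sk_prj i U

/-- The dimension is the trace of the idempotent `prj i`, which factors over the tensor product. -/
lemma finrank_summand (i : Fin 2) :
    (Module.finrank ℝ (summand n i) : ℝ) = n * (n - 1) ^ 2 * (n + 2) / 4 := by
  have h : toSummand i ∘ₗ coeSummand (n := n) i = LinearMap.id := by
    ext1 X
    exact Subtype.ext (Subtype.ext ((coe_toSummand i _).trans ((mem_summand_iff i _).1 X.2)))
  have h' : coeSummand i ∘ₗ toSummand (n := n) i = prj i := LinearMap.ext (coe_toSummand i)
  have := LinearMap.trace_comp_comm' (toSummand (n := n) i) (coeSummand i)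
  rw [h, h', LinearMap.trace_id, trace_prj, Fintype.card_fin] at this
  exact this.symm

/-! ### The structural constants -/

section Structural

variable {d : Type*} [Fintype d] [DecidableEq d]

/-- Expansion in an orthonormal basis; the factor -(n² - 2) converts the trace pairing into minus
the Killing form. -/
lemma prj_eq_sum (i : Fin 2) {b : Module.Basis d ℝ (summand n i)} (hb : IsKillingOrthonormal b)
    (U : Matrix (Fin n × Fin n) (Fin n × Fin n) ℝ) :
    prj i U = ∑ α, (-((n : ℝ) ^ 2 - 2) *
      (U * ((b α : so (Fin n × Fin n) ℝ) : Matrix (Fin n × Fin n) (Fin n × Fin n) ℝ)).trace) •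
        ((b α : so (Fin n × Fin n) ℝ) : Matrix (Fin n × Fin n) (Fin n × Fin n) ℝ) := by
  have hr : ∀ α, b.repr (toSummand i U) α = -((n : ℝ) ^ 2 - 2) *
      (U * ((b α : so (Fin n × Fin n) ℝ) : Matrix (Fin n × Fin n) (Fin n × Fin n) ℝ)).trace := by
    intro α
    have h1 : - killingForm ℝ (so (Fin n × Fin n) ℝ) (toSummand i U) (b α) =
        b.repr (toSummand i U) α := by
      conv_lhs => rw [← b.sum_repr (toSummand i U)]
      simp only [Submodule.coe_sum, map_sum, LinearMap.sum_apply, Submodule.coe_smul, map_smul,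
        LinearMap.smul_apply, smul_eq_mul, ← Finset.sum_neg_distrib, ← mul_neg, hb _ α]
      simp
    rw [← h1, killingForm_pair_eq, coe_toSummand, trace_prj_apply_mul,
      (mem_summand_iff i _).1 (b α).2]
    ring
  have h := congrArg (coeSummand i) (b.sum_repr (toSummand i U))
  rw [map_sum] at h
  refine (coe_toSummand i U).symm.trans (h.symm.trans (Finset.sum_congr rfl fun α _ => ?_))
  rw [map_smul, hr]
  rfl

lemma trace_mul_prj (i : Fin 2) {b : Module.Basis d ℝ (summand n i)} (hb : IsKillingOrthonormal b)
    (f : Module.End ℝ (Matrix (Fin n × Fin n) (Fin n × Fin n) ℝ)) :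
    LinearMap.trace ℝ _ (f * prj i) = ∑ α, -((n : ℝ) ^ 2 - 2) *
      (f ((b α : so (Fin n × Fin n) ℝ) : Matrix (Fin n × Fin n) (Fin n × Fin n) ℝ) *
        ((b α : so (Fin n × Fin n) ℝ) : Matrix (Fin n × Fin n) (Fin n × Fin n) ℝ)).trace := by
  have h : f * prj i = ∑ α, LinearMap.smulRight ((-((n : ℝ) ^ 2 - 2)) •
      (Matrix.traceLinearMap _ ℝ ℝ ∘ₗ LinearMap.mulRight ℝ
        ((b α : so (Fin n × Fin n) ℝ) : Matrix (Fin n × Fin n) (Fin n × Fin n) ℝ)))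
      (f ((b α : so (Fin n × Fin n) ℝ) : Matrix (Fin n × Fin n) (Fin n × Fin n) ℝ)) := by
    ext1 U
    rw [Module.End.mul_apply, prj_eq_sum i hb, map_sum, LinearMap.sum_apply]
    refine Finset.sum_congr rfl fun α _ => ?_
    rw [map_smul]
    rfl
  rw [h, map_sum]
  refine Finset.sum_congr rfl fun α _ => ?_
  rw [LinearMap.trace_smulRight]
  rfl

variable {d' d'' : Type*} [Fintype d'] [DecidableEq d'] [Fintype d''] [DecidableEq d'']

/-- For a fixed first vector, the double sum over the other two bases is a trace of two compressed
commutators, which depends only on the norm of that vector. Each unit vector thus contributes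
equally, and the first sum only counts them. -/
lemma structuralConstant_summand (hn : 3 ≤ n) (i j k : Fin 2) {X : Module.Basis d ℝ (summand n i)}
    {Y : Module.Basis d' ℝ (summand n j)} {Z : Module.Basis d'' ℝ (summand n k)}
    (hX : IsKillingOrthonormal X) (hY : IsKillingOrthonormal Y) (hZ : IsKillingOrthonormal Z) :
    structuralConstant X Y Z =
      Fintype.card d * (blockCoeff n j k i / ((n : ℝ) ^ 2 - 2)) := by
  have hN : (n : ℝ) ^ 2 - 2 ≠ 0 := by
    have : (3 : ℝ) ≤ n := by exact_mod_cast hn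
    nlinarith
  rw [structuralConstant, ← nsmul_eq_mul, ← Finset.card_univ, ← Finset.sum_const]
  refine Finset.sum_congr rfl fun α _ => ?_
  set x : Matrix (Fin n × Fin n) (Fin n × Fin n) ℝ := ((X α : so (Fin n × Fin n) ℝ) :
    Matrix (Fin n × Fin n) (Fin n × Fin n) ℝ) with hx
  have hxx : -((n : ℝ) ^ 2 - 2) * (x * x).trace = 1 := by
    have := hX α α
    rw [killingForm_pair_eq, if_pos rfl] at this
    linarith
  -- Parseval: the sum over γ is the squared norm of the component in the third summand.
  have h1 : ∀ W : so (Fin n × Fin n) ℝ,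
      ∑ γ, (- killingForm ℝ (so (Fin n × Fin n) ℝ) W (Z γ)) ^ 2 =
        -((n : ℝ) ^ 2 - 2) * (prj k (W : Matrix (Fin n × Fin n) (Fin n × Fin n) ℝ) * W).trace := by
    intro W
    rw [prj_eq_sum k hZ, Finset.sum_mul, Matrix.trace_sum, Finset.mul_sum]
    refine Finset.sum_congr rfl fun γ _ => ?_
    rw [killingForm_pair_eq, Matrix.smul_mul, Matrix.trace_smul, smul_eq_mul,
      Matrix.trace_mul_comm (W : Matrix (Fin n × Fin n) (Fin n × Fin n) ℝ)]
    ring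
  have h2 : ∀ V y : Matrix (Fin n × Fin n) (Fin n × Fin n) ℝ,
      (V * adj x y).trace = -(adj x V * y).trace := by
    intro V y
    rw [adj_apply, adj_apply, Matrix.mul_sub, Matrix.sub_mul, Matrix.trace_sub, Matrix.trace_sub,
      ← Matrix.mul_assoc, ← Matrix.mul_assoc, Matrix.trace_mul_comm _ x, ← Matrix.mul_assoc]
    ring
  -- By skewness of the commutator, the sum over β is minus a trace over the second summand.
  have h3 := trace_mul_prj j hY (adj x * prj k * adj x)
  have hxm : prj i x = x := (mem_summand_iff i _).1 (X α).2
  have h4 := trace_prj_adj_prj_adj j k i i x x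
  rw [if_pos rfl, hxm, Fintype.card_fin] at h4
  rw [LinearMap.trace_mul_comm, ← mul_assoc, ← mul_assoc, h4] at h3
  have h5 : ∑ β, ∑ γ, (- killingForm ℝ (so (Fin n × Fin n) ℝ)
      ⁅(X α : so (Fin n × Fin n) ℝ), (Y β : so (Fin n × Fin n) ℝ)⁆ (Z γ)) ^ 2 =
      -(blockCoeff n j k i * (x * x).trace) := by
    rw [h3, ← Finset.sum_neg_distrib]
    refine Finset.sum_congr rfl fun β _ => ?_
    rw [h1, coe_lie, h2]
    simp only [Module.End.mul_apply]
    ring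
  rw [h5]
  field_simp
  linear_combination blockCoeff n j k i * hxx

end Structural

end TensorSO

namespace ReductivePair

namespace InvMetric

variable {L : Type*} [LieRing L] [LieAlgebra ℝ L] {D : ReductivePair L} [FiniteDimensional ℝ L]
  (g : D.InvMetric)

/-! ### Traces with respect to a metric -/

lemma gTrace_form_left (f : Module.End ℝ D.compl) :
    g.gTrace (fun X Y => g.form (f X) Y) = LinearMap.trace ℝ _ f := by
  rw [gTrace, LinearMap.trace_eq_matrix_trace ℝ (Module.finBasis ℝ D.compl), Matrix.trace]
  refine Finset.sum_congr rfl fun i _ => ?_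
  rw [Matrix.diag, LinearMap.toMatrix_apply, g.symm]
  generalize f _ = X
  conv_lhs => rw [← (Module.finBasis ℝ D.compl).sum_repr X, map_sum]
  simp only [map_smul, LinearMap.BilinForm.apply_dualBasis_left]
  simp

lemma gTrace_form_right (f : Module.End ℝ D.compl) :
    g.gTrace (fun X Y => g.form X (f Y)) = LinearMap.trace ℝ _ f := by
  rw [gTrace, LinearMap.trace_eq_matrix_trace ℝ
    (g.form.dualBasis g.nondegenerate (Module.finBasis ℝ D.compl)), Matrix.trace]
  refine Finset.sum_congr rfl fun i _ => ?_
  rw [Matrix.diag, LinearMap.toMatrix_apply, g.symm, LinearMap.BilinForm.dualBasis_repr_apply]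

/-- The definition pairs a basis with its dual basis, so symmetry in the two slots is not visible;
it follows by representing the form through an endomorphism. -/
lemma gTrace_swap (B : LinearMap.BilinForm ℝ D.compl) :
    g.gTrace (fun X Y => B Y X) = g.gTrace (fun X Y => B X Y) := by
  have h : ∀ X Y, B X Y = g.form ((g.dual.symm.toLinearMap ∘ₗ B) X) Y := fun X Y => by
    change B X Y = g.dual _ Y
    simp
  simp only [h]
  rw [g.gTrace_form_left, ← g.gTrace_form_right]
  simp only [g.symm]

/-- An endomorphism and its adjoint have the same trace. -/
lemma trace_eq_of_adjoint {f f' : Module.End ℝ D.compl}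
    (h : ∀ X Y, g.form (f X) Y = g.form X (f' Y)) :
    LinearMap.trace ℝ _ f = LinearMap.trace ℝ _ f' := by
  rw [← g.gTrace_form_left, ← g.gTrace_form_right]
  simp only [h]

lemma form_ext {X Y : D.compl} (h : ∀ Z, g.form X Z = g.form Y Z) : X = Y :=
  g.dual.injective (LinearMap.ext h)

lemma form_gTrace (F : D.compl → D.compl → D.compl) (Z : D.compl) :
    g.form (g.gTrace F) Z = g.gTrace (fun X Y => g.form (F X Y) Z) := by
  simp [gTrace, LinearMap.sum_apply]

lemma gTrace_apply (F : D.compl → D.compl → Module.End ℝ D.compl) (Z : D.compl) :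
    g.gTrace F Z = g.gTrace (fun X Y => F X Y Z) := by
  simp [gTrace, LinearMap.sum_apply]

/-! ### The Ricci tensor of a unimodular reductive pair -/

/-- The endomorphism `X ↦ [[X, Y]_𝔨, Z]`. -/
noncomputable def isotropyTerm (D : ReductivePair L) (Y Z : D.compl) : Module.End ℝ D.compl :=
  (D.adP ∘ₗ D.bracketK.flip Y).flip Z

lemma isotropyTerm_apply (X Y Z : D.compl) :
    isotropyTerm D Y Z X = D.adP (D.bracketK X Y) Z := rfl

/-- Each of the three Koszul terms has zero trace: two are traces of brackets, which vanish by
assumption, and one is antisymmetric in the traced pair. -/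
lemma trace_nomizu_flip (hD : ∀ W, LinearMap.trace ℝ _ (D.bracketP W) = 0) (W : D.compl) :
    LinearMap.trace ℝ _ (g.nomizu.flip W) = 0 := by
  have hW : D.bracketP.flip W = - D.bracketP W := by
    ext1 X
    exact D.bracketP_swap X W
  have h0 : LinearMap.trace ℝ _ (D.bracketP.flip W) = 0 := by rw [hW, map_neg, hD, neg_zero]
  have h1 := g.gTrace_form_left (D.bracketP.flip W)
  have h2 := g.gTrace_form_right (D.bracketP.flip W)
  have h3 := g.gTrace_swap (D.bracketP.compr₂ (g.form.flip W))
  have h4 : g.gTrace (fun X Y => D.bracketP.compr₂ (g.form.flip W) Y X) =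
      - g.gTrace (fun X Y => D.bracketP.compr₂ (g.form.flip W) X Y) := by
    rw [gTrace, gTrace, ← Finset.sum_neg_distrib]
    refine Finset.sum_congr rfl fun i _ => ?_
    simp only [LinearMap.compr₂_apply]
    rw [D.bracketP_swap, map_neg]
  have h5 : g.gTrace (fun X Y => D.bracketP.compr₂ (g.form.flip W) Y X) = 0 := by linarith
  rw [h0] at h1 h2
  rw [← g.gTrace_form_left]
  simp only [LinearMap.flip_apply, form_nomizu]
  rw [gTrace] at h1 h2 h5 ⊢
  rw [← Finset.mul_sum, Finset.sum_add_distrib, Finset.sum_add_distrib]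
  simp only [LinearMap.flip_apply] at h1 h2
  change ∑ i, g.form (D.bracketP _ _) W = 0 at h5
  rw [h1, h2, h5]
  simp

/-- Replacing the bracket by its torsion-free expression groups the terms into a divergence, a
product of two flipped Nomizu maps, a commutator and the isotropy term. The divergence and the
commutator disappear from the Ricci trace. -/
lemma curvature_flip_flip (Y Z : D.compl) : (g.curvature.flip Y).flip Z =
    g.nomizu.flip (g.nomizu Y Z) - g.nomizu.flip Z * g.nomizu.flip Y
      + (g.nomizu.flip Z * g.nomizu Y - g.nomizu Y * g.nomizu.flip Z)
      - isotropyTerm D Y Z := by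
  ext1 X
  have h : D.bracketP X Y = g.nomizu X Y - g.nomizu Y X := (g.nomizu_torsion X Y).symm
  have : (g.curvature.flip Y).flip Z X = g.nomizu X (g.nomizu Y Z) - g.nomizu Y (g.nomizu X Z)
      - g.nomizu (D.bracketP X Y) Z - D.adP (D.bracketK X Y) Z := rfl
  rw [this, h]
  simp [isotropyTerm_apply]
  abel

lemma ricci_eq (hD : ∀ W, LinearMap.trace ℝ _ (D.bracketP W) = 0) (Y Z : D.compl) :
    g.ricci Y Z = - LinearMap.trace ℝ _ (g.nomizu.flip Y * g.nomizu.flip Z)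
      - LinearMap.trace ℝ _ (isotropyTerm D Y Z) := by
  rw [ricci, curvature_flip_flip, map_sub, map_add, map_sub, g.trace_nomizu_flip hD, map_sub,
    LinearMap.trace_mul_comm ℝ (g.nomizu Y), LinearMap.trace_mul_comm ℝ (g.nomizu.flip Z)]
  ring

/-! ### Metrics on a naturally reductive space -/

/-- The metric `q` is naturally reductive. -/
def IsNaturallyReductive (q : D.InvMetric) : Prop :=
  ∀ X Y Z, q.form (D.bracketP X Y) Z = - q.form Y (D.bracketP X Z)

section NaturallyReductive

variable {g} {q : D.InvMetric} (hq : q.IsNaturallyReductive)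
include hq

/-- A symmetric operator times a skew one is traceless: passing to the adjoint changes the sign. -/
lemma IsNaturallyReductive.trace_mul_bracketP {A : Module.End ℝ D.compl}
    (hA : ∀ X Y, q.form (A X) Y = q.form X (A Y)) (W : D.compl) :
    LinearMap.trace ℝ _ (A * D.bracketP W) = 0 := by
  have h : LinearMap.trace ℝ _ (A * D.bracketP W) =
      LinearMap.trace ℝ _ (-(D.bracketP W * A)) := by
    refine q.trace_eq_of_adjoint fun X Y => ?_
    rw [Module.End.mul_apply, hA, hq, LinearMap.neg_apply, map_neg, Module.End.mul_apply]
  rw [map_neg, LinearMap.trace_mul_comm] at h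
  rw [LinearMap.trace_mul_comm]
  linarith

lemma IsNaturallyReductive.trace_bracketP (W : D.compl) :
    LinearMap.trace ℝ _ (D.bracketP W) = 0 := by
  simpa using hq.trace_mul_bracketP (A := 1) (fun _ _ => rfl) W

/-- The Nomizu map of the metric `q(G·,·)`. -/
lemma IsNaturallyReductive.nomizu_flip {G G' : Module.End ℝ D.compl} (hGG' : G * G' = 1)
    (hg : ∀ X Y, g.form X Y = q.form (G X) Y) (Y : D.compl) :
    g.nomizu.flip Y = (-(1 / 2) : ℝ) •
      (D.bracketP Y + G' * D.bracketP (G Y) - G' * D.bracketP Y * G) := by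
  ext1 X
  refine g.form_ext fun Z => ?_
  have hG : ∀ W, G (G' W) = W := fun W => LinearMap.congr_fun hGG' W
  have hs : ∀ X Y, q.form (G X) Y = q.form X (G Y) := fun X Y => by
    rw [← hg, g.symm, hg, q.symm]
  rw [LinearMap.flip_apply, form_nomizu, LinearMap.smul_apply, map_smul, LinearMap.smul_apply]
  simp only [LinearMap.sub_apply, LinearMap.add_apply, map_sub, map_add, Module.End.mul_apply, hg,
    hG]
  rw [D.bracketP_swap X Y, map_neg, map_neg, LinearMap.neg_apply, hs (D.bracketP Z X),
    D.bracketP_swap Z X, map_neg, LinearMap.neg_apply, hq X Z, q.symm Z,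
    D.bracketP_swap X (G Y), map_neg, LinearMap.neg_apply, D.bracketP_swap Z Y, map_neg, hq Y (G X),
    smul_eq_mul]
  ring

lemma IsNaturallyReductive.nomizu_eq : q.nomizu = (1 / 2 : ℝ) • D.bracketP := by
  ext1 X
  ext1 Y
  have := LinearMap.congr_fun (hq.nomizu_flip (g := q) (G := 1) (G' := 1) (mul_one _)
    (fun _ _ => rfl) Y) X
  rw [LinearMap.flip_apply] at this
  rw [this]
  simp only [one_mul, mul_one, Module.End.one_apply, add_sub_cancel_right, LinearMap.smul_apply,
    D.bracketP_swap X Y]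
  module

lemma IsNaturallyReductive.nomizu_flip_self (Y : D.compl) :
    q.nomizu.flip Y = (-(1 / 2) : ℝ) • D.bracketP Y := by
  rw [hq.nomizu_flip (g := q) (G := 1) (G' := 1) (mul_one _) (fun _ _ => rfl) Y]
  simp

/-- Skewness of the bracket moves U and V to the two ends, so that the metric trace over them
becomes an operator trace. -/
lemma IsNaturallyReductive.form_bracketP_bracketP (A : Module.End ℝ D.compl)
    (U V Y Z : D.compl) : q.form (D.bracketP U (A (D.bracketP V Y))) Z =
      q.form U ((D.bracketP Z * A * D.bracketP Y) V) := by
  rw [hq, D.bracketP_swap U Z, map_neg, neg_neg, q.symm, hq, D.bracketP_swap V Y, map_neg, map_neg,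
    map_neg, neg_neg]
  rfl

lemma IsNaturallyReductive.gTrace_form_bracketP_bracketP (A : Module.End ℝ D.compl)
    (Y Z : D.compl) :
    q.gTrace (fun U V => q.form (D.bracketP U (A (D.bracketP V Y))) Z) =
      LinearMap.trace ℝ _ (A * D.bracketP Y * D.bracketP Z) := by
  simp only [hq.form_bracketP_bracketP, q.gTrace_form_right]
  rw [mul_assoc, LinearMap.trace_mul_comm]

lemma IsNaturallyReductive.gTrace_form_bracketP_bracketP_swap (A : Module.End ℝ D.compl)
    (Y Z : D.compl) :
    q.gTrace (fun U V => q.form (D.bracketP V (A (D.bracketP U Y))) Z) =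
      LinearMap.trace ℝ _ (A * D.bracketP Y * D.bracketP Z) := by
  simp only [hq.form_bracketP_bracketP, q.symm _ ((D.bracketP Z * A * D.bracketP Y) _),
    q.gTrace_form_left]
  rw [mul_assoc, LinearMap.trace_mul_comm]

/-- Pairing with Z turns the left side into the trace of A times the bracket with Z, which vanishes
by symmetry against skewness. -/
lemma IsNaturallyReductive.gTrace_bracketP_map {A : Module.End ℝ D.compl}
    (hA : ∀ X Y, q.form (A X) Y = q.form X (A Y)) :
    q.gTrace (fun X Y => D.bracketP X (A Y)) = 0 := by
  refine q.form_ext fun Z => ?_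
  rw [form_gTrace, map_zero, LinearMap.zero_apply, ← hq.trace_mul_bracketP hA Z,
    ← q.gTrace_form_left]
  congr 1
  ext X Y
  rw [hq, D.bracketP_swap X Z, map_neg, neg_neg, q.symm, ← hA]
  rfl

/-- Hence an invariant symmetric tensor is automatically divergence-free, and the TT-condition on
invariant symmetric tensors reduces to trace zero. -/
lemma IsNaturallyReductive.gTrace_nabla {A : Module.End ℝ D.compl}
    (hA : ∀ X Y, q.form (A X) Y = q.form X (A Y)) :
    q.gTrace (fun X Y => q.nabla X A Y) = 0 := by
  have h1 := hq.gTrace_bracketP_map hA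
  have h2 := hq.gTrace_bracketP_map (A := 1) fun _ _ => rfl
  rw [gTrace] at h1 h2 ⊢
  simp only [nabla, hq.nomizu_eq, LinearMap.sub_apply, Module.End.mul_apply, LinearMap.smul_apply,
    map_smul, Finset.sum_sub_distrib, ← Finset.smul_sum, ← map_sum, h1]
  simp only [Module.End.one_apply] at h2
  rw [h2]
  simp

lemma IsNaturallyReductive.form_roughLaplacian {A : Module.End ℝ D.compl}
    (hA : ∀ X Y, q.form (A X) Y = q.form X (A Y)) (Y Z : D.compl) :
    q.form (q.roughLaplacian A Y) Z = -(1 / 4) *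
      (LinearMap.trace ℝ _ (D.bracketP (A Y) * D.bracketP Z)
        + LinearMap.trace ℝ _ (D.bracketP Y * D.bracketP (A Z))
        - 2 * LinearMap.trace ℝ _ (A * D.bracketP Y * D.bracketP Z)) := by
  have h0 := hq.gTrace_bracketP_map (A := 1) fun _ _ => rfl
  have h1 := hq.gTrace_form_bracketP_bracketP 1 (A Y) Z
  have h2 := hq.gTrace_form_bracketP_bracketP A Y Z
  have h3 := hq.gTrace_form_bracketP_bracketP_swap A Y Z
  have h4 := hq.gTrace_form_bracketP_bracketP_swap 1 Y (A Z)
  -- The correction term of the second covariant derivative is linear in Σ Λ(eᵢ)eᵢ, which is zero.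
  have h5 : q.gTrace (fun U V => q.nabla (q.nomizu U V) A) = 0 := by
    have : ∀ U V, q.nabla (q.nomizu U V) A =
        ((LinearMap.mulRight ℝ A - LinearMap.mulLeft ℝ A) ∘ₗ q.nomizu) (q.nomizu U V) :=
      fun _ _ => rfl
    simp only [this, gTrace, ← map_sum]
    rw [gTrace] at h0
    simp only [hq.nomizu_eq, LinearMap.smul_apply, ← Finset.smul_sum]
    simp only [Module.End.one_apply] at h0
    rw [h0]
    simp
  have h6 : q.gTrace (fun U V => q.nabla₂ U V A) = q.gTrace fun U V => q.nabla U (q.nabla V A) := by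
    rw [gTrace] at h5
    simp only [gTrace, nabla₂, Finset.sum_sub_distrib]
    rw [h5, sub_zero]
  rw [roughLaplacian, h6, LinearMap.neg_apply, map_neg, LinearMap.neg_apply, gTrace_apply,
    form_gTrace]
  -- Two nested commutators give four terms; the explicit identity operators bring the outer two
  -- into the shape of the preceding trace formulas.
  have h7 : ∀ U V, q.form (q.nabla U (q.nabla V A) Y) Z = (1 / 4) *
      (q.form (D.bracketP U ((1 : Module.End ℝ D.compl) (D.bracketP V (A Y)))) Z
        - q.form (D.bracketP U (A (D.bracketP V Y))) Z
        - q.form (D.bracketP V (A (D.bracketP U Y))) Z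
        + q.form (D.bracketP V ((1 : Module.End ℝ D.compl) (D.bracketP U Y))) (A Z)) := by
    intro U V
    rw [← hA]
    simp only [nabla, hq.nomizu_eq, LinearMap.sub_apply, Module.End.mul_apply,
      LinearMap.smul_apply, map_smul, map_sub, smul_eq_mul, Module.End.one_apply]
    ring
  simp only [gTrace] at h1 h2 h3 h4 ⊢
  simp only [h7, ← Finset.mul_sum, Finset.sum_add_distrib, Finset.sum_sub_distrib, h1, h2, h3, h4,
    one_mul]
  ring

lemma IsNaturallyReductive.ricci_self (Y Z : D.compl) : q.ricci Y Z =
    -(1 / 4) * LinearMap.trace ℝ _ (D.bracketP Y * D.bracketP Z)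
      - LinearMap.trace ℝ _ (isotropyTerm D Y Z) := by
  rw [q.ricci_eq hq.trace_bracketP, hq.nomizu_flip_self, hq.nomizu_flip_self,
    smul_mul_smul_comm, map_smul, smul_eq_mul]
  ring

lemma IsNaturallyReductive.curvatureAction_eq {A : Module.End ℝ D.compl}
    (hA : ∀ X Y, q.form (A X) Y = q.form X (A Y)) (Y Z : D.compl) :
    q.curvatureAction A Y Z = -(1 / 4) * LinearMap.trace ℝ _ (A * D.bracketP Y * D.bracketP Z)
      - LinearMap.trace ℝ _ (A * isotropyTerm D Y Z) := by
  -- The two brackets may be exchanged by taking adjoints, since their two signs cancel.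
  have h : LinearMap.trace ℝ _ (A * (D.bracketP Z * D.bracketP Y)) =
      LinearMap.trace ℝ _ (A * (D.bracketP Y * D.bracketP Z)) := by
    rw [LinearMap.trace_mul_comm ℝ A (D.bracketP Y * _)]
    refine q.trace_eq_of_adjoint fun X W => ?_
    simp only [Module.End.mul_apply]
    rw [hA, hq, hq, neg_neg]
  rw [curvatureAction, curvature_flip_flip, ← Module.End.mul_eq_comp, hq.nomizu_flip_self,
    hq.nomizu_flip_self, hq.nomizu_flip_self, hq.nomizu_eq]
  simp only [LinearMap.smul_apply, mul_sub, mul_add, mul_smul_comm, smul_mul_assoc, map_sub,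
    map_add, map_smul, smul_eq_mul, hq.trace_mul_bracketP hA, h, mul_assoc]
  ring

lemma IsNaturallyReductive.lichnerowicz_eq {A : Module.End ℝ D.compl}
    (hA : ∀ X Y, q.form (A X) Y = q.form X (A Y)) (Y Z : D.compl) :
    q.lichnerowicz A Y Z = LinearMap.trace ℝ _ (A * D.bracketP Y * D.bracketP Z)
      - 1 / 2 * (LinearMap.trace ℝ _ (D.bracketP (A Y) * D.bracketP Z)
        + LinearMap.trace ℝ _ (D.bracketP Y * D.bracketP (A Z)))
      - LinearMap.trace ℝ _ (isotropyTerm D (A Y) Z) - LinearMap.trace ℝ _ (isotropyTerm D Y (A Z))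
      + 2 * LinearMap.trace ℝ _ (A * isotropyTerm D Y Z) := by
  rw [lichnerowicz, hq.form_roughLaplacian hA, hq.ricci_self, hq.ricci_self,
    hq.curvatureAction_eq hA]
  ring

end NaturallyReductive

end InvMetric

end ReductivePair

namespace TensorSO

open LieAlgebra.Orthogonal MatrixEnd ReductivePair ReductivePair.InvMetric

variable {n : ℕ} [Nonempty (Fin n)] (hn : 3 ≤ n)

/-- The projection of the matrix space onto `𝔭`. -/
noncomputable def prjP : Module.End ℝ (Matrix (Fin n × Fin n) (Fin n × Fin n) ℝ) := prj 0 + prj 1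

/-! ### Endomorphisms of `𝔭` as compressions of endomorphisms of the matrix space -/

/-- The inclusion of `𝔭` into the matrices. -/
noncomputable def incl : (pair hn).compl →ₗ[ℝ] Matrix (Fin n × Fin n) (Fin n × Fin n) ℝ :=
  coeSo ∘ₗ (pair hn).compl.subtype

include hn in
lemma toSo_mem_complement (U : Matrix (Fin n × Fin n) (Fin n × Fin n) ℝ) :
    toSo (prjP U) ∈ complement n := by
  rw [prjP, LinearMap.add_apply, map_add, ← p₁_sup_p₂ hn]
  exact Submodule.add_mem_sup (toSo_prj_mem 0 _) (toSo_prj_mem 1 _)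

/-- The projection of the matrices onto `𝔭`. -/
noncomputable def retr : Matrix (Fin n × Fin n) (Fin n × Fin n) ℝ →ₗ[ℝ] (pair hn).compl :=
  (toSo ∘ₗ prjP).codRestrict (complement n) (toSo_mem_complement hn)

lemma incl_retr (U : Matrix (Fin n × Fin n) (Fin n × Fin n) ℝ) :
    incl hn (retr hn U) = prjP U := by
  change sk (prjP U) = _
  rw [prjP, LinearMap.add_apply, map_add, sk_prj, sk_prj]

lemma incl_injective : Function.Injective (incl hn) := fun _ _ h => Subtype.ext (Subtype.ext h)

lemma prjK_incl (X : (pair hn).compl) : prjK (incl hn X) = 0 :=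
  (mem_complement_iff hn X.1).1 X.2

lemma prj_add_prj_incl (X : (pair hn).compl) :
    prjP (incl hn X) = incl hn X := by
  have h := coe_eq_prj_add_prjK X.1
  have h' : prjK (X.1 : Matrix (Fin n × Fin n) (Fin n × Fin n) ℝ) = 0 := prjK_incl hn X
  rwa [h', add_zero] at h

lemma retr_incl (X : (pair hn).compl) : retr hn (incl hn X) = X :=
  incl_injective hn (by rw [incl_retr, prj_add_prj_incl])

/-- The compression to `𝔭` of an endomorphism of the matrix space. -/
noncomputable def compress (F : Module.End ℝ (Matrix (Fin n × Fin n) (Fin n × Fin n) ℝ)) :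
    Module.End ℝ (pair hn).compl :=
  retr hn ∘ₗ F ∘ₗ incl hn

lemma incl_compress (F : Module.End ℝ (Matrix (Fin n × Fin n) (Fin n × Fin n) ℝ))
    (X : (pair hn).compl) :
    incl hn (compress hn F X) = prjP (F (incl hn X)) :=
  incl_retr hn _

/-- Including after retracting is the projection to 𝔭, which is what remains between the two
factors. -/
lemma compress_mul (F F' : Module.End ℝ (Matrix (Fin n × Fin n) (Fin n × Fin n) ℝ)) :
    compress hn F * compress hn F' = compress hn (F * prjP * F') := by
  ext1 X
  apply incl_injective hn
  rw [Module.End.mul_apply, incl_compress, incl_compress, incl_compress]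
  rfl

lemma trace_compress_eq (F : Module.End ℝ (Matrix (Fin n × Fin n) (Fin n × Fin n) ℝ)) :
    LinearMap.trace ℝ _ (compress hn F) = LinearMap.trace ℝ _ (prjP * F) := by
  rw [compress, LinearMap.trace_comp_comm', LinearMap.trace_mul_comm]
  congr 1
  ext1 U
  simp only [LinearMap.comp_apply, incl_retr, Module.End.mul_apply]

lemma prj_mul_add (i : Fin 2) : prj i * prjP =
    (prj i : Module.End ℝ (Matrix (Fin n × Fin n) (Fin n × Fin n) ℝ)) := by
  fin_cases i <;> simp [prjP, mul_add, prj_mul_self, prj_mul_of_ne]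

lemma add_mul_prj (i : Fin 2) : prjP * prj i =
    (prj i : Module.End ℝ (Matrix (Fin n × Fin n) (Fin n × Fin n) ℝ)) := by
  fin_cases i <;> simp [prjP, add_mul, prj_mul_self, prj_mul_of_ne]

/-- The projection of `𝔭` onto a summand. -/
noncomputable def proj (i : Fin 2) : Module.End ℝ (pair hn).compl := compress hn (prj i)

lemma incl_proj (i : Fin 2) (X : (pair hn).compl) : incl hn (proj hn i X) = prj i (incl hn X) := by
  rw [proj, incl_compress, ← Module.End.mul_apply, add_mul_prj]

lemma proj_mul_self (i : Fin 2) : proj hn i * proj hn i = proj hn i := by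
  rw [proj, compress_mul, prj_mul_add, prj_mul_self]

lemma proj_mul_of_ne {i j : Fin 2} (h : i ≠ j) : proj hn i * proj hn j = 0 := by
  rw [proj, proj, compress_mul, prj_mul_add, prj_mul_of_ne h]
  ext1 X
  simp [compress]

lemma sum_proj : ∑ i, proj hn i = 1 := by
  rw [Fin.sum_univ_two]
  ext1 X
  apply incl_injective hn
  rw [LinearMap.add_apply, map_add, incl_proj, incl_proj]
  exact prj_add_prj_incl hn X

lemma trace_proj (i : Fin 2) : LinearMap.trace ℝ _ (proj hn i) = n * (n - 1) ^ 2 * (n + 2) / 4 := by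
  rw [proj, trace_compress_eq, add_mul_prj, trace_prj, Fintype.card_fin]

lemma projP_eq (Z : so (Fin n × Fin n) ℝ) : (pair hn).projP Z = retr hn (coeSo Z) := by
  have hK : toSo (prjK (coeSo Z)) ∈ isotropyAlgebra n :=
    mem_isotropy_of_coe_eq (U := coeSo Z) (by rw [coe_toSo, sk_prjK])
  have hZ : Z = (retr hn (coeSo Z) : so (Fin n × Fin n) ℝ) + toSo (prjK (coeSo Z)) := by
    have h : (retr hn (coeSo Z) : so (Fin n × Fin n) ℝ) = toSo (prjP (coeSo Z)) := rfl
    rw [h, ← map_add]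
    exact (toSo_coe Z).symm.trans (congrArg toSo (coe_eq_prj_add_prjK Z).symm)
  conv_lhs => rw [hZ]
  rw [map_add, projP, Submodule.projectionOnto_apply_left, show (pair hn).compl.projectionOnto (pair hn).isotropy.toSubmodule (pair hn).isCompl.symm
    (toSo (prjK (coeSo Z))) = 0 from Submodule.projectionOnto_apply_of_mem_right _ hK, add_zero]

lemma coe_projK (Z : so (Fin n × Fin n) ℝ) : coeSo ((pair hn).projK Z) = prjK (coeSo Z) := by
  have h : (pair hn).projK Z = Z - (pair hn).projP Z := by
    rw [projK, projP, Submodule.projection_eq_self_sub_projection, Submodule.projection_apply]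
  rw [h, projP_eq, map_sub]
  have h1 := coe_eq_prj_add_prjK Z
  have h2 : coeSo (retr hn (coeSo Z) : so (Fin n × Fin n) ℝ) = incl hn (retr hn (coeSo Z)) := rfl
  rw [h2, incl_retr, sub_eq_iff_eq_add']
  exact h1.symm

lemma bracketP_eq (Y : (pair hn).compl) : (pair hn).bracketP Y = compress hn (adj (incl hn Y)) := by
  ext1 X
  exact projP_eq hn _

/-- Both brackets are reversed when X is moved to the right, so no sign remains. -/
lemma isotropyTerm_eq (Y Z : (pair hn).compl) : isotropyTerm (pair hn) Y Z =
    compress hn (adj (incl hn Z) * prjK * adj (incl hn Y)) := by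
  ext1 X
  refine (projP_eq hn _).trans ?_
  have h : coeSo ⁅(pair hn).projK ⁅(X : so (Fin n × Fin n) ℝ), (Y : so (Fin n × Fin n) ℝ)⁆,
      (Z : so (Fin n × Fin n) ℝ)⁆ =
      adj (coeSo ((pair hn).projK ⁅(X : so (Fin n × Fin n) ℝ), (Y : so (Fin n × Fin n) ℝ)⁆))
        (incl hn Z) := rfl
  refine (congrArg (retr hn) h).trans ?_
  rw [coe_projK]
  have hXY : coeSo ⁅(X : so (Fin n × Fin n) ℝ), (Y : so (Fin n × Fin n) ℝ)⁆ =
      -adj (incl hn Y) (incl hn X) := by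
    rw [adj_apply, neg_sub]
    rfl
  rw [hXY, map_neg, compress]
  simp only [LinearMap.comp_apply, Module.End.mul_apply]
  congr 1
  simp only [adj_apply, neg_mul, mul_neg]
  abel

lemma standardMetric_form (X Y : (pair hn).compl) : (standardMetric hn).form X Y =
    -((n : ℝ) ^ 2 - 2) * (incl hn X * incl hn Y).trace :=
  (congrArg Neg.neg (killingForm_pair_eq (X : so (Fin n × Fin n) ℝ) Y)).trans (neg_mul _ _).symm

/-- This is the ad-invariance of the trace form; projecting a bracket to 𝔭 is invisible when pairing
with an element of 𝔭. -/
lemma standardMetric_naturallyReductive : (standardMetric hn).IsNaturallyReductive := by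
  intro X Y Z
  have h : ∀ U V : Matrix (Fin n × Fin n) (Fin n × Fin n) ℝ, prjP V = V →
      (prjP U * V).trace =
        (U * V).trace := by
    intro U V hV
    conv_rhs => rw [← hV]
    simp only [prjP, LinearMap.add_apply, add_mul, mul_add, Matrix.trace_add, trace_prj_apply_mul]
  rw [standardMetric_form, standardMetric_form, bracketP_eq, incl_compress, incl_compress,
    h _ _ (prj_add_prj_incl hn Z), Matrix.trace_mul_comm (incl hn Y),
    h _ _ (prj_add_prj_incl hn Y), adj_apply, adj_apply, Matrix.sub_mul, Matrix.sub_mul,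
    Matrix.trace_sub, Matrix.trace_sub, Matrix.mul_assoc (incl hn Y),
    Matrix.trace_mul_comm (incl hn Y) (incl hn X * incl hn Z), Matrix.mul_assoc (incl hn Z),
    Matrix.trace_mul_comm (incl hn Z) (incl hn X * incl hn Y)]
  ring

/-- The numbers `[ijm] / dim 𝔭_m`. -/
noncomputable def bracketCoeff (n : ℝ) (i j m : Fin 2) : ℝ := blockCoeff n i j m / (n ^ 2 - 2)

/-- The Casimir constant of the isotropy representation. -/
noncomputable def casimirConst (n : ℝ) : ℝ := (2 * n - 2) / (n * (n ^ 2 - 2))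

include hn in
lemma sq_sub_two_pos : (0 : ℝ) < (n : ℝ) ^ 2 - 2 := by
  have : (3 : ℝ) ≤ n := by exact_mod_cast hn
  nlinarith

lemma proj_symm (i : Fin 2) (X Y : (pair hn).compl) :
    (standardMetric hn).form (proj hn i X) Y = (standardMetric hn).form X (proj hn i Y) := by
  rw [standardMetric_form, standardMetric_form, incl_proj, incl_proj, trace_prj_apply_mul]

lemma trace_proj_bracketP_proj_bracketP (i j m l : Fin 2) (Y Z : (pair hn).compl) :
    LinearMap.trace ℝ _ (proj hn i * (pair hn).bracketP (proj hn m Y) * proj hn j *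
      (pair hn).bracketP (proj hn l Z)) = if m = l then
        -bracketCoeff n i j m * (standardMetric hn).form (proj hn m Y) Z else 0 := by
  have h : proj hn i * (pair hn).bracketP (proj hn m Y) * proj hn j *
      (pair hn).bracketP (proj hn l Z) = compress hn (prj i * adj (prj m (incl hn Y)) * prj j *
        adj (prj l (incl hn Z))) := by
    simp only [bracketP_eq, incl_proj]
    rw [proj, proj, compress_mul, compress_mul, compress_mul, prj_mul_add, mul_assoc (prj i * adj _), add_mul_prj, mul_assoc _ (prj j),
      prj_mul_add]
  rw [h, trace_compress_eq, mul_assoc (prj i * adj _), mul_assoc (prj i), ← mul_assoc _ (prj i),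
    add_mul_prj, ← mul_assoc, ← mul_assoc, trace_prj_adj_prj_adj, standardMetric_form, incl_proj,
    Fintype.card_fin]
  have := (sq_sub_two_pos hn).ne'
  split_ifs with hml
  · rw [← hml, ← trace_prj_apply_mul, ← Module.End.mul_apply, prj_mul_self, bracketCoeff]
    field_simp
  · rfl

lemma trace_proj_isotropyTerm (i : Fin 2) (Y Z : (pair hn).compl) :
    LinearMap.trace ℝ _ (proj hn i * isotropyTerm (pair hn) Y Z) =
      -casimirConst n * (standardMetric hn).form (proj hn i Y) Z := by
  have hne : (i : Fin 2) = 0 ∨ i = 1 := by fin_cases i <;> simp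
  rw [isotropyTerm_eq, proj, compress_mul, prj_mul_add, trace_compress_eq, ← mul_assoc, add_mul_prj,
    ← proj, standardMetric_form, incl_proj]
  conv_lhs => rw [← prj_add_prj_incl hn Z, ← prj_add_prj_incl hn Y]
  have hpos := (sq_sub_two_pos hn).ne'
  have hn0 : (n : ℝ) ≠ 0 := by positivity
  simp only [prjP, LinearMap.add_apply, adj_add, mul_add, add_mul, map_add, ← mul_assoc,
    trace_prj_adj_prjK_adj, Fintype.card_fin]
  rcases hne with rfl | rfl
  all_goals
    simp only [zero_ne_one, one_ne_zero, and_false, and_true, if_false, if_true,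
      add_zero, zero_add, casimirConst, trace_prj_apply_mul _ (incl hn Z)]
    rw [← Module.End.mul_apply, prj_mul_self, Matrix.trace_mul_comm]
    field_simp

/-! ### The Ricci tensor of a diagonal metric -/

section Diagonal

variable {hn} {g : (pair hn).InvMetric} {x : Fin 2 → ℝ}

/-- The endomorphism `x₀ ⊕ x₁` of `𝔭 = 𝔭₁ ⊕ 𝔭₂`. -/
noncomputable def diagEnd (hn : 3 ≤ n) (x : Fin 2 → ℝ) : Module.End ℝ (pair hn).compl :=
  ∑ i, x i • proj hn i

lemma diagEnd_mul (x y : Fin 2 → ℝ) : diagEnd hn x * diagEnd hn y = diagEnd hn (x * y) := by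
  simp only [diagEnd, Fin.sum_univ_two, mul_add, add_mul, smul_mul_smul_comm, proj_mul_self,
    proj_mul_of_ne hn zero_ne_one, proj_mul_of_ne hn one_ne_zero, smul_zero, add_zero, zero_add,
    Pi.mul_apply]

lemma diagEnd_one : diagEnd hn 1 = 1 := by
  simp only [diagEnd, Pi.one_apply, one_smul, sum_proj]

lemma diagEnd_proj (x : Fin 2 → ℝ) (m : Fin 2) : diagEnd hn x * proj hn m = x m • proj hn m := by
  fin_cases m <;> simp [diagEnd, add_mul, proj_mul_self, proj_mul_of_ne]

lemma diagEnd_symm (x : Fin 2 → ℝ) (X Y : (pair hn).compl) :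
    (standardMetric hn).form (diagEnd hn x X) Y = (standardMetric hn).form X (diagEnd hn x Y) := by
  simp [diagEnd, proj_symm]

lemma eq_sum_proj_mul (T : Module.End ℝ (pair hn).compl) :
    T = ∑ k, ∑ j, proj hn k * T * proj hn j := by
  simp_rw [← Finset.mul_sum, sum_proj, mul_one, ← Finset.sum_mul, sum_proj, one_mul]

lemma diagEnd_mul_mul_diagEnd (x y : Fin 2 → ℝ) (T : Module.End ℝ (pair hn).compl) :
    diagEnd hn x * T * diagEnd hn y = ∑ k, ∑ j, (x k * y j) • (proj hn k * T * proj hn j) := by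
  simp_rw [diagEnd, Finset.sum_mul, Finset.mul_sum, smul_mul_assoc, mul_smul_comm, smul_smul]

/-- On the block (k, j), multiplying by the inverse metric on the left divides by x k, and
multiplying by the metric on the right multiplies by x j. -/
lemma add_smul_sub_eq_sum (c : ℝ) (x : Fin 2 → ℝ) (T : Module.End ℝ (pair hn).compl) :
    T + c • (diagEnd hn x⁻¹ * T) - diagEnd hn x⁻¹ * T * diagEnd hn x =
      ∑ k, ∑ j, (1 + (c - x j) / x k) • (proj hn k * T * proj hn j) := by
  have h2 := diagEnd_mul_mul_diagEnd x⁻¹ 1 T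
  rw [diagEnd_one, mul_one] at h2
  rw [diagEnd_mul_mul_diagEnd, h2]
  conv_lhs => enter [1, 1]; rw [eq_sum_proj_mul T]
  rw [Finset.smul_sum, ← Finset.sum_add_distrib, ← Finset.sum_sub_distrib]
  refine Finset.sum_congr rfl fun k _ => ?_
  rw [Finset.smul_sum, ← Finset.sum_add_distrib, ← Finset.sum_sub_distrib]
  refine Finset.sum_congr rfl fun j _ => ?_
  rw [smul_smul]
  simp only [Pi.inv_apply, Pi.one_apply]
  module

/-- Under the trace, blocks pair like matrix units: (i, j) only meets (j, i). -/
lemma trace_proj_mul_proj_mul (i j k l : Fin 2) (T T' : Module.End ℝ (pair hn).compl) :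
    LinearMap.trace ℝ _ ((proj hn i * T * proj hn j) * (proj hn k * T' * proj hn l)) =
      if j = k ∧ i = l then LinearMap.trace ℝ _ (proj hn i * T * proj hn j * T') else 0 := by
  split_ifs with h
  · rw [← h.1, ← h.2, MatrixEnd.trace_compress (proj_mul_self hn i) (proj_mul_self hn j)]
  · by_cases hjk : j = k
    · have hil : l ≠ i := fun hl => h ⟨hjk, hl.symm⟩
      rw [LinearMap.trace_mul_comm, mul_assoc, ← mul_assoc (proj hn l), ← mul_assoc (proj hn l),
        proj_mul_of_ne hn hil]
      simp
    · rw [mul_assoc, ← mul_assoc (proj hn j), ← mul_assoc (proj hn j), proj_mul_of_ne hn hjk]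
      simp

lemma trace_sum_proj_mul (a b : Fin 2 → Fin 2 → ℝ) (T T' : Module.End ℝ (pair hn).compl) :
    LinearMap.trace ℝ _ ((∑ k, ∑ j, a k j • (proj hn k * T * proj hn j)) *
      ∑ k, ∑ j, b k j • (proj hn k * T' * proj hn j)) =
      ∑ k, ∑ j, a k j * b j k * LinearMap.trace ℝ _ (proj hn k * T * proj hn j * T') := by
  simp only [Fin.sum_univ_two, smul_mul_smul_comm, map_add, map_smul,
    trace_proj_mul_proj_mul, mul_add, add_mul, smul_eq_mul]
  simp
  ring

/-- Linearity of `Y ↦ T_Y + A T_{GY} - A T_Y B` along the decomposition of `𝔭`. -/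
lemma sum_bracketP_proj (A B G : Module.End ℝ (pair hn).compl) (Y : (pair hn).compl) :
    (pair hn).bracketP Y + A * (pair hn).bracketP (G Y) - A * (pair hn).bracketP Y * B =
      ∑ m, ((pair hn).bracketP (proj hn m Y) + A * (pair hn).bracketP (G (proj hn m Y))
        - A * (pair hn).bracketP (proj hn m Y) * B) := by
  let F : (pair hn).compl →ₗ[ℝ] Module.End ℝ (pair hn).compl :=
    (pair hn).bracketP + LinearMap.mulLeft ℝ A ∘ₗ (pair hn).bracketP ∘ₗ G
      - LinearMap.mulRight ℝ B ∘ₗ LinearMap.mulLeft ℝ A ∘ₗ (pair hn).bracketP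
  have hY : ∑ m, proj hn m Y = Y := by
    rw [← LinearMap.sum_apply, sum_proj, Module.End.one_apply]
  have h := map_sum F (fun m => proj hn m Y) Finset.univ
  rw [hY] at h
  exact h

lemma bracketP_proj_eq_sum (x : Fin 2 → ℝ) (m : Fin 2) (Y : (pair hn).compl) :
    (pair hn).bracketP (proj hn m Y)
      + diagEnd hn x⁻¹ * (pair hn).bracketP (diagEnd hn x (proj hn m Y))
      - diagEnd hn x⁻¹ * (pair hn).bracketP (proj hn m Y) * diagEnd hn x =
      ∑ k, ∑ j, (1 + (x m - x j) / x k) •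
        (proj hn k * (pair hn).bracketP (proj hn m Y) * proj hn j) := by
  have h : diagEnd hn x (proj hn m Y) = x m • proj hn m Y := by
    rw [← Module.End.mul_apply, diagEnd_proj, LinearMap.smul_apply]
  have h' : diagEnd hn x⁻¹ * (pair hn).bracketP (diagEnd hn x (proj hn m Y)) =
      x m • (diagEnd hn x⁻¹ * (pair hn).bracketP (proj hn m Y)) := by
    rw [h, LinearMap.map_smul, mul_smul_comm]
  rw [h']
  exact add_smul_sub_eq_sum (x m) x _

variable (hx : ∀ i, x i ≠ 0)
  (hg : ∀ X Y, g.form X Y = (standardMetric hn).form (diagEnd hn x X) Y)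
include hx hg

lemma nomizu_flip_diagonal (Y : (pair hn).compl) : g.nomizu.flip Y =
    (-(1 / 2) : ℝ) • ∑ m, ∑ k, ∑ j, (1 + (x m - x j) / x k) •
      (proj hn k * (pair hn).bracketP (proj hn m Y) * proj hn j) := by
  have hx1 : diagEnd hn x * diagEnd hn x⁻¹ = 1 := by
    rw [diagEnd_mul, ← diagEnd_one]
    congr 1
    ext i
    simp [hx i]
  rw [(standardMetric_naturallyReductive hn).nomizu_flip hx1 hg, sum_bracketP_proj]
  congr 1
  exact Finset.sum_congr rfl fun m _ => bracketP_proj_eq_sum x m Y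

/-- In the trace of two Nomizu maps the block (k, j) of one meets the block (j, k) of the other, so
their scale factors multiply; terms with the two arguments in different summands vanish. -/
lemma ricci_diagonal (Y Z : (pair hn).compl) : g.ricci Y Z =
    ∑ m, (casimirConst n + 1 / 4 * ∑ k, ∑ j, (1 + (x m - x j) / x k) * (1 + (x m - x k) / x j) *
      bracketCoeff n k j m) * (standardMetric hn).form (proj hn m Y) Z := by
  rw [g.ricci_eq (standardMetric_naturallyReductive hn).trace_bracketP,
    nomizu_flip_diagonal hx hg, nomizu_flip_diagonal hx hg, smul_mul_smul_comm]
  have h : LinearMap.trace ℝ _ (isotropyTerm (pair hn) Y Z) =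
      ∑ m, LinearMap.trace ℝ _ (proj hn m * isotropyTerm (pair hn) Y Z) := by
    rw [← map_sum, ← Finset.sum_mul, sum_proj, one_mul]
  rw [h]
  rw [Finset.sum_mul_sum]
  simp only [map_smul, map_sum, trace_sum_proj_mul, trace_proj_isotropyTerm,
    trace_proj_bracketP_proj_bracketP, mul_ite, mul_zero, Finset.sum_ite_irrel,
    Finset.sum_const_zero, Finset.sum_ite_eq, Finset.mem_univ, if_true, smul_eq_mul]
  rw [Finset.mul_sum, ← Finset.sum_neg_distrib, ← Finset.sum_sub_distrib]
  refine Finset.sum_congr rfl fun m _ => ?_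
  simp only [Fin.sum_univ_two]
  ring

end Diagonal

end TensorSO

namespace MatrixEnd

/-! ### Bilinear forms on matrices invariant under the special orthogonal group -/

section Invariant

variable {n : ℕ}

/-- Every symmetric matrix is diagonalized by a rotation. -/
lemma exists_rotation_diagonal [NeZero n] {S : Matrix (Fin n) (Fin n) ℝ} (hS : Sᵀ = S) :
    ∃ (R : Matrix (Fin n) (Fin n) ℝ) (d : Fin n → ℝ), R * Rᵀ = 1 ∧ R.det = 1 ∧
      R * Matrix.diagonal d * Rᵀ = S := by
  have hH : S.IsHermitian := by
    rw [Matrix.IsHermitian, Matrix.conjTranspose_eq_transpose_of_trivial, hS]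
  obtain ⟨U, d, hU, hd⟩ : ∃ (U : Matrix (Fin n) (Fin n) ℝ) (d : Fin n → ℝ), U * Uᵀ = 1 ∧
      U * Matrix.diagonal d * Uᵀ = S := by
    refine ⟨hH.eigenvectorUnitary, hH.eigenvalues, ?_, ?_⟩
    · have := (Matrix.mem_unitaryGroup_iff).1 hH.eigenvectorUnitary.2
      rwa [Matrix.star_eq_conjTranspose, Matrix.conjTranspose_eq_transpose_of_trivial] at this
    · conv_rhs => rw [hH.spectral_theorem, Unitary.conjStarAlgAut_apply]
      simp [Matrix.star_eq_conjTranspose, Matrix.conjTranspose_eq_transpose_of_trivial]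
  have hdet : U.det * U.det = 1 := by
    nth_rw 2 [← Matrix.det_transpose U]
    rw [← Matrix.det_mul, hU, Matrix.det_one]
  -- The orthogonal diagonalizer may have determinant -1; a sign on the first eigenvector corrects
  -- this and does not disturb diagonal matrices.
  let e : Matrix (Fin n) (Fin n) ℝ := Matrix.diagonal (Function.update (1 : Fin n → ℝ) 0 U.det)
  have hup : ∀ i, Function.update (1 : Fin n → ℝ) 0 U.det i *
      Function.update (1 : Fin n → ℝ) 0 U.det i = 1 := by
    intro i
    by_cases hi : i = 0
    · subst hi; simpa using hdet
    · simp [hi]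
  have he : ∀ d' : Fin n → ℝ, e * Matrix.diagonal d' * eᵀ = Matrix.diagonal d' := fun d' => by
    rw [Matrix.diagonal_transpose, Matrix.diagonal_mul_diagonal, Matrix.diagonal_mul_diagonal]
    refine congrArg _ (funext fun i => ?_)
    rw [mul_right_comm, hup, one_mul]
  refine ⟨U * e, d, ?_, ?_, ?_⟩
  · have := he 1
    rw [show Matrix.diagonal (1 : Fin n → ℝ) = 1 from Matrix.diagonal_one, mul_one] at this
    rw [Matrix.transpose_mul, Matrix.mul_assoc, ← Matrix.mul_assoc e, this, Matrix.one_mul, hU]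
  · rw [Matrix.det_mul, Matrix.det_diagonal, Finset.prod_update_of_mem (Finset.mem_univ _)]
    simpa using hdet
  · rw [← hd, Matrix.transpose_mul]
    calc U * e * Matrix.diagonal d * (eᵀ * Uᵀ) = U * (e * Matrix.diagonal d * eᵀ) * Uᵀ := by
          simp only [Matrix.mul_assoc]
      _ = _ := by rw [he]

/-- The bilinear form `β` on the matrices is invariant under conjugation by `SO(n)`. -/
def IsSOInvariant (β : LinearMap.BilinForm ℝ (Matrix (Fin n) (Fin n) ℝ)) : Prop :=
  ∀ R : Matrix (Fin n) (Fin n) ℝ, R * Rᵀ = 1 → R.det = 1 → ∀ X Y,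
    β (R * X * Rᵀ) (R * Y * Rᵀ) = β X Y

/-- The value of a bilinear form at two elementary matrices. -/
noncomputable def entry (β : LinearMap.BilinForm ℝ (Matrix (Fin n) (Fin n) ℝ)) (i j k l : Fin n) :
    ℝ :=
  β (Matrix.single i j 1) (Matrix.single k l 1)

lemma eq_sum_entry (β : LinearMap.BilinForm ℝ (Matrix (Fin n) (Fin n) ℝ))
    (X Y : Matrix (Fin n) (Fin n) ℝ) :
    β X Y = ∑ i, ∑ j, X i j * ∑ k, ∑ l, Y k l * entry β i j k l := by
  have h : ∀ Z : Matrix (Fin n) (Fin n) ℝ, Z = ∑ i, ∑ j, Z i j • Matrix.single i j (1 : ℝ) := by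
    intro Z
    conv_lhs => rw [Matrix.matrix_eq_sum_single Z]
    simp [Matrix.smul_single]
  conv_lhs => rw [h X]
  simp only [map_sum, LinearMap.sum_apply, map_smul, LinearMap.smul_apply, smul_eq_mul]
  refine Finset.sum_congr rfl fun i _ => Finset.sum_congr rfl fun j _ => congrArg _ ?_
  conv_lhs => rw [h Y]
  simp only [map_sum, map_smul, smul_eq_mul, entry]

/-- The signed permutation matrix sending `e_i` to `s_i e_{σ i}`. -/
def signedPerm (σ : Equiv.Perm (Fin n)) (s : Fin n → ℝ) : Matrix (Fin n) (Fin n) ℝ :=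
  (Matrix.diagonal s).submatrix σ.symm id

lemma signedPerm_mul_transpose (σ : Equiv.Perm (Fin n)) {s : Fin n → ℝ} (hs : ∀ i, s i * s i = 1) :
    signedPerm σ s * (signedPerm σ s)ᵀ = 1 := by
  rw [signedPerm, Matrix.transpose_submatrix, ← Matrix.submatrix_mul _ _ _ _ _
    Function.bijective_id, Matrix.diagonal_transpose, Matrix.diagonal_mul_diagonal]
  simp [hs]

lemma det_signedPerm (σ : Equiv.Perm (Fin n)) (s : Fin n → ℝ) :
    (signedPerm σ s).det = (Equiv.Perm.sign σ : ℤ) * ∏ i, s i := by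
  rw [signedPerm, Matrix.det_permute, Matrix.det_diagonal, Equiv.Perm.sign_symm]

lemma signedPerm_conj_single (σ : Equiv.Perm (Fin n)) (s : Fin n → ℝ) (i j : Fin n) :
    signedPerm σ s * Matrix.single i j 1 * (signedPerm σ s)ᵀ =
      (s i * s j) • Matrix.single (σ i) (σ j) 1 := by
  have h : ∀ a i, signedPerm σ s a i = if σ i = a then s i else 0 := fun a i => by
    simp only [signedPerm, Matrix.submatrix_apply, Matrix.diagonal_apply, id, Equiv.symm_apply_eq]
    by_cases hi : σ i = a
    · simp [← hi]
    · simp [hi, Ne.symm hi]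
  ext a b
  rw [Matrix.mul_assoc, mul_single_mul_apply, Matrix.transpose_apply, h, h, Matrix.smul_apply,
    Matrix.single_apply, smul_eq_mul]
  by_cases h1 : σ i = a <;> by_cases h2 : σ j = b <;> simp [h1, h2]

/-- The symmetric group acts doubly transitively. -/
lemma exists_perm_apply_eq {p q i j : Fin n} (hpq : p ≠ q) (hij : i ≠ j) :
    ∃ σ : Equiv.Perm (Fin n), σ p = i ∧ σ q = j := by
  refine ⟨Equiv.swap (Equiv.swap p i q) j * Equiv.swap p i, ?_, by simp⟩
  rw [Equiv.Perm.mul_apply, Equiv.swap_apply_left]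
  refine Equiv.swap_apply_of_ne_of_ne (fun h => hpq ?_) hij
  rw [← Equiv.swap_apply_left p i] at h
  exact (Equiv.swap p i).injective (by simpa using h)

namespace IsSOInvariant

variable {β : LinearMap.BilinForm ℝ (Matrix (Fin n) (Fin n) ℝ)}

lemma flip (hβ : IsSOInvariant β) : IsSOInvariant β.flip := fun R h1 h2 X Y => hβ R h1 h2 Y X

variable (hβ : IsSOInvariant β)
include hβ

lemma entry_signedPerm (σ : Equiv.Perm (Fin n)) {s : Fin n → ℝ} (hs : ∀ i, s i * s i = 1)
    (h : (Equiv.Perm.sign σ : ℤ) * ∏ i, s i = 1) (i j k l : Fin n) :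
    s i * s j * s k * s l * entry β (σ i) (σ j) (σ k) (σ l) = entry β i j k l := by
  have := hβ (signedPerm σ s) (signedPerm_mul_transpose σ hs) ((det_signedPerm σ s).trans h)
    (Matrix.single i j 1) (Matrix.single k l 1)
  rw [signedPerm_conj_single, signedPerm_conj_single] at this
  simp only [map_smul, LinearMap.smul_apply, smul_eq_mul] at this
  rw [entry, entry, ← this]
  ring

/-- Invariance under permutations, up to signs. -/
lemma entry_perm [NeZero n] (σ : Equiv.Perm (Fin n)) : ∃ s : Fin n → ℝ, (∀ i, s i * s i = 1) ∧
    (∏ i, s i = (Equiv.Perm.sign σ : ℤ)) ∧ ∀ i j k l,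
      s i * s j * s k * s l * entry β (σ i) (σ j) (σ k) (σ l) = entry β i j k l := by
  have h1 : ((Equiv.Perm.sign σ : ℤ) : ℝ) * (Equiv.Perm.sign σ : ℤ) = 1 := by
    rcases Int.units_eq_one_or (Equiv.Perm.sign σ) with h | h <;> simp [h]
  -- Placing the sign of σ in one slot gives the signed permutation determinant sign(σ)² = 1.
  have hs : ∀ i, Function.update (1 : Fin n → ℝ) 0 ((Equiv.Perm.sign σ : ℤ) : ℝ) i *
      Function.update (1 : Fin n → ℝ) 0 ((Equiv.Perm.sign σ : ℤ) : ℝ) i = 1 := fun i => by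
    by_cases hi : i = 0
    · subst hi; simpa using h1
    · simp [hi]
  have hp : ∏ i, Function.update (1 : Fin n → ℝ) 0 ((Equiv.Perm.sign σ : ℤ) : ℝ) i =
      (Equiv.Perm.sign σ : ℤ) := by
    rw [Finset.prod_update_of_mem (Finset.mem_univ _)]; simp
  exact ⟨_, hs, hp, hβ.entry_signedPerm σ hs (by rw [hp, h1])⟩

/-- Changing the signs of two basis vectors. -/
lemma entry_eq_zero {p q : Fin n} (hpq : p ≠ q) {i j k l : Fin n}
    (h : ∀ s : Fin n → ℝ, s p = -1 → s q = -1 → (∀ r, r ≠ p → r ≠ q → s r = 1) →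
      (∀ r, s r * s r = 1) → s i * s j * s k * s l = -1) : entry β i j k l = 0 := by
  set s : Fin n → ℝ := Function.update (Function.update 1 p (-1)) q (-1) with hs
  have hp : s p = -1 := by simp [hs, hpq]
  have hq : s q = -1 := by simp [hs]
  have hr : ∀ r, r ≠ p → r ≠ q → s r = 1 := fun r h1 h2 => by simp [hs, h1, h2]
  have hss : ∀ i, s i * s i = 1 := fun i => by
    by_cases h1 : i = p
    · rw [h1, hp]; norm_num
    by_cases h2 : i = q
    · rw [h2, hq]; norm_num
    rw [hr i h1 h2]; norm_num
  have hprod : ∏ i, s i = 1 := by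
    rw [hs, Finset.prod_update_of_mem (Finset.mem_univ q),
      Finset.prod_update_of_mem (by simp [hpq])]
    simp
  have h1 := hβ.entry_signedPerm 1 hss (by simpa using hprod) i j k l
  rw [h s hp hq hr hss] at h1
  simp only [Equiv.Perm.coe_one, id] at h1
  linarith

/-- Flip the signs of k and of a third index. The index i occurs twice, so its own sign never
matters, even if it is the flipped one. -/
lemma entry_diag_offdiag (hn : 3 ≤ n) (i : Fin n) {k l : Fin n} (hkl : k ≠ l) :
    entry β i i k l = 0 := by
  obtain ⟨q, hq⟩ : ∃ q, q ∉ ({k, l} : Finset (Fin n)) := by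
    by_contra! hc
    have h1 := Finset.card_le_card (fun x _ => hc x : (Finset.univ : Finset (Fin n)) ⊆ {k, l})
    have := Finset.card_le_two (a := k) (b := l)
    rw [Finset.card_univ, Fintype.card_fin] at h1
    omega
  simp only [Finset.mem_insert, Finset.mem_singleton, not_or] at hq
  refine hβ.entry_eq_zero (p := k) (q := q) (Ne.symm hq.1) fun s h1 h2 h3 h4 => ?_
  rw [h4 i, h1, h3 l hkl.symm (Ne.symm hq.2)]
  norm_num

lemma entry_diag_ne [NeZero n] {p q i j : Fin n} (hpq : p ≠ q) (hij : i ≠ j) :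
    entry β i i j j = entry β p p q q := by
  obtain ⟨σ, rfl, rfl⟩ := exists_perm_apply_eq hpq hij
  obtain ⟨s, h1, -, h⟩ := hβ.entry_perm σ
  rw [← h p p q q, mul_assoc (s p * s p), h1, h1, one_mul, one_mul]

lemma entry_diag_self [NeZero n] (p i : Fin n) : entry β i i i i = entry β p p p p := by
  obtain ⟨s, h1, -, h⟩ := hβ.entry_perm (Equiv.swap p i)
  have := h p p p p
  rwa [mul_assoc (s p * s p), h1, one_mul, one_mul, Equiv.swap_apply_left] at this

lemma entry_pair [NeZero n] {p q i j : Fin n} (hpq : p ≠ q) (hij : i ≠ j) :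
    entry β i j i j = entry β p q p q := by
  obtain ⟨σ, rfl, rfl⟩ := exists_perm_apply_eq hpq hij
  obtain ⟨s, h1, -, h⟩ := hβ.entry_perm σ
  rw [← h p q p q, show s p * s q * s p * s q = (s p * s p) * (s q * s q) by ring, h1, h1,
    one_mul, one_mul]

lemma entry_pair_swap [NeZero n] {p q i j : Fin n} (hpq : p ≠ q) (hij : i ≠ j) :
    entry β i j j i = entry β p q q p := by
  obtain ⟨σ, rfl, rfl⟩ := exists_perm_apply_eq hpq hij
  obtain ⟨s, h1, -, h⟩ := hβ.entry_perm σ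
  rw [← h p q q p, show s p * s q * s q * s p = (s p * s p) * (s q * s q) by ring, h1, h1,
    one_mul, one_mul]

/-- An invariant bilinear form on trace-free symmetric matrices and all matrices. -/
theorem apply_symm (hn : 3 ≤ n) {p q : Fin n} (hpq : p ≠ q) {S : Matrix (Fin n) (Fin n) ℝ}
    (hS : Sᵀ = S) (hS0 : S.trace = 0) (Y : Matrix (Fin n) (Fin n) ℝ) :
    β S Y = (entry β p p p p - entry β p p q q) * (S * Y).trace := by
  have : NeZero n := ⟨by omega⟩
  obtain ⟨R, d, hR, hdet, rfl⟩ := exists_rotation_diagonal hS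
  have hR' := mul_eq_one_comm.1 hR
  obtain ⟨Z, rfl⟩ : ∃ Z, Y = R * Z * Rᵀ := by
    refine ⟨Rᵀ * Y * R, ?_⟩
    calc Y = (R * Rᵀ) * Y * (R * Rᵀ) := by rw [hR, Matrix.one_mul, Matrix.mul_one]
      _ = _ := by simp only [Matrix.mul_assoc]
  have hd : ∑ i, d i = 0 := by
    rwa [Matrix.trace_mul_comm, ← Matrix.mul_assoc, hR', Matrix.one_mul, Matrix.trace_diagonal]
      at hS0
  have htr : (R * Matrix.diagonal d * Rᵀ * (R * Z * Rᵀ)).trace = ∑ i, d i * Z i i := by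
    have : R * Matrix.diagonal d * Rᵀ * (R * Z * Rᵀ) = R * (Matrix.diagonal d * Z * Rᵀ) := by
      calc _ = R * Matrix.diagonal d * (Rᵀ * R) * (Z * Rᵀ) := by simp only [Matrix.mul_assoc]
        _ = _ := by rw [hR', Matrix.mul_one]; simp only [Matrix.mul_assoc]
    rw [this, Matrix.trace_mul_comm, Matrix.mul_assoc, hR', Matrix.mul_one]
    simp [Matrix.trace, Matrix.diagonal_mul]
  rw [htr, hβ R hR hdet, eq_sum_entry]
  -- After diagonalizing, row i gives a multiple of Z i i plus a multiple of the trace of Z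
  -- independent of i; the latter is annihilated by Σ d i = 0.
  have h1 : ∀ i, ∑ k, ∑ l, Z k l * entry β i i k l =
      (entry β p p p p - entry β p p q q) * Z i i + entry β p p q q * ∑ k, Z k k := by
    intro i
    have : ∀ k, ∑ l, Z k l * entry β i i k l = Z k k * entry β i i k k := fun k =>
      Finset.sum_eq_single k (fun l _ hl => by
        rw [hβ.entry_diag_offdiag hn i hl.symm, mul_zero]) (by simp)
    simp only [this]
    rw [← Finset.add_sum_erase _ _ (Finset.mem_univ i),
      ← Finset.add_sum_erase _ (fun k => Z k k) (Finset.mem_univ i), hβ.entry_diag_self p i,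
      Finset.sum_congr rfl fun k hk => by
        rw [hβ.entry_diag_ne hpq (Finset.ne_of_mem_erase hk).symm], ← Finset.sum_mul]
    ring
  have h2 : ∀ i, ∑ j, Matrix.diagonal d i j * ∑ k, ∑ l, Z k l * entry β i j k l =
      d i * ∑ k, ∑ l, Z k l * entry β i i k l := fun i => by
    rw [Finset.sum_eq_single i (fun j _ hj => by
      rw [Matrix.diagonal_apply_ne _ hj.symm, zero_mul]) (by simp), Matrix.diagonal_apply_eq]
  simp only [h2, h1, mul_add, Finset.sum_add_distrib]
  rw [← Finset.sum_mul, hd, zero_mul, add_zero, Finset.mul_sum]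
  exact Finset.sum_congr rfl fun i _ => by ring

lemma apply_symm_right (hn : 3 ≤ n) {p q : Fin n} (hpq : p ≠ q) {S : Matrix (Fin n) (Fin n) ℝ}
    (hS : Sᵀ = S) (hS0 : S.trace = 0) (Y : Matrix (Fin n) (Fin n) ℝ) :
    β Y S = (entry β p p p p - entry β q q p p) * (Y * S).trace := by
  rw [Matrix.trace_mul_comm]
  exact hβ.flip.apply_symm hn hpq hS hS0 Y

/-- If two index pairs share exactly one index, the corresponding entry vanishes. -/
lemma entry_eq_zero_of_share {i j k l : Fin n} (hij : i ≠ j) (hkl : k ≠ l)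
    (h : (i = k ∧ j ≠ l) ∨ (i = l ∧ j ≠ k) ∨ (j = k ∧ i ≠ l) ∨ (j = l ∧ i ≠ k)) :
    entry β i j k l = 0 := by
  refine hβ.entry_eq_zero hij fun s h1 h2 h3 h4 => ?_
  rcases h with ⟨rfl, h⟩ | ⟨rfl, h⟩ | ⟨rfl, h⟩ | ⟨rfl, h⟩
  · rw [h1, h2, h3 l hkl.symm h.symm]; norm_num
  · rw [h1, h2, h3 k hkl h.symm]; norm_num
  · rw [h1, h2, h3 l h.symm hkl.symm]; norm_num
  · rw [h1, h2, h3 k h.symm hkl]; norm_num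

/-- There is room for an index outside all four; flipping it together with i changes exactly one
sign. -/
lemma entry_eq_zero_of_distinct (hn : 4 < n) {i j k l : Fin n} (hij : i ≠ j) (hik : i ≠ k)
    (hil : i ≠ l) : entry β i j k l = 0 := by
  obtain ⟨q, hq⟩ : ∃ q, q ∉ ({i, j, k, l} : Finset (Fin n)) := by
    by_contra! hc
    have h1 := Finset.card_le_card
      (fun x _ => hc x : (Finset.univ : Finset (Fin n)) ⊆ {i, j, k, l})
    have := Finset.card_le_four (a := i) (b := j) (c := k) (d := l)
    rw [Finset.card_univ, Fintype.card_fin] at h1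
    omega
  simp only [Finset.mem_insert, Finset.mem_singleton, not_or] at hq
  obtain ⟨hqi, hqj, hqk, hql⟩ := hq
  refine hβ.entry_eq_zero (p := i) (q := q) (Ne.symm hqi) fun s h1 h2 h3 h4 => ?_
  rw [h1, h3 j hij.symm (Ne.symm hqj), h3 k hik.symm (Ne.symm hqk), h3 l hil.symm (Ne.symm hql)]
  norm_num

/-- An invariant bilinear form on skew-symmetric matrices, up to the contribution of the entries
with four different indices. -/
lemma apply_skew_eq_sum [NeZero n] {p q : Fin n} (hpq : p ≠ q) {A B : Matrix (Fin n) (Fin n) ℝ}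
    (hA : Aᵀ = -A) (hB : Bᵀ = -B) :
    β A B = (entry β p q q p - entry β p q p q) * (A * B).trace +
      ∑ i, ∑ j, A i j * ∑ k, ∑ l, B k l *
        if i ≠ j ∧ i ≠ k ∧ i ≠ l ∧ j ≠ k ∧ j ≠ l ∧ k ≠ l then entry β i j k l else 0 := by
  have hA' : ∀ i, A i i = 0 := fun i => by
    have := congrFun (congrFun hA i) i
    simp only [Matrix.transpose_apply, Matrix.neg_apply] at this
    linarith
  have hB' : ∀ i, B i i = 0 := fun i => by
    have := congrFun (congrFun hB i) i
    simp only [Matrix.transpose_apply, Matrix.neg_apply] at this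
    linarith
  have hBt : ∀ i j, B i j = - B j i := fun i j => congrFun (congrFun hB j) i
  -- The pairs (i, j) and (k, l) may be equal, reversed, share one index or be disjoint. The first
  -- two give the trace term, the third vanishes, and only disjoint pairs are left undetermined.
  have hent : ∀ i j k l, A i j * (B k l * entry β i j k l) =
      A i j * ((if i = k then if j = l then B k l * entry β p q p q else 0 else 0) +
        (if i = l then if j = k then B k l * entry β p q q p else 0 else 0) + B k l *
        if i ≠ j ∧ i ≠ k ∧ i ≠ l ∧ j ≠ k ∧ j ≠ l ∧ k ≠ l then entry β i j k l else 0) := by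
    intro i j k l
    by_cases hij : i = j
    · rw [hij, hA', zero_mul, zero_mul]
    by_cases hkl : k = l
    · subst hkl
      simp [hB']
    congr 1
    by_cases h1 : i = k ∧ j = l
    · obtain ⟨rfl, rfl⟩ := h1
      simp [hij, hβ.entry_pair hpq hij]
    by_cases h2 : i = l ∧ j = k
    · obtain ⟨rfl, rfl⟩ := h2
      simp [hij, hβ.entry_pair_swap hpq hij]
    rw [← ite_and, ← ite_and, if_neg h1, if_neg h2, add_zero, zero_add]
    by_cases h3 : (i = k ∧ j ≠ l) ∨ (i = l ∧ j ≠ k) ∨ (j = k ∧ i ≠ l) ∨ (j = l ∧ i ≠ k)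
    · rw [hβ.entry_eq_zero_of_share hij hkl h3, ite_self]
    · rw [if_pos ⟨hij, by tauto, by tauto, by tauto, by tauto, hkl⟩]
  rw [eq_sum_entry]
  have hsum : ∀ i j, A i j * ∑ k, ∑ l, B k l * entry β i j k l =
      (entry β p q q p - entry β p q p q) * (A i j * B j i) + A i j * ∑ k, ∑ l, B k l *
        if i ≠ j ∧ i ≠ k ∧ i ≠ l ∧ j ≠ k ∧ j ≠ l ∧ k ≠ l then entry β i j k l else 0 := by
    intro i j
    simp only [Finset.mul_sum, hent]
    simp only [← Finset.mul_sum]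
    rw [mul_left_comm, ← mul_add]
    congr 1
    simp only [Finset.sum_add_distrib]
    congr 1
    simp [Finset.sum_ite_irrel]
    rw [hBt i j]
    ring
  simp only [hsum, Finset.sum_add_distrib, ← Finset.mul_sum, Matrix.trace, Matrix.diag,
    Matrix.mul_apply]

/-- An invariant bilinear form on skew-symmetric matrices. -/
theorem apply_skew (hn : 3 ≤ n) (hn4 : n ≠ 4) {p q : Fin n} (hpq : p ≠ q)
    {A B : Matrix (Fin n) (Fin n) ℝ} (hA : Aᵀ = -A) (hB : Bᵀ = -B) :
    β A B = (entry β p q q p - entry β p q p q) * (A * B).trace := by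
  have : NeZero n := ⟨by omega⟩
  have hdist : ∀ i j k l : Fin n, (if i ≠ j ∧ i ≠ k ∧ i ≠ l ∧ j ≠ k ∧ j ≠ l ∧ k ≠ l then
      entry β i j k l else 0) = 0 := by
    intro i j k l
    refine ite_eq_right_iff.2 fun h => ?_
    -- For n = 3 there are no four distinct indices; for n > 4 a fifth one is available.
    rcases lt_or_gt_of_ne hn4 with h4 | h4
    · simp only [ne_eq, Fin.ext_iff] at h
      omega
    · exact hβ.entry_eq_zero_of_distinct h4 h.1 h.2.1 h.2.2.1
  rw [hβ.apply_skew_eq_sum hpq hA hB]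
  simp [hdist]

end IsSOInvariant

end Invariant

/-! ### The additional invariant form on so(4). -/

section FourDimensional

/-- The Levi-Civita symbol in dimension four. -/
def leviCivita (i j k l : Fin 4) : ℤ :=
  Int.sign (((j : ℤ) - i) * ((k : ℤ) - i) * ((l : ℤ) - i) * ((k : ℤ) - j) * ((l : ℤ) - j) *
    ((l : ℤ) - k))

lemma leviCivita_perm (σ : Equiv.Perm (Fin 4)) :
    leviCivita (σ 0) (σ 1) (σ 2) (σ 3) = (Equiv.Perm.sign σ : ℤ) := by
  revert σ
  decide

/-- The Hodge star operator on the skew-symmetric `4 × 4` matrices. -/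
def star : Module.End ℝ (Matrix (Fin 4) (Fin 4) ℝ) where
  toFun X := !![0, X 2 3, - X 1 3, X 1 2; - X 2 3, 0, X 0 3, - X 0 2;
    X 1 3, - X 0 3, 0, X 0 1; - X 1 2, X 0 2, - X 0 1, 0]
  map_add' X Y := by
    ext i j
    fin_cases i <;> fin_cases j <;> simp <;> ring
  map_smul' c X := by
    ext i j
    fin_cases i <;> fin_cases j <;> simp

lemma sum_leviCivita {B : Matrix (Fin 4) (Fin 4) ℝ} (hB : Bᵀ = -B) (i j : Fin 4) :
    ∑ k, ∑ l, B k l * leviCivita i j k l = 2 * star B i j := by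
  have hBt : ∀ i j, B i j = - B j i := fun i j => congrFun (congrFun hB j) i
  have h2 : Int.sign 2 = 1 := rfl
  have h3 : Int.sign 3 = 1 := rfl
  fin_cases i <;> fin_cases j <;>
  simp [Fin.sum_univ_four, leviCivita, star, hBt 1 0, hBt 2 0, hBt 3 0, hBt 2 1, hBt 3 1,
    hBt 3 2, h2, h3] <;> ring

/-- An `SO(4)`-invariant bilinear form on skew-symmetric matrices. -/
theorem IsSOInvariant.apply_skew_four {β : LinearMap.BilinForm ℝ (Matrix (Fin 4) (Fin 4) ℝ)}
    (hβ : IsSOInvariant β) {p q : Fin 4} (hpq : p ≠ q) {A B : Matrix (Fin 4) (Fin 4) ℝ}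
    (hA : Aᵀ = -A) (hB : Bᵀ = -B) :
    β A B = (entry β p q q p - entry β p q p q) * (A * B).trace -
      2 * entry β 0 1 2 3 * (A * star B).trace := by
  have hent : ∀ i j k l : Fin 4, (if i ≠ j ∧ i ≠ k ∧ i ≠ l ∧ j ≠ k ∧ j ≠ l ∧ k ≠ l then
      entry β i j k l else 0) = leviCivita i j k l * entry β 0 1 2 3 := by
    intro i j k l
    split_ifs with h
    · obtain ⟨h1, h2, h3, h4, h5, h6⟩ := h
      have hinj : Function.Injective ![i, j, k, l] := by
        intro a b hab
        fin_cases a <;> fin_cases b <;> simp_all [eq_comm]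
      -- Four distinct indices form a permutation, and all four sign corrections occur once, so
      -- their product is the sign of the permutation.
      obtain ⟨s, -, hs, h⟩ := hβ.entry_perm (Equiv.ofBijective _
        (Finite.injective_iff_bijective.1 hinj))
      have h0 := leviCivita_perm (Equiv.ofBijective _ (Finite.injective_iff_bijective.1 hinj))
      have h' := h 0 1 2 3
      rw [Fin.prod_univ_four] at hs
      rw [hs, ← h0] at h'
      rw [← h']
      have hsq : (leviCivita i j k l : ℝ) * leviCivita i j k l = 1 := by
        have : leviCivita i j k l = (Equiv.Perm.sign (Equiv.ofBijective _
          (Finite.injective_iff_bijective.1 hinj)) : ℤ) := h0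
        rw [this]
        rcases Int.units_eq_one_or (Equiv.Perm.sign (Equiv.ofBijective _
          (Finite.injective_iff_bijective.1 hinj))) with h | h <;> simp [h]
      change entry β i j k l = leviCivita i j k l * (leviCivita i j k l * entry β i j k l)
      rw [← mul_assoc, hsq, one_mul]
    -- A repeated index makes one of the differences in the symbol zero.
    · have : leviCivita i j k l = 0 := by
        rw [leviCivita, Int.sign_eq_zero_iff_zero]
        simp only [ne_eq, Fin.ext_iff, mul_eq_zero, sub_eq_zero, Nat.cast_inj] at h ⊢
        tauto
      rw [this, Int.cast_zero, zero_mul]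
  have hst : ∀ i j, star B i j = - star B j i := fun i j => by
    fin_cases i <;> fin_cases j <;> simp [star]
  rw [hβ.apply_skew_eq_sum hpq hA hB, sub_eq_add_neg]
  congr 1
  have hsum : ∀ i j, ∑ k, ∑ l, B k l * (leviCivita i j k l * entry β 0 1 2 3) =
      -(2 * entry β 0 1 2 3) * star B j i := fun i j => by
    simp only [← mul_assoc, ← Finset.sum_mul, sum_leviCivita hB, hst j i]
    ring
  simp only [hent, hsum, Matrix.trace, Matrix.diag, Matrix.mul_apply]
  simp only [Finset.mul_sum, ← Finset.sum_neg_distrib]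
  exact Finset.sum_congr rfl fun i _ => Finset.sum_congr rfl fun j _ => by ring

end FourDimensional

end MatrixEnd

namespace MatrixEnd

/-! ### Invariant bilinear forms on the tensor product -/

/-- The exchange `X ⊗ Y ↦ Y ⊗ X` of the tensor factors. -/
def exchange {ι : Type*} [Fintype ι] [DecidableEq ι] :
    Matrix (ι × ι) (ι × ι) ℝ ≃ₐ[ℝ] Matrix (ι × ι) (ι × ι) ℝ :=
  Matrix.reindexAlgEquiv ℝ ℝ (Equiv.prodComm ι ι)

section Exchange

variable {ι : Type*} [Fintype ι] [DecidableEq ι]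

@[simp] lemma exchange_kronecker (X Y : Matrix ι ι ℝ) : exchange (X ⊗ₖ Y) = Y ⊗ₖ X := by
  ext a b
  simp [exchange, mul_comm]

@[simp] lemma exchange_exchange (U : Matrix (ι × ι) (ι × ι) ℝ) : exchange (exchange U) = U := by
  ext a b
  simp [exchange]

lemma exchange_kmap (f g : Module.End ℝ (Matrix ι ι ℝ)) (U : Matrix (ι × ι) (ι × ι) ℝ) :
    exchange (kmap f g U) = kmap g f (exchange U) := by
  induction U using kronecker_induction with
  | add X Y hX hY => simp only [map_add, hX, hY]
  | kron X Y => simp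

lemma trace_exchange (U : Matrix (ι × ι) (ι × ι) ℝ) : (exchange U).trace = U.trace := by
  simp only [Matrix.trace, Matrix.diag]
  exact Equiv.sum_comp (Equiv.prodComm ι ι).symm fun a => U a a

lemma exchange_prj (U : Matrix (ι × ι) (ι × ι) ℝ) : exchange (prj 0 U) = prj 1 (exchange U) :=
  exchange_kmap _ _ _

lemma exchange_prj_one (U : Matrix (ι × ι) (ι × ι) ℝ) : exchange (prj 1 U) = prj 0 (exchange U) :=
  exchange_kmap _ _ _

lemma prj_zero_kronecker (X Y : Matrix ι ι ℝ) : prj 0 (X ⊗ₖ Y) = sk X ⊗ₖ sy Y :=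
  kmap_kronecker _ _ _ _

end Exchange

variable {n : ℕ}

/-- The bilinear form `Ψ` is invariant under conjugation by `SO(n) ⊗ SO(n)`. -/
def IsKInvariant (Ψ : LinearMap.BilinForm ℝ (Matrix (Fin n × Fin n) (Fin n × Fin n) ℝ)) : Prop :=
  ∀ P Q : Matrix (Fin n) (Fin n) ℝ, P * Pᵀ = 1 → P.det = 1 → Q * Qᵀ = 1 → Q.det = 1 →
    ∀ U V, Ψ (kmap (TensorSO.conjEnd P) (TensorSO.conjEnd Q) U) (kmap (TensorSO.conjEnd P) (TensorSO.conjEnd Q) V) = Ψ U V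

/-- The form `(X, X') ↦ Ψ(X ⊗ Y, X' ⊗ Y')`. -/
noncomputable def slotLeft
    (Ψ : LinearMap.BilinForm ℝ (Matrix (Fin n × Fin n) (Fin n × Fin n) ℝ))
    (Y Y' : Matrix (Fin n) (Fin n) ℝ) : LinearMap.BilinForm ℝ (Matrix (Fin n) (Fin n) ℝ) :=
  Ψ.compl₁₂ ((Matrix.kroneckerBilinear (R := ℝ)).flip Y)
    ((Matrix.kroneckerBilinear (R := ℝ)).flip Y')

/-- The form `(Y, Y') ↦ Ψ(X ⊗ Y, X' ⊗ Y')`. -/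
noncomputable def slotRight
    (Ψ : LinearMap.BilinForm ℝ (Matrix (Fin n × Fin n) (Fin n × Fin n) ℝ))
    (X X' : Matrix (Fin n) (Fin n) ℝ) : LinearMap.BilinForm ℝ (Matrix (Fin n) (Fin n) ℝ) :=
  Ψ.compl₁₂ (Matrix.kroneckerBilinear (R := ℝ) X) (Matrix.kroneckerBilinear (R := ℝ) X')

namespace IsKInvariant

variable {Ψ : LinearMap.BilinForm ℝ (Matrix (Fin n × Fin n) (Fin n × Fin n) ℝ)}

lemma slotLeft_apply (X X' Y Y' : Matrix (Fin n) (Fin n) ℝ) :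
    slotLeft Ψ Y Y' X X' = Ψ (X ⊗ₖ Y) (X' ⊗ₖ Y') := rfl

lemma slotRight_apply (X X' Y Y' : Matrix (Fin n) (Fin n) ℝ) :
    slotRight Ψ X X' Y Y' = Ψ (X ⊗ₖ Y) (X' ⊗ₖ Y') := rfl

variable (hΨ : IsKInvariant Ψ)
include hΨ

lemma slotLeft_invariant (Y Y' : Matrix (Fin n) (Fin n) ℝ) : IsSOInvariant (slotLeft Ψ Y Y') := by
  intro R h1 h2 X X'
  have := hΨ R 1 h1 h2 (by simp) (by simp) (X ⊗ₖ Y) (X' ⊗ₖ Y')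
  simpa [TensorSO.conjEnd_apply, slotLeft_apply] using this

lemma slotRight_invariant (X X' : Matrix (Fin n) (Fin n) ℝ) :
    IsSOInvariant (slotRight Ψ X X') := by
  intro R h1 h2 Y Y'
  have := hΨ 1 R (by simp) (by simp) h1 h2 (X ⊗ₖ Y) (X' ⊗ₖ Y')
  simpa [TensorSO.conjEnd_apply, slotRight_apply] using this

/-- The form obtained by exchanging the tensor factors. -/
lemma exchange : IsKInvariant
    (Ψ.compl₁₂ (exchange (ι := Fin n)).toLinearMap (MatrixEnd.exchange (ι := Fin n)).toLinearMap) := by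
  intro P Q h1 h2 h3 h4 U V
  have := hΨ Q P h3 h4 h1 h2 (MatrixEnd.exchange U) (MatrixEnd.exchange V)
  rw [← exchange_kmap, ← exchange_kmap] at this
  exact this

variable [Nonempty (Fin n)]

/-- A two-step Schur argument. With the symmetric factors fixed, the form on the skew factors is a
multiple of the trace form; that multiple is itself an invariant form in the symmetric factors,
hence a multiple of theirs. -/
lemma exists_coeff_zero (hn : 3 ≤ n) (hn4 : n ≠ 4) : ∃ x : ℝ, ∀ U V,
    Ψ (prj 0 U) (prj 0 V) = x * (prj 0 U * prj 0 V).trace := by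
  let p : Fin n := ⟨0, by omega⟩
  let q : Fin n := ⟨1, by omega⟩
  have hpq : p ≠ q := by simp [p, q]
  -- Evaluated at two symmetric matrices, γ is exactly the coefficient which `apply_skew` assigns to
  -- the corresponding left slot.
  let γ := slotRight Ψ (Matrix.single p q 1) (Matrix.single q p 1) -
    slotRight Ψ (Matrix.single p q 1) (Matrix.single p q 1)
  have hγ : IsSOInvariant γ := fun R h1 h2 Y Y' =>
    congrArg₂ (fun a b : ℝ => a - b) (hΨ.slotRight_invariant _ _ R h1 h2 Y Y')
      (hΨ.slotRight_invariant _ _ R h1 h2 Y Y')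
  refine ⟨entry γ p p p p - entry γ p p q q, fun U V => ?_⟩
  induction U, V using kronecker_induction₂ with
  | add_left X Y Z h h' | add_right X Y Z h h' =>
    simp only [map_add, LinearMap.add_apply, add_mul, mul_add, h, h', Matrix.trace_add]
  | kron X Y X' Y' =>
    have h1 := (hΨ.slotLeft_invariant (sy Y) (sy Y')).apply_skew hn hn4 hpq (transpose_sk X)
      (transpose_sk X')
    have h2 := hγ.apply_symm hn hpq (transpose_sy Y) (trace_sy Y) (sy Y')
    change Ψ (sk X ⊗ₖ sy Y) (sk X' ⊗ₖ sy Y') = _ at h1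
    change entry (slotLeft Ψ (sy Y) (sy Y')) p q q p -
      entry (slotLeft Ψ (sy Y) (sy Y')) p q p q = _ at h2
    change Ψ (kmap sk sy (X ⊗ₖ Y)) (kmap sk sy (X' ⊗ₖ Y')) =
      _ * (kmap sk sy (X ⊗ₖ Y) * kmap sk sy (X' ⊗ₖ Y')).trace
    rw [kmap_kronecker, kmap_kronecker, h1, ← Matrix.mul_kronecker_mul, Matrix.trace_kronecker,
      mul_comm (sk X * sk X').trace, ← mul_assoc, ← h2]

lemma exists_coeff_one (hn : 3 ≤ n) (hn4 : n ≠ 4) : ∃ x : ℝ, ∀ U V,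
    Ψ (prj 1 U) (prj 1 V) = x * (prj 1 U * prj 1 V).trace := by
  obtain ⟨x, hx⟩ := hΨ.exchange.exists_coeff_zero hn hn4
  refine ⟨x, fun U V => ?_⟩
  have := hx (MatrixEnd.exchange U) (MatrixEnd.exchange V)
  rw [← exchange_prj_one, ← exchange_prj_one, ← map_mul MatrixEnd.exchange, trace_exchange] at this
  simpa using this

/-- In the first factor a skew matrix is paired with a trace-free symmetric one, and such a pairing
is a multiple of tr(AS) = 0. No restriction n ≠ 4 is needed here. -/
lemma apply_zero_one (hn : 3 ≤ n) (U V : Matrix (Fin n × Fin n) (Fin n × Fin n) ℝ) :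
    Ψ (prj 0 U) (prj 1 V) = 0 := by
  have hpq : (⟨0, by omega⟩ : Fin n) ≠ ⟨1, by omega⟩ := by simp
  induction U, V using kronecker_induction₂ with
  | add_left X Y Z h h' | add_right X Y Z h h' =>
    simp only [map_add, LinearMap.add_apply, h, h', add_zero]
  | kron X Y X' Y' =>
    have h1 := (hΨ.slotLeft_invariant (sy Y) (sk Y')).apply_symm_right hn hpq (transpose_sy X')
      (trace_sy X') (sk X)
    change Ψ (kmap sk sy (X ⊗ₖ Y)) (kmap sy sk (X' ⊗ₖ Y')) = _
    rw [kmap_kronecker, kmap_kronecker]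
    refine h1.trans ?_
    rw [trace_skew_mul_symm (transpose_sk X) (transpose_sy X'), mul_zero]

lemma apply_one_zero (hn : 3 ≤ n) (U V : Matrix (Fin n × Fin n) (Fin n × Fin n) ℝ) :
    Ψ (prj 1 U) (prj 0 V) = 0 := by
  have := hΨ.exchange.apply_zero_one hn (MatrixEnd.exchange U) (MatrixEnd.exchange V)
  rw [← exchange_prj_one, ← exchange_prj] at this
  simpa using this

end IsKInvariant

/-! ### Invariant forms on the tensor product for n = 4. -/

section FourDimensional

variable {Ψ : LinearMap.BilinForm ℝ (Matrix (Fin 4 × Fin 4) (Fin 4 × Fin 4) ℝ)}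

/-- The Hodge star operators on `so(4) ⊗ Sym₀(4)` and `Sym₀(4) ⊗ so(4)`. -/
noncomputable def tensorStar : Fin 2 → Module.End ℝ (Matrix (Fin 4 × Fin 4) (Fin 4 × Fin 4) ℝ) :=
  ![kmap star 1, kmap 1 star]

lemma tensorStar_zero_kronecker (X Y : Matrix (Fin 4) (Fin 4) ℝ) :
    tensorStar 0 (X ⊗ₖ Y) = star X ⊗ₖ Y :=
  kmap_kronecker _ _ _ _

lemma IsKInvariant.exists_coeff_four_zero (hΨ : IsKInvariant Ψ) : ∃ x m : ℝ, ∀ U V,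
    Ψ (prj 0 U) (prj 0 V) = x * (prj 0 U * prj 0 V).trace +
      m * (prj 0 U * tensorStar 0 (prj 0 V)).trace := by
  have hpq : (0 : Fin 4) ≠ 1 := by simp
  have hn : 3 ≤ 4 := by omega
  let γ := slotRight Ψ (Matrix.single 0 1 1) (Matrix.single 1 0 1) -
    slotRight Ψ (Matrix.single 0 1 1) (Matrix.single 0 1 1)
  have hγ : IsSOInvariant γ := fun R h1 h2 Y Y' =>
    congrArg₂ (fun a b : ℝ => a - b) (hΨ.slotRight_invariant _ _ R h1 h2 Y Y')
      (hΨ.slotRight_invariant _ _ R h1 h2 Y Y')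
  -- The form δ records the coefficient of the star term as a function of the symmetric factors.
  obtain ⟨δ, hδ'⟩ : ∃ δ, δ = slotRight Ψ (Matrix.single 0 1 1) (Matrix.single 2 3 1) := ⟨_, rfl⟩
  have hδ : IsSOInvariant δ := hδ' ▸ hΨ.slotRight_invariant _ _
  refine ⟨entry γ 0 0 0 0 - entry γ 0 0 1 1, -2 * (entry δ 0 0 0 0 - entry δ 0 0 1 1),
    fun U V => ?_⟩
  induction U, V using kronecker_induction₂ with
  | add_left X Y Z h h' | add_right X Y Z h h' =>
    simp only [map_add, LinearMap.add_apply, add_mul, mul_add, h, h', Matrix.trace_add]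
    ring
  | kron X Y X' Y' =>
    have h1 := (hΨ.slotLeft_invariant (sy Y) (sy Y')).apply_skew_four hpq (transpose_sk X)
      (transpose_sk X')
    have h2 := hγ.apply_symm hn hpq (transpose_sy Y) (trace_sy Y) (sy Y')
    have h4 : entry (slotLeft Ψ (sy Y) (sy Y')) 0 1 2 3 = δ (sy Y) (sy Y') := by
      rw [hδ', entry, slotLeft_apply, slotRight_apply]
    have h3 := hδ.apply_symm hn hpq (transpose_sy Y) (trace_sy Y) (sy Y')
    change Ψ (sk X ⊗ₖ sy Y) (sk X' ⊗ₖ sy Y') = _ at h1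
    change entry (slotLeft Ψ (sy Y) (sy Y')) 0 1 1 0 -
      entry (slotLeft Ψ (sy Y) (sy Y')) 0 1 0 1 = _ at h2
    rw [prj_zero_kronecker, prj_zero_kronecker, tensorStar_zero_kronecker, h1,
      ← Matrix.mul_kronecker_mul, ← Matrix.mul_kronecker_mul, Matrix.trace_kronecker,
      Matrix.trace_kronecker, h2, h4, h3]
    ring

lemma exchange_tensorStar (U : Matrix (Fin 4 × Fin 4) (Fin 4 × Fin 4) ℝ) :
    exchange (tensorStar 1 U) = tensorStar 0 (exchange U) := exchange_kmap _ _ _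

lemma IsKInvariant.exists_coeff_four_one (hΨ : IsKInvariant Ψ) : ∃ x m : ℝ, ∀ U V,
    Ψ (prj 1 U) (prj 1 V) = x * (prj 1 U * prj 1 V).trace +
      m * (prj 1 U * tensorStar 1 (prj 1 V)).trace := by
  obtain ⟨x, m, hx⟩ := hΨ.exchange.exists_coeff_four_zero
  refine ⟨x, m, fun U V => ?_⟩
  have := hx (MatrixEnd.exchange U) (MatrixEnd.exchange V)
  rw [← exchange_prj_one, ← exchange_prj_one, ← exchange_tensorStar, ← map_mul MatrixEnd.exchange,
    ← map_mul MatrixEnd.exchange,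
    trace_exchange, trace_exchange] at this
  simpa using this

end FourDimensional

end MatrixEnd

namespace MatrixEnd

/-! ### The Hodge star operator in dimension four -/

section Star

lemma star_apply (X : Matrix (Fin 4) (Fin 4) ℝ) : star X =
    !![0, X 2 3, - X 1 3, X 1 2; - X 2 3, 0, X 0 3, - X 0 2;
      X 1 3, - X 0 3, 0, X 0 1; - X 1 2, X 0 2, - X 0 1, 0] := rfl

lemma star_entries (X : Matrix (Fin 4) (Fin 4) ℝ) :
    (star X 0 0 = 0 ∧ star X 1 1 = 0 ∧ star X 2 2 = 0 ∧ star X 3 3 = 0) ∧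
    (star X 0 1 = X 2 3 ∧ star X 0 2 = - X 1 3 ∧ star X 0 3 = X 1 2 ∧ star X 1 2 = X 0 3 ∧
      star X 1 3 = - X 0 2 ∧ star X 2 3 = X 0 1) ∧
    star X 1 0 = - X 2 3 ∧ star X 2 0 = X 1 3 ∧ star X 3 0 = - X 1 2 ∧ star X 2 1 = - X 0 3 ∧
      star X 3 1 = X 0 2 ∧ star X 3 2 = - X 0 1 := by
  simp [star_apply]

lemma transpose_star (X : Matrix (Fin 4) (Fin 4) ℝ) : (star X)ᵀ = -star X := by
  ext i j
  fin_cases i <;> fin_cases j <;> simp [star_apply]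

lemma skew_four_ext {A B : Matrix (Fin 4) (Fin 4) ℝ} (hA : Aᵀ = -A) (hB : Bᵀ = -B)
    (h01 : A 0 1 = B 0 1) (h02 : A 0 2 = B 0 2) (h03 : A 0 3 = B 0 3) (h12 : A 1 2 = B 1 2)
    (h13 : A 1 3 = B 1 3) (h23 : A 2 3 = B 2 3) : A = B := by
  have hAt : ∀ i j, A i j = - A j i := fun i j => congrFun (congrFun hA j) i
  have hBt : ∀ i j, B i j = - B j i := fun i j => congrFun (congrFun hB j) i
  have hAB : ∀ i, A i i = B i i := fun i => by linarith [hAt i i, hBt i i]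
  have hswap : ∀ i j, A i j = B i j → A j i = B j i := fun i j h => by rw [hAt, hBt, h]
  ext i j
  fin_cases i <;> fin_cases j <;> first | exact hAB _ | assumption | (apply hswap; assumption)

lemma transpose_adj_skew {A B : Matrix (Fin 4) (Fin 4) ℝ} (hA : Aᵀ = -A) (hB : Bᵀ = -B) :
    (adj A B)ᵀ = -adj A B := by
  simp [hA, hB]

lemma transpose_jor_skew {A S : Matrix (Fin 4) (Fin 4) ℝ} (hA : Aᵀ = -A) (hS : Sᵀ = S) :
    (jor A S)ᵀ = -jor A S := by
  simp [hA, hS, add_comm]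

/-- The bracket of so(4) is linear over the star: its self-dual and anti-self-dual parts are ideals.
-/
lemma star_adj {A B : Matrix (Fin 4) (Fin 4) ℝ} (hA : Aᵀ = -A) (hB : Bᵀ = -B) :
    star (adj A B) = adj (star A) B := by
  have hAt : ∀ i j, A i j = - A j i := fun i j => congrFun (congrFun hA j) i
  have hBt : ∀ i j, B i j = - B j i := fun i j => congrFun (congrFun hB j) i
  have hA0 : ∀ i, A i i = 0 := fun i => by linarith [hAt i i]
  have hB0 : ∀ i, B i i = 0 := fun i => by linarith [hBt i i]
  refine skew_four_ext (transpose_star _) (transpose_adj_skew (transpose_star _) hB)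
    ?_ ?_ ?_ ?_ ?_ ?_ <;>
  simp [star_entries, Matrix.mul_apply, Fin.sum_univ_four, hA0, hB0, hAt 1 0, hAt 2 0,
    hAt 2 1, hAt 3 1, hAt 3 2, hBt 1 0, hBt 2 0, hBt 2 1, hBt 3 1, hBt 3 2] <;> ring

/-- For S of trace zero, the anticommutator with S exchanges self-dual and anti-self-dual matrices,
which accounts for the sign. -/
lemma star_jor {A S : Matrix (Fin 4) (Fin 4) ℝ} (hA : Aᵀ = -A) (hS : Sᵀ = S) :
    star (jor A S) = S.trace • star A - jor (star A) S := by
  have hAt : ∀ i j, A i j = - A j i := fun i j => congrFun (congrFun hA j) i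
  have hSt : ∀ i j, S i j = S j i := fun i j => congrFun (congrFun hS j) i
  have hA0 : ∀ i, A i i = 0 := fun i => by linarith [hAt i i]
  refine skew_four_ext (transpose_star _) ?_ ?_ ?_ ?_ ?_ ?_ ?_
  · rw [Matrix.transpose_sub, Matrix.transpose_smul, transpose_star,
      transpose_jor_skew (transpose_star _) hS]
    module
  all_goals
    simp [star_entries, Matrix.mul_apply, Fin.sum_univ_four, Matrix.trace, hA0, hAt 1 0, hAt 2 0,
      hAt 2 1, hAt 3 1, hAt 3 2, hSt 1 0, hSt 2 0, hSt 2 1, hSt 3 1, hSt 3 2]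
    ring

lemma sk_of_transpose_eq_neg {ι : Type*} [Fintype ι] [DecidableEq ι] {A : Matrix ι ι ℝ}
    (hA : Aᵀ = -A) : sk A = A := by
  rw [sk_apply, hA]
  module

lemma sk_mul_star : sk * star = star :=
  LinearMap.ext fun X => sk_of_transpose_eq_neg (transpose_star X)

lemma trace_star_mul {A B : Matrix (Fin 4) (Fin 4) ℝ} (hA : Aᵀ = -A) (hB : Bᵀ = -B) :
    (star A * B).trace = (A * star B).trace := by
  have hAt : ∀ i j, A i j = - A j i := fun i j => congrFun (congrFun hA j) i
  have hBt : ∀ i j, B i j = - B j i := fun i j => congrFun (congrFun hB j) i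
  simp [star_entries, Matrix.trace, Matrix.mul_apply, Fin.sum_univ_four, hAt 1 0, hAt 2 0, hAt 3 0,
    hAt 2 1, hAt 3 1, hAt 3 2, hBt 1 0, hBt 2 0, hBt 3 0, hBt 2 1, hBt 3 1, hBt 3 2]
  ring

lemma star_mul_adj {A : Matrix (Fin 4) (Fin 4) ℝ} (hA : Aᵀ = -A) :
    star * (sk * adj A * sk) = sk * adj (star A) * sk := by
  ext1 X
  have hX := transpose_sk X
  simp only [Module.End.mul_apply]
  rw [sk_of_transpose_eq_neg (transpose_adj_skew hA hX),
    sk_of_transpose_eq_neg (transpose_adj_skew (transpose_star A) hX), star_adj hA hX]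

lemma star_mul_jor {A : Matrix (Fin 4) (Fin 4) ℝ} (hA : Aᵀ = -A) :
    star * (sk * jor A * sy) = -(sk * jor (star A) * sy) := by
  ext1 X
  have hX := transpose_sy X
  simp only [Module.End.mul_apply, LinearMap.neg_apply]
  rw [sk_of_transpose_eq_neg (transpose_jor_skew hA hX),
    sk_of_transpose_eq_neg (transpose_jor_skew (transpose_star A) hX), star_jor hA hX, trace_sy,
    zero_smul, zero_sub]

lemma star_mul_jor_symm {S : Matrix (Fin 4) (Fin 4) ℝ} (hS : Sᵀ = S) :
    star * (sk * jor S * sk) = S.trace • (star * sk) - sk * jor S * sk * (star * sk) := by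
  ext1 X
  have hX := transpose_sk X
  have h : ∀ Y, jor S Y = jor Y S := fun Y => by simp [add_comm]
  simp only [Module.End.mul_apply, LinearMap.sub_apply, LinearMap.smul_apply]
  rw [h, h, sk_of_transpose_eq_neg (transpose_star (sk X)),
    sk_of_transpose_eq_neg (transpose_jor_skew hX hS),
    sk_of_transpose_eq_neg (transpose_jor_skew (transpose_star _) hS), star_jor hX hS]

lemma trace_eq_of_trace_mul {ι : Type*} [Fintype ι] [DecidableEq ι]
    {f g : Module.End ℝ (Matrix ι ι ℝ)} (h : ∀ X Y, (f X * Y).trace = (X * g Y).trace) :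
    LinearMap.trace ℝ _ f = LinearMap.trace ℝ _ g := by
  have h1 : ∀ (X : Matrix ι ι ℝ) i j, X i j = (X * Matrix.single j i 1).trace := fun X i j => by
    simp [Matrix.trace_mul_single]
  rw [trace_eq_sum, trace_eq_sum, Finset.sum_comm]
  refine Finset.sum_congr rfl fun i _ => Finset.sum_congr rfl fun j _ => ?_
  rw [h1 (f _), h, h1 (g _), Matrix.trace_mul_comm]

lemma trace_star_sk_apply_mul (X Y : Matrix (Fin 4) (Fin 4) ℝ) :
    ((star * sk : Module.End ℝ (Matrix (Fin 4) (Fin 4) ℝ)) X * Y).trace =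
      (X * (star * sk : Module.End ℝ (Matrix (Fin 4) (Fin 4) ℝ)) Y).trace := by
  have h : sk (star (sk X)) = star (sk X) := sk_of_transpose_eq_neg (transpose_star _)
  have h' : sk (star (sk Y)) = star (sk Y) := sk_of_transpose_eq_neg (transpose_star _)
  rw [Module.End.mul_apply, Module.End.mul_apply, ← h, trace_sk_apply_mul,
    trace_star_mul (transpose_sk X) (transpose_sk Y), trace_sk_apply_mul, h']

lemma trace_star_mul_sk : LinearMap.trace ℝ _ (star * sk) = 0 := by
  rw [trace_eq_sum]
  simp [Fin.sum_univ_four, star_entries, sk_apply]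

lemma trace_adj_apply_mul {ι : Type*} [Fintype ι] [DecidableEq ι] (S X Y : Matrix ι ι ℝ) :
    (adj S X * Y).trace = -(X * adj S Y).trace := by
  simp only [adj_apply, sub_mul, mul_sub, Matrix.trace_sub]
  rw [mul_assoc, Matrix.trace_mul_comm S, mul_assoc, mul_assoc]
  ring

lemma trace_jor_apply_mul {ι : Type*} [Fintype ι] [DecidableEq ι] (S X Y : Matrix ι ι ℝ) :
    (jor S X * Y).trace = (X * jor S Y).trace := by
  simp only [jor_apply, add_mul, mul_add, Matrix.trace_add]
  rw [mul_assoc, Matrix.trace_mul_comm S, mul_assoc, mul_assoc]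
  ring

/-- Taking adjoints reverses the product without a sign, whereas moving the star past the first
operator produces one; so the trace equals its negative. -/
lemma trace_star_jor_jor {S T : Matrix (Fin 4) (Fin 4) ℝ} (hS : Sᵀ = S)
    (hS0 : S.trace = 0) :
    LinearMap.trace ℝ _ (star * (sk * jor S * sk) * (sk * jor T * sk)) = 0 := by
  have hadj : ∀ S X Y : Matrix (Fin 4) (Fin 4) ℝ,
      ((sk * jor S * sk : Module.End ℝ (Matrix (Fin 4) (Fin 4) ℝ)) X * Y).trace =
        (X * (sk * jor S * sk : Module.End ℝ (Matrix (Fin 4) (Fin 4) ℝ)) Y).trace := fun S X Y => by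
    simp only [Module.End.mul_apply]
    rw [trace_sk_apply_mul, trace_jor_apply_mul, trace_sk_apply_mul]
  have h1 : star * (sk * jor S * sk) = star * sk * (sk * jor S * sk) := by
    simp only [mul_assoc]
    rw [← mul_assoc sk sk, sk_mul_sk]
  have h2 : LinearMap.trace ℝ _ (star * (sk * jor S * sk) * (sk * jor T * sk)) =
      LinearMap.trace ℝ _ (sk * jor T * sk * (sk * jor S * sk) * (star * sk)) := by
    rw [h1]
    refine trace_eq_of_trace_mul fun X Y => ?_
    simp only [Module.End.mul_apply (f := star * sk * (sk * jor S * sk)),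
      Module.End.mul_apply (f := star * sk), Module.End.mul_apply (f := sk * jor T * sk),
      Module.End.mul_apply (f := sk * jor T * sk * (sk * jor S * sk))]
    rw [trace_star_sk_apply_mul, hadj, hadj]
  have h3 : LinearMap.trace ℝ _ (star * (sk * jor S * sk) * (sk * jor T * sk)) =
      -LinearMap.trace ℝ _ (sk * jor T * sk * (sk * jor S * sk) * (star * sk)) := by
    rw [star_mul_jor_symm hS, hS0, zero_smul, zero_sub,
      ← neg_one_smul ℝ (_ * _ : Module.End ℝ (Matrix (Fin 4) (Fin 4) ℝ)), smul_mul_assoc, map_smul,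
      neg_one_smul, LinearMap.trace_mul_comm]
    simp only [mul_assoc]
  linarith

/-- The trace part of S contributes only tr(star) = 0; the rest anticommutes with the star. -/
lemma trace_star_jor {S : Matrix (Fin 4) (Fin 4) ℝ} (hS : Sᵀ = S) :
    LinearMap.trace ℝ _ (star * (sk * jor S * sk)) = 0 := by
  have h : LinearMap.trace ℝ _ (sk * jor S * sk * (star * sk)) =
      LinearMap.trace ℝ _ (star * (sk * jor S * sk)) := by
    rw [LinearMap.trace_mul_comm, mul_assoc, ← mul_assoc sk, ← mul_assoc sk, sk_mul_sk]
  have h1 := congrArg (LinearMap.trace ℝ (Matrix (Fin 4) (Fin 4) ℝ)) (star_mul_jor_symm hS)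
  rw [map_sub, map_smul, trace_star_mul_sk, smul_zero, h] at h1
  linarith

/-- The star is absorbed into the argument, leaving a skew operator. -/
lemma trace_star_adj {C : Matrix (Fin 4) (Fin 4) ℝ} (hC : Cᵀ = -C) :
    LinearMap.trace ℝ _ (star * (sk * adj C * sk)) = 0 := by
  rw [star_mul_adj hC]
  have h : LinearMap.trace ℝ _ (sk * adj (star C) * sk) =
      LinearMap.trace ℝ _ ((-1 : ℝ) • (sk * adj (star C) * sk)) := by
    refine trace_eq_of_trace_mul fun X Y => ?_
    simp only [Module.End.mul_apply, LinearMap.smul_apply]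
    rw [trace_sk_apply_mul, trace_adj_apply_mul, trace_sk_apply_mul, mul_smul_comm,
      Matrix.trace_smul, neg_one_smul]
  rw [map_smul, smul_eq_mul] at h
  linarith

lemma adj_mul_adj_add_jor_mul_jor {S T : Matrix (Fin 4) (Fin 4) ℝ} (hS : Sᵀ = S) (hT : Tᵀ = T) :
    adj S * adj T + jor S * jor T = jor (S * T + (S * T)ᵀ) + adj (S * T - (S * T)ᵀ) := by
  ext1 X
  simp only [LinearMap.add_apply, Module.End.mul_apply, adj_apply, jor_apply,
    Matrix.transpose_mul, hS, hT]
  noncomm_ring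

/-- For symmetric S and T, the products of commutators and of anticommutators sum to an
anticommutator with a symmetric matrix plus a commutator with a skew one. The star traces of both,
and of the product of anticommutators, are already known to vanish. -/
lemma trace_star_adj_adj {S T : Matrix (Fin 4) (Fin 4) ℝ} (hS : Sᵀ = S) (hT : Tᵀ = T)
    (hS0 : S.trace = 0) :
    LinearMap.trace ℝ _ (star * (sk * adj S * sy) * (sy * adj T * sk)) = 0 := by
  -- The commutator of a symmetric and a skew matrix is symmetric and trace-free, so the inner
  -- projection is superfluous.
  have h1 : sk * adj S * sy * (sy * adj T * sk) = sk * (adj S * adj T) * sk := by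
    ext1 X
    have hX := transpose_sk X
    have h2 : sy (adj T (sk X)) = adj T (sk X) := by
      have h3 : (adj T (sk X)).trace = 0 := by
        rw [adj_apply, Matrix.trace_sub, Matrix.trace_mul_comm, sub_self]
      rw [sy_apply, sc_apply, h3]
      simp only [adj_apply, Matrix.transpose_sub, Matrix.transpose_mul, hX, hT, neg_mul, mul_neg]
      module
    simp only [Module.End.mul_apply]
    rw [h2, h2]
  have h2 : sk * jor S * sk * (sk * jor T * sk) = sk * (jor S * jor T) * sk := by
    ext1 X
    have hX := transpose_sk X
    have h2 : sk (jor T (sk X)) = jor T (sk X) := by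
      rw [sk_apply]
      simp only [jor_apply, Matrix.transpose_add, Matrix.transpose_mul, hX, hT, neg_mul, mul_neg]
      module
    simp only [Module.End.mul_apply]
    rw [h2, h2]
  have h3 := trace_star_jor_jor (T := T) hS hS0
  have h4 := trace_star_jor (S := S * T + (S * T)ᵀ) (by simp [add_comm])
  have h5 := trace_star_adj (C := S * T - (S * T)ᵀ) (by simp)
  rw [mul_assoc] at h3 ⊢
  rw [h1]
  rw [h2] at h3
  have h6 := congrArg (fun f => LinearMap.trace ℝ _ (star * (sk * f * sk)))
    (adj_mul_adj_add_jor_mul_jor hS hT)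
  simp only [mul_add, add_mul, map_add] at h6 h4 h5
  linarith

end Star

end MatrixEnd

/-! ### The star on the tensor factors, and its traces against commutators. -/

namespace MatrixEnd

section TensorStar

lemma kmap_smul_left {ι : Type*} [Fintype ι] [DecidableEq ι] (c : ℝ)
    (f g : Module.End ℝ (Matrix ι ι ℝ)) : kmap (c • f) g = c • kmap f g := by
  simp [kmap, TensorProduct.map_smul_left]

/-- On this block only ad ⊗ jor survives, and the star passes through ad without a sign. -/
lemma tensorStar_mul_adj_zero (U : Matrix (Fin 4 × Fin 4) (Fin 4 × Fin 4) ℝ) :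
    tensorStar 0 * (prj 0 * adj (prj 0 U) * prj 0) =
      prj 0 * adj (tensorStar 0 (prj 0 U)) * prj 0 := by
  induction U using kronecker_induction with
  | add X Y hX hY => simp only [map_add, adj_add, mul_add, add_mul, hX, hY]
  | kron X Y =>
    rw [prj_zero_kronecker, tensorStar_zero_kronecker]
    simp only [prj, tensorStar, Matrix.cons_val_zero]
    rw [kmap_mul_adj_mul_kmap, kmap_mul_adj_mul_kmap, sk_jor_sk_skew (transpose_sk X),
      sk_jor_sk_skew (transpose_star _), kmap_zero_left, add_zero, add_zero, mul_smul_comm,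
      kmap_mul, star_mul_adj (transpose_sk X), one_mul]

/-- On this block only jor ⊗ ad survives, and the star changes the sign of the anticommutator with
Sym₀. -/
lemma tensorStar_mul_adj_one (U : Matrix (Fin 4 × Fin 4) (Fin 4 × Fin 4) ℝ) :
    tensorStar 0 * (prj 0 * adj (prj 0 U) * prj 1) =
      (-1 : ℝ) • (prj 0 * adj (tensorStar 0 (prj 0 U)) * prj 1) := by
  induction U using kronecker_induction with
  | add X Y hX hY => simp only [map_add, adj_add, mul_add, add_mul, hX, hY, smul_add]
  | kron X Y =>
    rw [prj_zero_kronecker, tensorStar_zero_kronecker]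
    simp only [prj, tensorStar, Matrix.cons_val_zero, Matrix.cons_val_one]
    rw [kmap_mul_adj_mul_kmap, kmap_mul_adj_mul_kmap, sk_adj_sy_skew (transpose_sk X),
      sk_adj_sy_skew (transpose_star _), kmap_zero_left, zero_add, zero_add, mul_smul_comm,
      kmap_mul, star_mul_jor (transpose_sk X), one_mul, ← neg_one_smul ℝ (_ * _ : Module.End ℝ (Matrix _ _ ℝ)),
      kmap_smul_left, smul_comm]

lemma prj_tensorStar_zero (U : Matrix (Fin 4 × Fin 4) (Fin 4 × Fin 4) ℝ) :
    prj 0 (tensorStar 0 (prj 0 U)) = tensorStar 0 (prj 0 U) := by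
  simp only [prj, tensorStar, Matrix.cons_val_zero]
  simp only [← Module.End.mul_apply, kmap_mul]
  rw [← mul_assoc sk, sk_mul_star, one_mul, sy_mul_sy]

/-- The trace of a star operator composed with two commutators. -/
noncomputable def starCoeff (i j l : Fin 2) : ℝ :=
  if l = i then if j = i then blockCoeff 4 i i i else -blockCoeff 4 i j i else 0

/-- If the star acts on the factor in which U is skew, it is absorbed into U up to a sign per block,
and the unstarred trace formula applies. -/
lemma trace_tensorStar_adj_adj_zero (j l : Fin 2)
    (U V : Matrix (Fin 4 × Fin 4) (Fin 4 × Fin 4) ℝ) :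
    LinearMap.trace ℝ _ (tensorStar l * (prj l * adj (prj 0 U) * prj j) * adj (prj 0 V)) =
      starCoeff 0 j l * (tensorStar 0 (prj 0 U) * prj 0 V).trace := by
  fin_cases l
  · have h := fun j => trace_prj_adj_prj_adj 0 j 0 0 (tensorStar 0 (prj 0 U)) V
    simp only [prj_tensorStar_zero, if_true] at h
    fin_cases j
    · simpa [starCoeff, tensorStar_mul_adj_zero] using h 0
    · simpa [starCoeff, tensorStar_mul_adj_one] using h 1
  -- Here the star acts on the factor in which U and V are symmetric; there the trace of the second
  -- factor vanishes by `trace_star_adj_adj` or `trace_star_jor_jor`.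
  · have h0 : starCoeff 0 j 1 = 0 := by simp [starCoeff]
    change LinearMap.trace ℝ _ (tensorStar 1 * (prj 1 * adj (prj 0 U) * prj j) * adj (prj 0 V)) =
      starCoeff 0 j 1 * _
    rw [h0, zero_mul]
    have h1 : tensorStar 1 * (prj 1 * adj (prj 0 U) * prj j) * adj (prj 0 V) =
        (tensorStar 1 * (prj 1 * adj (prj 0 U) * prj j)) * (prj j * adj (prj 0 V)) := by
      simp only [mul_assoc]
      rw [← mul_assoc (prj j) (prj j), prj_mul_self]
    have h2 : tensorStar 1 * (prj 1 * adj (prj 0 U) * prj j) =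
        prj 1 * (tensorStar 1 * (prj 1 * adj (prj 0 U) * prj j)) := by
      have : prj 1 * (tensorStar 1 * prj 1) = tensorStar 1 * prj 1 := by
        simp only [prj, tensorStar, Matrix.cons_val_one, Matrix.cons_val_zero]
        rw [kmap_mul, kmap_mul, ← mul_assoc sk, sk_mul_star, one_mul, sy_mul_sy]
      simp only [← mul_assoc] at this ⊢
      rw [this]
    rw [h1, h2, mul_assoc, LinearMap.trace_mul_comm, mul_assoc]
    clear h0 h1 h2
    induction U, V using kronecker_induction₂ with
    | add_left X Y Z h h' | add_right X Y Z h h' =>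
      simp only [map_add, adj_add, mul_add, add_mul, h, h', add_zero]
    | kron X Y X' Y' =>
      rw [prj_zero_kronecker, prj_zero_kronecker]
      have hX := transpose_sk X
      have hX' := transpose_sk X'
      have kY := transpose_sy Y
      have kY' := transpose_sy Y'
      have tY := trace_sy Y
      have tY' := trace_sy Y'
      fin_cases j
      · simp [prj, tensorStar, kmap_mul_adj_mul_kmap, kmap_mul, trace_kmap, sk_adj_sy_skew,
          sy_adj_sk_skew, sk_jor_sy_symm, sy_jor_sk_symm, hX, hX', kY, kY', trace_star_adj_adj kY kY' tY]
      · simp [prj, tensorStar, kmap_mul_adj_mul_kmap, kmap_mul, trace_kmap, sy_jor_sy_skew,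
          sk_adj_sk_symm, hX, hX', kY, kY', trace_star_jor_jor kY tY]

/-- On scalars the anticommutator is multiplication by 2A, so the star passes without the sign it
has on Sym₀. -/
lemma star_mul_jor_sc {A : Matrix (Fin 4) (Fin 4) ℝ} (hA : Aᵀ = -A) :
    star * (sk * jor A * sc) = sk * jor (star A) * sc := by
  ext1 X
  have h : (sc X)ᵀ = sc X := by simp [sc_apply]
  simp only [Module.End.mul_apply]
  rw [sk_of_transpose_eq_neg (transpose_jor_skew hA h),
    sk_of_transpose_eq_neg (transpose_jor_skew (transpose_star A) h), sc_apply, jor_apply,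
    jor_apply, mul_smul_comm, smul_mul_assoc, mul_smul_comm, smul_mul_assoc, one_mul, one_mul,
    mul_one, mul_one, map_add, map_smul]

lemma tensorStar_mul_adj_prjK (U : Matrix (Fin 4 × Fin 4) (Fin 4 × Fin 4) ℝ) :
    tensorStar 0 * (prj 0 * adj (prj 0 U) * prjK) =
      prj 0 * adj (tensorStar 0 (prj 0 U)) * prjK := by
  induction U using kronecker_induction with
  | add X Y hX hY => simp only [map_add, adj_add, mul_add, add_mul, hX, hY]
  | kron X Y =>
    rw [prj_zero_kronecker, tensorStar_zero_kronecker]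
    simp only [prj, prjK, tensorStar, Matrix.cons_val_zero, mul_add]
    simp only [kmap_mul_adj_mul_kmap, sk_jor_sk_skew (transpose_sk X),
      sk_jor_sk_skew (transpose_star _), mul_adj_mul_sc, kmap_zero_left, zero_add, add_zero,
      mul_smul_comm, kmap_mul, star_mul_adj (transpose_sk X), star_mul_jor_sc (transpose_sk X),
      one_mul]

/-- The factor 3/2 is the isotropy constant (2n - 2)/n at n = 4. -/
lemma trace_tensorStar_adj_prjK_adj_zero (l : Fin 2)
    (U V : Matrix (Fin 4 × Fin 4) (Fin 4 × Fin 4) ℝ) :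
    LinearMap.trace ℝ _ (tensorStar l * (prj l * adj (prj 0 U) * prjK) * adj (prj 0 V)) =
      if l = 0 then 3 / 2 * (tensorStar 0 (prj 0 U) * prj 0 V).trace else 0 := by
  obtain rfl | rfl : l = 0 ∨ l = 1 := by omega
  · have h := trace_prj_adj_prjK_adj 0 0 0 (tensorStar 0 (prj 0 U)) V
    rw [prj_tensorStar_zero] at h
    rw [tensorStar_mul_adj_prjK, h]
    norm_num
  · have h : prj 1 * adj (prj 0 U) * prjK = 0 := by
      induction U using kronecker_induction with
      | add X Y hX hY => simp only [map_add, adj_add, mul_add, add_mul, hX, hY, add_zero]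
      | kron X Y =>
        rw [prj_zero_kronecker]
        simp only [prj, prjK, Matrix.cons_val_one, Matrix.cons_val_zero, mul_add]
        simp only [kmap_mul_adj_mul_kmap, sy_adj_sk_skew (transpose_sk X),
          sy_jor_sc_skew (transpose_sk X), mul_adj_mul_sc, kmap_zero_left, kmap_zero_right,
          add_zero, smul_zero]
    rw [h, mul_zero, zero_mul, map_zero, if_neg one_ne_zero]

/-- Conjugation with the exchange of the tensor factors. -/
noncomputable def exchangeConj :
    Module.End ℝ (Matrix (Fin 4 × Fin 4) (Fin 4 × Fin 4) ℝ) ≃ₐ[ℝ]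
      Module.End ℝ (Matrix (Fin 4 × Fin 4) (Fin 4 × Fin 4) ℝ) :=
  (exchange (ι := Fin 4)).toLinearEquiv.conjAlgEquiv ℝ

lemma exchangeConj_apply (f : Module.End ℝ (Matrix (Fin 4 × Fin 4) (Fin 4 × Fin 4) ℝ))
    (U : Matrix (Fin 4 × Fin 4) (Fin 4 × Fin 4) ℝ) :
    exchangeConj f U = exchange (f (exchange U)) := rfl

lemma trace_exchangeConj (f : Module.End ℝ (Matrix (Fin 4 × Fin 4) (Fin 4 × Fin 4) ℝ)) :
    LinearMap.trace ℝ _ (exchangeConj f) = LinearMap.trace ℝ _ f :=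
  LinearMap.trace_conj' f (exchange (ι := Fin 4)).toLinearEquiv

lemma exchangeConj_adj (U : Matrix (Fin 4 × Fin 4) (Fin 4 × Fin 4) ℝ) :
    exchangeConj (adj U) = adj (exchange U) := by
  ext1 V
  rw [exchangeConj_apply, adj_apply, adj_apply, map_sub, map_mul, map_mul, exchange_exchange]

lemma exchangeConj_prj (i : Fin 2) : exchangeConj (prj i) = prj (1 - i) := by
  ext1 V
  rw [exchangeConj_apply]
  fin_cases i
  · exact (exchange_prj _).trans (by simp)
  · exact (exchange_prj_one _).trans (by simp)

lemma exchange_tensorStar_zero (U : Matrix (Fin 4 × Fin 4) (Fin 4 × Fin 4) ℝ) :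
    exchange (tensorStar 0 U) = tensorStar 1 (exchange U) := exchange_kmap _ _ _

lemma exchangeConj_tensorStar (i : Fin 2) :
    exchangeConj (tensorStar i) = tensorStar (1 - i) := by
  ext1 V
  rw [exchangeConj_apply]
  fin_cases i
  · exact (exchange_tensorStar_zero _).trans (by simp)
  · exact (exchange_tensorStar _).trans (by simp)

lemma trace_tensorStar_adj_adj (i j l : Fin 2)
    (U V : Matrix (Fin 4 × Fin 4) (Fin 4 × Fin 4) ℝ) :
    LinearMap.trace ℝ _ (tensorStar l * (prj l * adj (prj i U) * prj j) * adj (prj i V)) =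
      starCoeff i j l * (tensorStar i (prj i U) * prj i V).trace := by
  obtain rfl | rfl : i = 0 ∨ i = 1 := by omega
  · exact trace_tensorStar_adj_adj_zero j l U V
  · have h := trace_tensorStar_adj_adj_zero (1 - j) (1 - l) (exchange U) (exchange V)
    rw [← trace_exchangeConj] at h
    simp only [map_mul, exchangeConj_adj, exchangeConj_prj, exchangeConj_tensorStar,
      exchange_prj, exchange_exchange, sub_sub_cancel] at h
    refine h.trans ?_
    rw [← trace_exchange, map_mul, exchange_tensorStar_zero, exchange_prj, exchange_prj,
      exchange_exchange, exchange_exchange]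
    congr 1
    fin_cases j <;> fin_cases l <;> simp [starCoeff, blockCoeff]

lemma exchangeConj_prjK : exchangeConj prjK = prjK := by
  ext1 V
  rw [exchangeConj_apply, prjK, LinearMap.add_apply, map_add, exchange_kmap, exchange_kmap,
    exchange_exchange, add_comm, LinearMap.add_apply]

lemma trace_tensorStar_adj_prjK_adj (i l : Fin 2)
    (U V : Matrix (Fin 4 × Fin 4) (Fin 4 × Fin 4) ℝ) :
    LinearMap.trace ℝ _ (tensorStar l * (prj l * adj (prj i U) * prjK) * adj (prj i V)) =
      if l = i then 3 / 2 * (tensorStar i (prj i U) * prj i V).trace else 0 := by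
  obtain rfl | rfl : i = 0 ∨ i = 1 := by omega
  · exact trace_tensorStar_adj_prjK_adj_zero l U V
  · have h := trace_tensorStar_adj_prjK_adj_zero (1 - l) (exchange U) (exchange V)
    rw [← trace_exchangeConj] at h
    simp only [map_mul, exchangeConj_adj, exchangeConj_prj, exchangeConj_tensorStar,
      exchangeConj_prjK, exchange_prj, exchange_exchange, sub_sub_cancel] at h
    refine h.trans ?_
    rw [← trace_exchange, map_mul, exchange_tensorStar_zero, exchange_prj, exchange_prj,
      exchange_exchange, exchange_exchange]
    fin_cases l <;> simp

lemma prj_tensorStar (i : Fin 2) (U : Matrix (Fin 4 × Fin 4) (Fin 4 × Fin 4) ℝ) :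
    prj i (tensorStar i (prj i U)) = tensorStar i (prj i U) := by
  obtain rfl | rfl : i = 0 ∨ i = 1 := by omega
  · exact prj_tensorStar_zero U
  · have h := congrArg exchange (prj_tensorStar_zero (exchange U))
    simpa only [exchange_prj, exchange_tensorStar_zero, exchange_exchange] using h

lemma trace_tensorStar_mul (i : Fin 2) (U V : Matrix (Fin 4 × Fin 4) (Fin 4 × Fin 4) ℝ) :
    (tensorStar i (prj i U) * prj i V).trace = (prj i U * tensorStar i (prj i V)).trace := by
  have h0 : ∀ U V : Matrix (Fin 4 × Fin 4) (Fin 4 × Fin 4) ℝ,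
      (tensorStar 0 (prj 0 U) * prj 0 V).trace = (prj 0 U * tensorStar 0 (prj 0 V)).trace := by
    intro U V
    induction U, V using kronecker_induction₂ with
    | add_left X Y Z h h' | add_right X Y Z h h' =>
      simp only [map_add, mul_add, add_mul, h, h', Matrix.trace_add]
    | kron X Y X' Y' =>
      rw [prj_zero_kronecker, prj_zero_kronecker, tensorStar_zero_kronecker,
        tensorStar_zero_kronecker, ← Matrix.mul_kronecker_mul, ← Matrix.mul_kronecker_mul,
        Matrix.trace_kronecker, Matrix.trace_kronecker,
        trace_star_mul (transpose_sk X) (transpose_sk X')]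
  obtain rfl | rfl : i = 0 ∨ i = 1 := by omega
  · exact h0 U V
  · have h := h0 (exchange U) (exchange V)
    rw [← trace_exchange, ← trace_exchange (_ * tensorStar 0 _)] at h
    simpa only [map_mul, exchange_prj, exchange_tensorStar_zero, exchange_exchange] using h

end TensorStar

end MatrixEnd

namespace TensorSO

open LieAlgebra.Orthogonal MatrixEnd ReductivePair ReductivePair.InvMetric

variable {n : ℕ} [Nonempty (Fin n)]

/-! ### The `Ad(K)`-invariant bilinear forms on `𝔭` -/

section Forms

variable {hn : 3 ≤ n} {Φ : LinearMap.BilinForm ℝ (pair hn).compl}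

/-- Extending by the retraction to all matrices makes the classification on M_n ⊗ M_n applicable;
invariance persists because conjugation by K commutes with the projections. -/
lemma pullback_isKInvariant (hΦ : ∀ φ (hφ : φ ∈ (pair hn).AdK) (X Y : (pair hn).compl),
    Φ ⟨φ X, (pair hn).Ad_compl φ hφ X X.2⟩ ⟨φ Y, (pair hn).Ad_compl φ hφ Y Y.2⟩ = Φ X Y) :
    IsKInvariant (Φ.compl₁₂ (retr hn) (retr hn)) := by
  intro P Q h1 h2 h3 h4 U V
  let P' : Matrix.specialOrthogonalGroup (Fin n) ℝ :=
    ⟨P, Matrix.mem_specialOrthogonalGroup_iff.2 ⟨(Matrix.mem_orthogonalGroup_iff _ _).2 h1, h2⟩⟩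
  let Q' : Matrix.specialOrthogonalGroup (Fin n) ℝ :=
    ⟨Q, Matrix.mem_specialOrthogonalGroup_iff.2 ⟨(Matrix.mem_orthogonalGroup_iff _ _).2 h3, h4⟩⟩
  have hk : Ad (tensorRep n (P', Q')) ∈ (pair hn).AdK := ⟨_, ⟨_, rfl⟩, rfl⟩
  have h : ∀ W, retr hn (kmap (conjEnd P) (conjEnd Q) W) =
      ⟨Ad (tensorRep n (P', Q')) (retr hn W), (pair hn).Ad_compl _ hk _ (retr hn W).2⟩ := by
    intro W
    apply incl_injective hn
    have h5 : incl hn ⟨Ad (tensorRep n (P', Q')) (retr hn W),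
        (pair hn).Ad_compl _ hk _ (retr hn W).2⟩ = conjEnd (P ⊗ₖ Q) (incl hn (retr hn W)) :=
      coe_Ad _ _
    have h6 := fun i => LinearMap.congr_fun (conjEnd_mul_prj P' Q' i) W
    simp only [Module.End.mul_apply] at h6
    rw [h5, incl_retr, incl_retr, ← conjEnd_kronecker, prjP, LinearMap.add_apply,
      LinearMap.add_apply, map_add, ← h6, ← h6]
  rw [LinearMap.compl₁₂_apply, LinearMap.compl₁₂_apply, h, h, hΦ _ hk]

lemma incl_eq_add (X : (pair hn).compl) :
    X = retr hn (prj 0 (incl hn X)) + retr hn (prj 1 (incl hn X)) := by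
  rw [← map_add]
  exact (retr_incl hn X).symm.trans (congrArg _ (prj_add_prj_incl hn X).symm)

lemma standardMetric_form_proj (i : Fin 2) (X Y : (pair hn).compl) :
    (standardMetric hn).form (proj hn i X) Y =
      -((n : ℝ) ^ 2 - 2) * (prj i (incl hn X) * prj i (incl hn Y)).trace := by
  rw [standardMetric_form, incl_proj, ← trace_prj_apply_mul, ← Module.End.mul_apply, prj_mul_self]

/-- If `n ≠ 4`, the `Ad(K)`-invariant bilinear forms are scalar on each summand. -/
theorem form_eq_diagEnd (hn4 : n ≠ 4)
    (hΦ : ∀ φ (hφ : φ ∈ (pair hn).AdK) (X Y : (pair hn).compl),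
      Φ ⟨φ X, (pair hn).Ad_compl φ hφ X X.2⟩ ⟨φ Y, (pair hn).Ad_compl φ hφ Y Y.2⟩ = Φ X Y) :
    ∃ x : Fin 2 → ℝ, ∀ X Y, Φ X Y = (standardMetric hn).form (diagEnd hn x X) Y := by
  have h := pullback_isKInvariant hΦ
  obtain ⟨x, hx⟩ := h.exists_coeff_zero hn hn4
  obtain ⟨y, hy⟩ := h.exists_coeff_one hn hn4
  have h0 := (sq_sub_two_pos hn).ne'
  refine ⟨![-x / ((n : ℝ) ^ 2 - 2), -y / ((n : ℝ) ^ 2 - 2)], fun X Y => ?_⟩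
  have h1 := hx (incl hn X) (incl hn Y)
  have h2 := hy (incl hn X) (incl hn Y)
  have h3 := h.apply_zero_one hn (incl hn X) (incl hn Y)
  have h4 := h.apply_one_zero hn (incl hn X) (incl hn Y)
  rw [LinearMap.compl₁₂_apply] at h1 h2 h3 h4
  conv_lhs => rw [incl_eq_add X, incl_eq_add Y]
  simp only [map_add, LinearMap.add_apply, h1, h2, h3, h4, diagEnd, Fin.sum_univ_two,
    LinearMap.smul_apply, map_smul, standardMetric_form_proj, smul_eq_mul, Matrix.cons_val_zero,
    Matrix.cons_val_one]
  field_simp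
  ring

end Forms

/-! ### The star operators on 𝔭 for n = 4. -/

section FourDimensional

variable {hn : 3 ≤ 4} {Φ : LinearMap.BilinForm ℝ (pair hn).compl}

/-- The Hodge star operators on the summands of `𝔭`. -/
noncomputable def starProj (hn : 3 ≤ 4) (i : Fin 2) : Module.End ℝ (pair hn).compl :=
  compress hn (tensorStar i * prj i)

lemma mul_tensorStar_mul_prj (i : Fin 2) :
    prj i * (tensorStar i * prj i) = tensorStar i * prj i :=
  LinearMap.ext fun U => prj_tensorStar i U

lemma prjP_tensorStar_mul_prj (i : Fin 2) :
    prjP * (tensorStar i * prj i) = tensorStar i * prj i := by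
  rw [← mul_tensorStar_mul_prj, ← mul_assoc, add_mul_prj]

lemma incl_starProj (i : Fin 2) (X : (pair hn).compl) :
    incl hn (starProj hn i X) = tensorStar i (prj i (incl hn X)) := by
  rw [starProj, incl_compress, ← Module.End.mul_apply, prjP_tensorStar_mul_prj,
    Module.End.mul_apply]

lemma proj_mul_starProj (i : Fin 2) : proj hn i * starProj hn i = starProj hn i := by
  rw [proj, starProj, compress_mul, mul_assoc, prjP_tensorStar_mul_prj, mul_tensorStar_mul_prj]

lemma starProj_mul_proj (i : Fin 2) : starProj hn i * proj hn i = starProj hn i := by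
  rw [proj, starProj, compress_mul, mul_assoc, mul_assoc, add_mul_prj, prj_mul_self]

lemma starProj_mul_proj_of_ne {i j : Fin 2} (h : i ≠ j) : starProj hn i * proj hn j = 0 := by
  rw [← starProj_mul_proj, mul_assoc, proj_mul_of_ne hn h, mul_zero]

lemma standardMetric_form_starProj (i : Fin 2) (X Y : (pair hn).compl) :
    (standardMetric hn).form (starProj hn i X) Y =
      -14 * (tensorStar i (prj i (incl hn X)) * prj i (incl hn Y)).trace := by
  rw [standardMetric_form, incl_starProj, ← prj_tensorStar, trace_prj_apply_mul, prj_tensorStar]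
  norm_num

lemma starProj_symm (i : Fin 2) (X Y : (pair hn).compl) :
    (standardMetric hn).form (starProj hn i X) Y =
      (standardMetric hn).form X (starProj hn i Y) := by
  rw [(standardMetric hn).symm X, standardMetric_form_starProj, standardMetric_form_starProj,
    trace_tensorStar_mul, Matrix.trace_mul_comm]

lemma trace_starProj (i : Fin 2) : LinearMap.trace ℝ _ (starProj hn i) = 0 := by
  rw [starProj, trace_compress_eq, prjP_tensorStar_mul_prj]
  obtain rfl | rfl : i = 0 ∨ i = 1 := by omega
  · simp only [tensorStar, prj, Matrix.cons_val_zero]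
    rw [kmap_mul, trace_kmap, trace_star_mul_sk, zero_mul]
  · simp only [tensorStar, prj, Matrix.cons_val_one, Matrix.cons_val_zero]
    rw [kmap_mul, trace_kmap, trace_star_mul_sk, mul_zero]

/-- Inserting the two projections between the brackets gives the sum over j; the divisor 14 is n² -
2. -/
lemma trace_starProj_bracketP_bracketP (l i : Fin 2) (Y Z : (pair hn).compl) :
    LinearMap.trace ℝ _ (starProj hn l * (pair hn).bracketP (proj hn i Y) *
      (pair hn).bracketP (proj hn i Z)) =
        -(∑ j, starCoeff i j l) / 14 * (standardMetric hn).form (starProj hn i Y) Z := by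
  have h : prjP * (tensorStar l * prj l * prjP * adj (prj i (incl hn Y)) * prjP *
      adj (prj i (incl hn Z))) = ∑ j, tensorStar l * (prj l * adj (prj i (incl hn Y)) * prj j) *
        adj (prj i (incl hn Z)) := by
    simp only [mul_assoc]
    rw [← mul_assoc (prj l) prjP, prj_mul_add, ← mul_assoc (tensorStar l) (prj l),
      ← mul_assoc prjP, prjP_tensorStar_mul_prj]
    simp only [prjP, Fin.sum_univ_two, mul_add, add_mul, mul_assoc]
  rw [bracketP_eq, bracketP_eq, starProj, compress_mul, compress_mul, trace_compress_eq,
    incl_proj, incl_proj, h, map_sum]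
  simp only [trace_tensorStar_adj_adj]
  rw [← Finset.sum_mul, standardMetric_form_starProj]
  ring

lemma trace_starProj_isotropyTerm (l i : Fin 2) (Y Z : (pair hn).compl) :
    LinearMap.trace ℝ _ (starProj hn l * isotropyTerm (pair hn) (proj hn i Y) (proj hn i Z)) =
      if l = i then -(3 / 28) * (standardMetric hn).form (starProj hn i Y) Z else 0 := by
  rw [isotropyTerm_eq, starProj, compress_mul, trace_compress_eq, incl_proj, incl_proj]
  have h : prjP * (tensorStar l * prj l * prjP * (adj (prj i (incl hn Z)) * prjK *
      adj (prj i (incl hn Y)))) = tensorStar l * (prj l * adj (prj i (incl hn Z)) * prjK) *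
        adj (prj i (incl hn Y)) := by
    simp only [mul_assoc]
    rw [← mul_assoc (prj l) prjP, prj_mul_add, ← mul_assoc (tensorStar l) (prj l),
      ← mul_assoc prjP, prjP_tensorStar_mul_prj]
  rw [h, trace_tensorStar_adj_prjK_adj, standardMetric_form_starProj,
    trace_tensorStar_mul, Matrix.trace_mul_comm]
  split_ifs <;> ring

/-- The `Ad(K)`-invariant bilinear forms for `n = 4`. -/
theorem form_eq_diagEnd_add_star
    (hΦ : ∀ φ (hφ : φ ∈ (pair hn).AdK) (X Y : (pair hn).compl),
      Φ ⟨φ X, (pair hn).Ad_compl φ hφ X X.2⟩ ⟨φ Y, (pair hn).Ad_compl φ hφ Y Y.2⟩ = Φ X Y) :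
    ∃ x m : Fin 2 → ℝ, ∀ X Y, Φ X Y =
      (standardMetric hn).form ((diagEnd hn x + ∑ i, m i • starProj hn i) X) Y := by
  have h := pullback_isKInvariant hΦ
  obtain ⟨x, m, hx⟩ := h.exists_coeff_four_zero
  obtain ⟨y, m', hy⟩ := h.exists_coeff_four_one
  refine ⟨![-x / 14, -y / 14], ![-m / 14, -m' / 14], fun X Y => ?_⟩
  have h1 := hx (incl hn X) (incl hn Y)
  have h2 := hy (incl hn X) (incl hn Y)
  have h3 := h.apply_zero_one hn (incl hn X) (incl hn Y)
  have h4 := h.apply_one_zero hn (incl hn X) (incl hn Y)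
  rw [LinearMap.compl₁₂_apply] at h1 h2 h3 h4
  conv_lhs => rw [incl_eq_add X, incl_eq_add Y]
  simp only [map_add, LinearMap.add_apply, h1, h2, h3, h4, diagEnd, Fin.sum_univ_two,
    LinearMap.smul_apply, map_smul, standardMetric_form_proj, standardMetric_form_starProj,
    smul_eq_mul, Matrix.cons_val_zero, Matrix.cons_val_one, trace_tensorStar_mul, Nat.cast_ofNat]
  ring

end FourDimensional

end TensorSO

namespace TensorSO

open LieAlgebra.Orthogonal MatrixEnd ReductivePair ReductivePair.InvMetric

variable {n : ℕ} [Nonempty (Fin n)] {hn : 3 ≤ n}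

/-! ### The Lichnerowicz Laplacian of the standard metric -/

section Lichnerowicz

lemma trace_proj_bracketP_bracketP (k : Fin 2) (Y Z : (pair hn).compl) :
    LinearMap.trace ℝ _ (proj hn k * (pair hn).bracketP Y * (pair hn).bracketP Z) =
      ∑ m, -(∑ j, bracketCoeff n k j m) * (standardMetric hn).form (proj hn m Y) Z := by
  have hY : ∀ Y : (pair hn).compl, Y = ∑ m, proj hn m Y := fun Y => by
    conv_lhs => rw [← Module.End.one_apply (R := ℝ) Y, ← sum_proj hn, LinearMap.sum_apply]
  have h : proj hn k * (pair hn).bracketP Y * (pair hn).bracketP Z = ∑ j, ∑ m, ∑ l,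
      proj hn k * (pair hn).bracketP (proj hn m Y) * proj hn j *
        (pair hn).bracketP (proj hn l Z) := by
    conv_lhs => rw [hY Y, hY Z, ← mul_one (proj hn k * _), ← sum_proj hn]
    simp only [map_sum, Finset.mul_sum, Finset.sum_mul]
    simp only [Fin.sum_univ_two]
    abel
  rw [h]
  simp only [map_sum, trace_proj_bracketP_proj_bracketP, Finset.sum_ite_eq, Finset.mem_univ,
    if_true]
  rw [Finset.sum_comm]
  refine Finset.sum_congr rfl fun m _ => ?_
  rw [← Finset.sum_mul, Finset.sum_neg_distrib]

omit [Nonempty (Fin n)] in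
lemma isotropyTerm_add_left (Y Y' Z : (pair hn).compl) : isotropyTerm (pair hn) (Y + Y') Z =
    isotropyTerm (pair hn) Y Z + isotropyTerm (pair hn) Y' Z := by
  ext1 X
  simp only [isotropyTerm_apply, map_add, LinearMap.add_apply]

omit [Nonempty (Fin n)] in
lemma isotropyTerm_add_right (Y Z Z' : (pair hn).compl) : isotropyTerm (pair hn) Y (Z + Z') =
    isotropyTerm (pair hn) Y Z + isotropyTerm (pair hn) Y Z' := by
  ext1 X
  simp only [isotropyTerm_apply, map_add, LinearMap.add_apply]

omit [Nonempty (Fin n)] in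
lemma isotropyTerm_smul_left (c : ℝ) (Y Z : (pair hn).compl) :
    isotropyTerm (pair hn) (c • Y) Z = c • isotropyTerm (pair hn) Y Z := by
  ext1 X
  simp only [isotropyTerm_apply, map_smul, LinearMap.smul_apply]

omit [Nonempty (Fin n)] in
lemma isotropyTerm_smul_right (c : ℝ) (Y Z : (pair hn).compl) :
    isotropyTerm (pair hn) Y (c • Z) = c • isotropyTerm (pair hn) Y Z := by
  ext1 X
  simp only [isotropyTerm_apply, map_smul, LinearMap.smul_apply]

lemma lichnerowicz_add {A B : Module.End ℝ (pair hn).compl}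
    (hA : ∀ X Y, (standardMetric hn).form (A X) Y = (standardMetric hn).form X (A Y))
    (hB : ∀ X Y, (standardMetric hn).form (B X) Y = (standardMetric hn).form X (B Y))
    (Y Z : (pair hn).compl) : (standardMetric hn).lichnerowicz (A + B) Y Z =
      (standardMetric hn).lichnerowicz A Y Z + (standardMetric hn).lichnerowicz B Y Z := by
  have hq := standardMetric_naturallyReductive hn
  have hAB : ∀ X Y, (standardMetric hn).form ((A + B) X) Y =
      (standardMetric hn).form X ((A + B) Y) := fun X Y => by
    simp only [LinearMap.add_apply, map_add, hA, hB]
  rw [hq.lichnerowicz_eq hA, hq.lichnerowicz_eq hB, hq.lichnerowicz_eq hAB]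
  simp only [isotropyTerm_add_left, isotropyTerm_add_right, LinearMap.add_apply, map_add, add_mul,
    mul_add]
  ring

lemma lichnerowicz_smul {A : Module.End ℝ (pair hn).compl} (c : ℝ)
    (hA : ∀ X Y, (standardMetric hn).form (A X) Y = (standardMetric hn).form X (A Y))
    (Y Z : (pair hn).compl) : (standardMetric hn).lichnerowicz (c • A) Y Z =
      c * (standardMetric hn).lichnerowicz A Y Z := by
  have hq := standardMetric_naturallyReductive hn
  have hcA : ∀ X Y, (standardMetric hn).form ((c • A) X) Y =
      (standardMetric hn).form X ((c • A) Y) := fun X Y => by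
    simp only [LinearMap.smul_apply, map_smul, hA]
  rw [hq.lichnerowicz_eq hA, hq.lichnerowicz_eq hcA]
  simp only [isotropyTerm_smul_left, isotropyTerm_smul_right, LinearMap.smul_apply, map_smul,
    smul_mul_assoc, mul_smul_comm, smul_eq_mul]
  ring

lemma eq_sum_proj (Y : (pair hn).compl) : Y = ∑ m, proj hn m Y := by
  conv_lhs => rw [← Module.End.one_apply (R := ℝ) Y, ← sum_proj hn, LinearMap.sum_apply]

/-- For an argument in either summand, one of the four blocks has all indices equal and the other
three do not. -/
lemma trace_bracketP_bracketP (Y Z : (pair hn).compl) :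
    LinearMap.trace ℝ _ ((pair hn).bracketP Y * (pair hn).bracketP Z) =
      -(bracketCoeff n 0 0 0 + 3 * bracketCoeff n 0 1 0) * (standardMetric hn).form Y Z := by
  have h : (pair hn).bracketP Y * (pair hn).bracketP Z =
      ∑ k, proj hn k * (pair hn).bracketP Y * (pair hn).bracketP Z := by
    rw [← Finset.sum_mul, ← Finset.sum_mul, sum_proj, one_mul]
  rw [h, map_sum]
  simp only [trace_proj_bracketP_bracketP]
  conv_rhs => rw [eq_sum_proj Y]
  simp only [Fin.sum_univ_two, map_add, LinearMap.add_apply]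
  simp [bracketCoeff, blockCoeff]
  ring

lemma trace_isotropyTerm (Y Z : (pair hn).compl) :
    LinearMap.trace ℝ _ (isotropyTerm (pair hn) Y Z) =
      -casimirConst n * (standardMetric hn).form Y Z := by
  have h : isotropyTerm (pair hn) Y Z = ∑ k, proj hn k * isotropyTerm (pair hn) Y Z := by
    rw [← Finset.sum_mul, sum_proj, one_mul]
  rw [h, map_sum]
  simp only [trace_proj_isotropyTerm]
  conv_rhs => rw [eq_sum_proj Y]
  simp only [map_sum, LinearMap.sum_apply, Finset.mul_sum]

/-- The bracket and isotropy traces of the standard metric are multiples of it, so the terms in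
which A acts on an argument collapse to a scalar. -/
lemma lichnerowicz_eq_of_symm {A : Module.End ℝ (pair hn).compl}
    (hA : ∀ X Y, (standardMetric hn).form (A X) Y = (standardMetric hn).form X (A Y))
    (Y Z : (pair hn).compl) : (standardMetric hn).lichnerowicz A Y Z =
      LinearMap.trace ℝ _ (A * (pair hn).bracketP Y * (pair hn).bracketP Z) +
      2 * LinearMap.trace ℝ _ (A * isotropyTerm (pair hn) Y Z) +
      (bracketCoeff n 0 0 0 + 3 * bracketCoeff n 0 1 0 + 2 * casimirConst n) *
        (standardMetric hn).form (A Y) Z := by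
  rw [(standardMetric_naturallyReductive hn).lichnerowicz_eq hA, trace_bracketP_bracketP,
    trace_bracketP_bracketP, trace_isotropyTerm, trace_isotropyTerm]
  linear_combination -((bracketCoeff n 0 0 0 + 3 * bracketCoeff n 0 1 0) / 2 + casimirConst n) *
    hA Y Z

/-- The trace-free diagonal tensors are eigentensors. -/
lemma lichnerowicz_diagEnd {x : Fin 2 → ℝ} (hx : x 0 + x 1 = 0) (Y Z : (pair hn).compl) :
    (standardMetric hn).lichnerowicz (diagEnd hn x) Y Z =
      ((n : ℝ) ^ 2 - 4) / (n ^ 2 - 2) * (standardMetric hn).form (diagEnd hn x Y) Z := by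
  have hx1 : x 1 = -x 0 := by linarith
  rw [lichnerowicz_eq_of_symm (diagEnd_symm _)]
  simp only [diagEnd, Fin.sum_univ_two, add_mul, smul_mul_assoc, map_add, map_smul,
    trace_proj_bracketP_bracketP, trace_proj_isotropyTerm, LinearMap.add_apply,
    LinearMap.smul_apply, smul_eq_mul, hx1]
  -- With a, b, c the three constants, the traces contribute -a + b - 2c and the scalar term a + 3b
  -- + 2c; their sum is 4b.
  simp [bracketCoeff, blockCoeff]
  ring

/-- The star operators are eigentensors of the Lichnerowicz Laplacian on the summands. -/
lemma lichnerowicz_starProj {hn : 3 ≤ 4} (l i : Fin 2) (Y Z : (pair hn).compl) :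
    (standardMetric hn).lichnerowicz (starProj hn l) (proj hn i Y) (proj hn i Z) =
      6 / 7 * (standardMetric hn).form (starProj hn l (proj hn i Y)) (proj hn i Z) := by
  have h1 : starProj hn i (proj hn i Y) = starProj hn i Y := by
    rw [← Module.End.mul_apply, starProj_mul_proj]
  have h2 : (standardMetric hn).form (starProj hn i Y) (proj hn i Z) =
      (standardMetric hn).form (starProj hn i Y) Z := by
    rw [← proj_symm, ← Module.End.mul_apply (proj hn i), proj_mul_starProj]
  rw [lichnerowicz_eq_of_symm (starProj_symm l), trace_starProj_bracketP_bracketP,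
    trace_starProj_isotropyTerm]
  by_cases h : l = i
  · subst h
    -- The star blocks contribute -(a - b) and the isotropy term -2c, as for diagonal tensors; hence
    -- again 4b, which is 6/7 at n = 4.
    rw [h1, h2]
    fin_cases l <;> simp [starCoeff, bracketCoeff, blockCoeff, casimirConst, Fin.sum_univ_two] <;>
    ring
  · have h3 : starProj hn l (proj hn i Y) = 0 := by
      rw [← Module.End.mul_apply, starProj_mul_proj_of_ne h, LinearMap.zero_apply]
    rw [h3]
    simp [starCoeff, h]

omit [Nonempty (Fin n)] in
lemma finrank_pos (hn : 3 ≤ n) : (0 : ℝ) < n * (n - 1) ^ 2 * (n + 2) / 4 := by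
  have : (3 : ℝ) ≤ n := by exact_mod_cast hn
  have : (0 : ℝ) < n - 1 := by linarith
  positivity

lemma trace_diagEnd (x : Fin 2 → ℝ) : LinearMap.trace ℝ _ (diagEnd hn x) =
    (x 0 + x 1) * (n * (n - 1) ^ 2 * (n + 2) / 4) := by
  simp only [diagEnd, Fin.sum_univ_two, map_add, map_smul, trace_proj, smul_eq_mul]
  ring

omit [Nonempty (Fin n)] in
lemma form_comp_invariant {A : Module.End ℝ (pair hn).compl} (hA : (standardMetric hn).IsTT A)
    (φ) (hφ : φ ∈ (pair hn).AdK) (X Y : (pair hn).compl) :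
    ((standardMetric hn).form ∘ₗ A) ⟨φ X, (pair hn).Ad_compl φ hφ X X.2⟩
      ⟨φ Y, (pair hn).Ad_compl φ hφ Y Y.2⟩ = ((standardMetric hn).form ∘ₗ A) X Y := by
  rw [LinearMap.comp_apply, LinearMap.comp_apply, hA.inv φ hφ]
  exact (standardMetric hn).inv φ hφ (A X) Y

/-- The classification of invariant forms makes A diagonal; the summands have equal dimension, so
trace zero means opposite coefficients. -/
lemma exists_eq_diagEnd (hn4 : n ≠ 4) {A : Module.End ℝ (pair hn).compl}
    (hA : (standardMetric hn).IsTT A) : ∃ x : Fin 2 → ℝ, x 0 + x 1 = 0 ∧ A = diagEnd hn x := by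
  obtain ⟨x, hx⟩ := form_eq_diagEnd hn4 (form_comp_invariant hA)
  have hAx : A = diagEnd hn x :=
    LinearMap.ext fun X => (standardMetric hn).form_ext (hx X)
  refine ⟨x, ?_, hAx⟩
  have h := hA.trace
  rw [hAx, trace_diagEnd] at h
  exact (mul_eq_zero.1 h).resolve_right (finrank_pos hn).ne'

/-- The combination of the star operators on the summands. -/
noncomputable def starEnd (hn : 3 ≤ 4) (m : Fin 2 → ℝ) : Module.End ℝ (pair hn).compl :=
  ∑ i, m i • starProj hn i

lemma proj_mul_starProj_of_ne {hn : 3 ≤ 4} {i j : Fin 2} (h : i ≠ j) :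
    proj hn i * starProj hn j = 0 := by
  rw [← proj_mul_starProj, ← mul_assoc, proj_mul_of_ne hn h, zero_mul]

lemma starEnd_mul_proj {hn : 3 ≤ 4} (m : Fin 2 → ℝ) (i : Fin 2) :
    starEnd hn m * proj hn i = m i • starProj hn i := by
  rw [starEnd, Finset.sum_mul, Finset.sum_eq_single i]
  · rw [smul_mul_assoc, starProj_mul_proj]
  · intro j _ hj
    rw [smul_mul_assoc, starProj_mul_proj_of_ne hj, smul_zero]
  · simp

lemma proj_mul_starEnd {hn : 3 ≤ 4} (m : Fin 2 → ℝ) (i : Fin 2) :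
    proj hn i * starEnd hn m = m i • starProj hn i := by
  rw [starEnd, Finset.mul_sum, Finset.sum_eq_single i]
  · rw [mul_smul_comm, proj_mul_starProj]
  · intro j _ hj
    rw [mul_smul_comm, proj_mul_starProj_of_ne hj.symm, smul_zero]
  · simp

lemma proj_mul_diagEnd (x : Fin 2 → ℝ) (m : Fin 2) : proj hn m * diagEnd hn x = x m • proj hn m := by
  fin_cases m <;> simp [diagEnd, mul_add, proj_mul_self, proj_mul_of_ne]

lemma starEnd_symm {hn : 3 ≤ 4} (m : Fin 2 → ℝ) (X Y : (pair hn).compl) :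
    (standardMetric hn).form (starEnd hn m X) Y = (standardMetric hn).form X (starEnd hn m Y) := by
  simp [starEnd, starProj_symm]

lemma lichnerowicz_starEnd {hn : 3 ≤ 4} (m : Fin 2 → ℝ) (i : Fin 2) (Y Z : (pair hn).compl) :
    (standardMetric hn).lichnerowicz (starEnd hn m) (proj hn i Y) (proj hn i Z) =
      6 / 7 * (standardMetric hn).form (starEnd hn m (proj hn i Y)) (proj hn i Z) := by
  have h : ∀ l X Y, (standardMetric hn).form ((m l • starProj hn l) X) Y =
      (standardMetric hn).form X ((m l • starProj hn l) Y) := fun l X Y => by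
    simp only [LinearMap.smul_apply, map_smul, starProj_symm]
  have h' : starEnd hn m = m 0 • starProj hn 0 + m 1 • starProj hn 1 := Fin.sum_univ_two _
  rw [h', lichnerowicz_add (h 0) (h 1), lichnerowicz_smul _ (starProj_symm 0),
    lichnerowicz_smul _ (starProj_symm 1), lichnerowicz_starProj, lichnerowicz_starProj]
  simp only [LinearMap.add_apply, LinearMap.smul_apply, map_add, map_smul, smul_eq_mul]
  ring

lemma exists_eq_diagEnd_add_star {hn : 3 ≤ 4} {A : Module.End ℝ (pair hn).compl}
    (hA : (standardMetric hn).IsTT A) : ∃ x m : Fin 2 → ℝ, x 0 + x 1 = 0 ∧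
      A = diagEnd hn x + starEnd hn m := by
  obtain ⟨x, m, hx⟩ := form_eq_diagEnd_add_star (form_comp_invariant hA)
  have hAx : A = diagEnd hn x + starEnd hn m :=
    LinearMap.ext fun X => (standardMetric hn).form_ext (hx X)
  refine ⟨x, m, ?_, hAx⟩
  have h := hA.trace
  rw [hAx, map_add, starEnd, map_sum, trace_diagEnd] at h
  simp only [map_smul, trace_starProj, smul_zero, Finset.sum_const_zero, add_zero] at h
  exact (mul_eq_zero.1 h).resolve_right (finrank_pos hn).ne'

omit [Nonempty (Fin n)] in
-- The eigenvalue can be read off at a single vector, tested against its own image.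
lemma eq_of_eigentensor {A : Module.End ℝ (pair hn).compl} {μ ν : ℝ} {Y : (pair hn).compl}
    (hY : A Y ≠ 0) (hμ : ∀ Z, (standardMetric hn).lichnerowicz A Y Z =
      μ * (standardMetric hn).form (A Y) Z)
    (hν : (standardMetric hn).lichnerowicz A Y (A Y) =
      ν * (standardMetric hn).form (A Y) (A Y)) : μ = ν :=
  mul_right_cancel₀ ((standardMetric hn).posDef _ hY).ne' ((hμ _).symm.trans hν)

/-- All invariant TT-tensors share one eigenvalue, so minimality is automatic once the spectrum is
nonempty. -/
lemma eq_of_mem_ttSpectrum {μ : ℝ} (hμ : μ ∈ (standardMetric hn).ttSpectrum) :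
    μ = ((n : ℝ) ^ 2 - 4) / (n ^ 2 - 2) := by
  obtain ⟨A, hA, hA0, hμ⟩ := hμ
  by_cases hn4 : n = 4
  · subst hn4
    obtain ⟨x, m, hx, hAx⟩ := exists_eq_diagEnd_add_star hA
    -- The star tensors are known to be eigentensors only for two arguments in the same summand;
    -- since A preserves the summands, one such test suffices.
    have hcomm : ∀ i, proj hn i * A = A * proj hn i := fun i => by
      rw [hAx, add_mul, mul_add, diagEnd_proj, proj_mul_diagEnd, starEnd_mul_proj, proj_mul_starEnd]
    obtain ⟨i, Y, hY⟩ : ∃ i Y, A (proj hn i Y) ≠ 0 := by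
      by_contra! h
      refine hA0 ?_
      rw [← mul_one A, ← sum_proj hn, Finset.mul_sum]
      exact Finset.sum_eq_zero fun i _ => LinearMap.ext (h i)
    refine eq_of_eigentensor hY (hμ _) ?_
    have hZ : proj hn i (A Y) = A (proj hn i Y) := by
      rw [← Module.End.mul_apply, ← Module.End.mul_apply, hcomm]
    have key : ∀ Z, (standardMetric hn).lichnerowicz A (proj hn i Y) (proj hn i Z) =
        (((4 : ℕ) : ℝ) ^ 2 - 4) / (((4 : ℕ) : ℝ) ^ 2 - 2) *
          (standardMetric hn).form (A (proj hn i Y)) (proj hn i Z) := by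
      intro Z
      rw [hAx, lichnerowicz_add (diagEnd_symm x) (starEnd_symm m), lichnerowicz_diagEnd hx,
        lichnerowicz_starEnd, LinearMap.add_apply, map_add, LinearMap.add_apply]
      norm_num
      ring
    have := key (A Y)
    rwa [hZ] at this
  · obtain ⟨x, hx, rfl⟩ := exists_eq_diagEnd hn4 hA
    obtain ⟨Y, hY⟩ : ∃ Y, diagEnd hn x Y ≠ 0 := by
      by_contra! h
      exact hA0 (LinearMap.ext h)
    exact eq_of_eigentensor hY (hμ Y) (lichnerowicz_diagEnd hx Y _)

lemma diagEnd_isTT {x : Fin 2 → ℝ} (hx : x 0 + x 1 = 0) :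
    (standardMetric hn).IsTT (diagEnd hn x) where
  symm := diagEnd_symm x
  inv φ hφ X := by
    have hφ' := hφ
    obtain ⟨k, hk, rfl⟩ := hφ'
    have h : ∀ Y : (pair hn).compl, incl hn ⟨Ad k Y, (pair hn).Ad_compl _ hφ Y Y.2⟩ =
        conjEnd (k : Matrix (Fin n × Fin n) (Fin n × Fin n) ℝ) (incl hn Y) := fun Y => coe_Ad _ _
    have h' : ∀ Y : (pair hn).compl, incl hn (diagEnd hn x Y) =
        x 0 • prj 0 (incl hn Y) + x 1 • prj 1 (incl hn Y) := fun Y => by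
      simp only [diagEnd, Fin.sum_univ_two, LinearMap.add_apply, LinearMap.smul_apply, map_add,
        map_smul, incl_proj]
    have h'' : ∀ i, prj i (conjEnd (k : Matrix (Fin n × Fin n) (Fin n × Fin n) ℝ) (incl hn X)) =
        conjEnd (k : Matrix (Fin n × Fin n) (Fin n × Fin n) ℝ) (prj i (incl hn X)) := fun i => by
      have := prj_Ad hk i X.1
      rwa [coe_Ad] at this
    apply incl_injective hn
    rw [h, h', h', h, h'', h'', map_add, map_smul, map_smul]
  trace := by rw [trace_diagEnd, hx, zero_mul]
  div := (standardMetric_naturallyReductive hn).gTrace_nabla (diagEnd_symm x)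

theorem isLeast_ttSpectrum :
    IsLeast (standardMetric hn).ttSpectrum (((n : ℝ) ^ 2 - 4) / (n ^ 2 - 2)) := by
  have hx : (![1, -1] : Fin 2 → ℝ) 0 + (![1, -1] : Fin 2 → ℝ) 1 = 0 := by simp
  refine ⟨⟨diagEnd hn ![1, -1], diagEnd_isTT hx, fun h => ?_, lichnerowicz_diagEnd hx⟩,
    fun μ hμ => (eq_of_mem_ttSpectrum hμ).ge⟩
  have h1 := diagEnd_proj (hn := hn) ![1, -1] 0
  rw [h, zero_mul, Matrix.cons_val_zero, one_smul] at h1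
  have h2 := trace_proj hn 0
  rw [← h1, map_zero] at h2
  exact (finrank_pos hn).ne h2

end Lichnerowicz

end TensorSO

namespace TensorSO

open LieAlgebra.Orthogonal MatrixEnd ReductivePair ReductivePair.InvMetric

variable {n : ℕ} [Nonempty (Fin n)] {hn : 3 ≤ n}

/-! ### Diagonal metrics -/

section Diagonal

variable {g : (pair hn).InvMetric} {x : Fin 2 → ℝ}

lemma exists_proj_ne_zero (i : Fin 2) : ∃ Y : (pair hn).compl, proj hn i Y ≠ 0 := by
  by_contra! h
  have h2 := trace_proj hn i
  rw [show proj hn i = 0 from LinearMap.ext h, map_zero] at h2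
  exact (finrank_pos hn).ne h2

lemma proj_proj (i : Fin 2) (X : (pair hn).compl) : proj hn i (proj hn i X) = proj hn i X := by
  rw [← Module.End.mul_apply, proj_mul_self]

lemma diagEnd_proj_apply (x : Fin 2 → ℝ) (i : Fin 2) (X : (pair hn).compl) :
    diagEnd hn x (proj hn i X) = x i • proj hn i X := by
  rw [← Module.End.mul_apply, diagEnd_proj, LinearMap.smul_apply]

lemma proj_mem_p₁ (X : (pair hn).compl) : ((proj hn 0 X : (pair hn).compl) : so _ ℝ) ∈ p₁ n := by
  have h := congrArg (incl hn) (proj_proj 0 X)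
  rw [incl_proj] at h
  exact (mem_p₁_iff _).2 h

lemma proj_mem_p₂ (X : (pair hn).compl) : ((proj hn 1 X : (pair hn).compl) : so _ ℝ) ∈ p₂ n := by
  have h := congrArg (incl hn) (proj_proj 1 X)
  rw [incl_proj] at h
  exact (mem_p₂_iff _).2 h

lemma proj_of_mem_p₁ {X : (pair hn).compl} (hX : (X : so _ ℝ) ∈ p₁ n) : proj hn 0 X = X :=
  incl_injective hn ((incl_proj hn 0 X).trans ((mem_p₁_iff _).1 hX))

lemma proj_of_mem_p₂ {X : (pair hn).compl} (hX : (X : so _ ℝ) ∈ p₂ n) : proj hn 1 X = X :=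
  incl_injective hn ((incl_proj hn 1 X).trans ((mem_p₂_iff _).1 hX))

lemma form_proj_of_ne {i j : Fin 2} (h : i ≠ j) (X Y : (pair hn).compl) :
    (standardMetric hn).form (proj hn i X) (proj hn j Y) = 0 := by
  rw [proj_symm, ← Module.End.mul_apply, proj_mul_of_ne hn h, LinearMap.zero_apply, map_zero]

theorem isDiagonal_of_ne_four (hn4 : n ≠ 4) (g : (pair hn).InvMetric) : IsDiagonal g := by
  obtain ⟨x, hx⟩ := form_eq_diagEnd hn4 g.inv
  refine ⟨x 0, x 1, fun X Y => ⟨fun hX _ => ?_, fun hX _ => ?_, fun hX hY => ?_⟩⟩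
  · rw [hx, ← proj_of_mem_p₁ hX, diagEnd_proj_apply, map_smul, LinearMap.smul_apply, smul_eq_mul]
  · rw [hx, ← proj_of_mem_p₂ hX, diagEnd_proj_apply, map_smul, LinearMap.smul_apply, smul_eq_mul]
  · rw [hx, ← proj_of_mem_p₁ hX, ← proj_of_mem_p₂ hY, diagEnd_proj_apply, map_smul,
      LinearMap.smul_apply, form_proj_of_ne zero_ne_one, smul_zero]

/-- The coefficients are not assumed positive; evaluating the metric on a nonzero vector of each
summand shows that they are. -/
lemma IsDiagonal.exists_diagEnd (hg : IsDiagonal g) :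
    ∃ x : Fin 2 → ℝ, (∀ i, 0 < x i) ∧
      ∀ X Y, g.form X Y = (standardMetric hn).form (diagEnd hn x X) Y := by
  obtain ⟨x₁, x₂, h⟩ := hg
  have h0 := fun X Y => (h (proj hn 0 X) (proj hn 0 Y)).1 (proj_mem_p₁ X) (proj_mem_p₁ Y)
  have h1 := fun X Y => (h (proj hn 1 X) (proj hn 1 Y)).2.1 (proj_mem_p₂ X) (proj_mem_p₂ Y)
  have h2 := fun X Y => (h (proj hn 0 X) (proj hn 1 Y)).2.2 (proj_mem_p₁ X) (proj_mem_p₂ Y)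
  have h3 := fun X Y => (g.symm (proj hn 1 X) (proj hn 0 Y)).trans (h2 Y X)
  refine ⟨![x₁, x₂], fun i => ?_, fun X Y => ?_⟩
  · obtain ⟨Y, hY⟩ := exists_proj_ne_zero (hn := hn) i
    have hp := (standardMetric hn).posDef _ hY
    have hg := g.posDef _ hY
    obtain rfl | rfl : i = 0 ∨ i = 1 := by omega
    · rw [h0] at hg
      exact (mul_pos_iff_of_pos_right hp).1 hg
    · rw [h1] at hg
      exact (mul_pos_iff_of_pos_right hp).1 hg
  · have hX := eq_sum_proj X
    have hY := eq_sum_proj Y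
    rw [Fin.sum_univ_two] at hX hY
    rw [hX, hY]
    simp only [map_add, LinearMap.add_apply, h0, h1, h2, h3, diagEnd_proj_apply, map_smul,
      LinearMap.smul_apply, form_proj_of_ne zero_ne_one, form_proj_of_ne one_ne_zero, smul_eq_mul,
      mul_zero, Matrix.cons_val_zero, Matrix.cons_val_one]

/-- The Ricci curvatures of the metric `x₀ ⊕ x₁` relative to the standard metric. -/
noncomputable def ricciCoeff (n : ℕ) (x : Fin 2 → ℝ) (m : Fin 2) : ℝ :=
  casimirConst n + 1 / 4 * ∑ k, ∑ j, (1 + (x m - x j) / x k) * (1 + (x m - x k) / x j) *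
    bracketCoeff n k j m

lemma ricci_eq_diagEnd (hx : ∀ i, 0 < x i)
    (hg : ∀ X Y, g.form X Y = (standardMetric hn).form (diagEnd hn x X) Y)
    (Y Z : (pair hn).compl) :
    g.ricci Y Z = (standardMetric hn).form (diagEnd hn (ricciCoeff n x) Y) Z := by
  rw [ricci_diagonal (fun i => (hx i).ne') hg, diagEnd, LinearMap.sum_apply, map_sum,
    LinearMap.sum_apply]
  simp only [LinearMap.smul_apply, map_smul, smul_eq_mul, ricciCoeff]

lemma ricci_eq_form (hx : ∀ i, 0 < x i)
    (hg : ∀ X Y, g.form X Y = (standardMetric hn).form (diagEnd hn x X) Y)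
    (Y Z : (pair hn).compl) :
    g.ricci Y Z = g.form (diagEnd hn (fun i => ricciCoeff n x i / x i) Y) Z := by
  have h : x * (fun i => ricciCoeff n x i / x i) = ricciCoeff n x := funext fun i =>
    mul_div_cancel₀ _ (hx i).ne'
  rw [ricci_eq_diagEnd hx hg, hg, ← Module.End.mul_apply, diagEnd_mul, h]

lemma scal_eq (hx : ∀ i, 0 < x i)
    (hg : ∀ X Y, g.form X Y = (standardMetric hn).form (diagEnd hn x X) Y) :
    g.scal = (ricciCoeff n x 0 / x 0 + ricciCoeff n x 1 / x 1) *
      (n * (n - 1) ^ 2 * (n + 2) / 4) := by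
  rw [scal, ← trace_diagEnd (hn := hn) fun i => ricciCoeff n x i / x i, ← g.gTrace_form_left]
  congr 1
  ext Y Z
  exact ricci_eq_form hx hg Y Z

lemma IsEinsteinWith.ricciCoeff_eq {ρ : ℝ} (hρ : g.IsEinsteinWith ρ) (hx : ∀ i, 0 < x i)
    (hg : ∀ X Y, g.form X Y = (standardMetric hn).form (diagEnd hn x X) Y) (i : Fin 2) :
    ricciCoeff n x i / x i = ρ := by
  obtain ⟨Y, hY⟩ := exists_proj_ne_zero (hn := hn) i
  have h := (ricci_eq_form hx hg _ _).symm.trans (hρ (proj hn i Y) (proj hn i Y))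
  rw [diagEnd_proj_apply, map_smul, LinearMap.smul_apply, smul_eq_mul] at h
  exact mul_right_cancel₀ (g.posDef _ hY).ne' h

lemma standardMetric_form_eq_diagEnd (X Y : (pair hn).compl) :
    (standardMetric hn).form X Y = (standardMetric hn).form (diagEnd hn 1 X) Y := by
  rw [diagEnd_one, Module.End.one_apply]

/-! ### The Einstein equation and the scalar curvature as functions of two positive numbers. -/

section Coefficients

include hn in
-- For a unit vector Y of 𝔭, -tr(ad_Y²) = 1, split along 𝔤 = 𝔨 ⊕ 𝔭: the paths inside 𝔭 give a + 3b,
-- those through 𝔨 give 2c.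
lemma coeff_sum : bracketCoeff n 0 0 0 + 3 * bracketCoeff n 0 1 0 + 2 * casimirConst n = 1 := by
  have h0 : (n : ℝ) ≠ 0 := by
    have : n ≠ 0 := by omega
    exact_mod_cast this
  have h1 := (sq_sub_two_pos hn).ne'
  simp [bracketCoeff, blockCoeff, casimirConst]
  field_simp
  ring

lemma bracketCoeff_zero_one (n : ℝ) : bracketCoeff n 0 1 0 = (n ^ 2 - 4) / (4 * (n ^ 2 - 2)) := by
  simp [bracketCoeff, blockCoeff, div_div]

include hn in
-- The decisive inequality. It amounts to n³ - 10n + 4 > 0, which equals 1 at n = 3 and fails at n =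
-- 2.
lemma one_add_casimirConst_lt : 1 + 2 * casimirConst n < 8 * bracketCoeff n 0 1 0 := by
  have h3 : (3 : ℝ) ≤ n := by exact_mod_cast hn
  have h0 : (0 : ℝ) < n := by linarith
  have h1 := sq_sub_two_pos hn
  rw [bracketCoeff_zero_one, casimirConst, ← sub_pos]
  have : 8 * (((n : ℝ) ^ 2 - 4) / (4 * (n ^ 2 - 2))) -
      (1 + 2 * ((2 * n - 2) / (n * (n ^ 2 - 2)))) =
      (n ^ 3 - 10 * n + 4) / (n * (n ^ 2 - 2)) := by
    field_simp
    ring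
  rw [this]
  refine div_pos ?_ (by positivity)
  nlinarith [mul_nonneg (sub_nonneg.2 h3) h0.le, mul_nonneg (mul_nonneg (sub_nonneg.2 h3) h0.le) h0.le]

include hn in
-- The same inequality after adding the relation `coeff_sum`, in the shape required by the cubic
-- factors below.
lemma bracketCoeff_lt : bracketCoeff n 0 0 0 + 4 * bracketCoeff n 0 1 0 + 4 * casimirConst n <
    9 * bracketCoeff n 0 1 0 := by
  linarith [coeff_sum (hn := hn), one_add_casimirConst_lt (hn := hn)]

include hn in
lemma bracketCoeff_pos : 0 < bracketCoeff n 0 1 0 := by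
  have h3 : (3 : ℝ) ≤ n := by exact_mod_cast hn
  have h1 := sq_sub_two_pos hn
  have : (0 : ℝ) < (n : ℝ) ^ 2 - 4 := by nlinarith
  rw [bracketCoeff_zero_one]
  positivity

omit [Nonempty (Fin n)] in
lemma ricciCoeff_zero (h0 : x 0 ≠ 0) (h1 : x 1 ≠ 0) :
    ricciCoeff n x 0 = casimirConst n + 1 / 4 * (bracketCoeff n 0 0 0 + bracketCoeff n 0 1 0 *
      (4 - 2 * x 1 / x 0 + x 0 ^ 2 / x 1 ^ 2)) := by
  simp only [ricciCoeff, Fin.sum_univ_two]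
  simp [bracketCoeff, blockCoeff]
  field_simp
  ring

omit [Nonempty (Fin n)] in
lemma ricciCoeff_one (h0 : x 0 ≠ 0) (h1 : x 1 ≠ 0) :
    ricciCoeff n x 1 = casimirConst n + 1 / 4 * (bracketCoeff n 0 0 0 + bracketCoeff n 0 1 0 *
      (4 - 2 * x 0 / x 1 + x 1 ^ 2 / x 0 ^ 2)) := by
  simp only [ricciCoeff, Fin.sum_univ_two]
  simp [bracketCoeff, blockCoeff]
  field_simp
  ring

include hn in
lemma ricciCoeff_of_eq (h0 : x 0 ≠ 0) (h01 : x 0 = x 1) (i : Fin 2) :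
    ricciCoeff n x i = 1 / 4 + (n - 1) / (n * ((n : ℝ) ^ 2 - 2)) := by
  have h : ricciCoeff n x i = casimirConst n + 1 / 4 * (bracketCoeff n 0 0 0 +
      3 * bracketCoeff n 0 1 0) := by
    obtain rfl | rfl : i = 0 ∨ i = 1 := by omega
    · rw [ricciCoeff_zero h0 (h01 ▸ h0), ← h01]
      field_simp
      ring
    · rw [ricciCoeff_one h0 (h01 ▸ h0), ← h01]
      field_simp
      ring
  have hc : casimirConst n = 2 * ((n - 1) / (n * ((n : ℝ) ^ 2 - 2))) := by
    rw [casimirConst]; ring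
  linarith [coeff_sum (hn := hn)]

include hn in
/-- The Einstein equation has no solutions off the diagonal. -/
lemma eq_of_ricciCoeff_eq (hx : ∀ i, 0 < x i)
    (h : ricciCoeff n x 0 / x 0 = ricciCoeff n x 1 / x 1) : x 0 = x 1 := by
  have h0 := hx 0
  have h1 := hx 1
  rw [ricciCoeff_zero h0.ne' h1.ne', ricciCoeff_one h0.ne' h1.ne'] at h
  have hb := bracketCoeff_pos (hn := hn)
  have hlt := bracketCoeff_lt (hn := hn)
  set a := bracketCoeff n 0 0 0
  set b := bracketCoeff n 0 1 0
  set c := casimirConst n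
  -- Clearing denominators, the Einstein equation is antisymmetric in the two variables and hence
  -- divisible by their difference.
  have key : (x 1 - x 0) * ((a + 4 * b + 4 * c) * (x 0 * x 1) -
      3 * b * (x 0 ^ 2 + x 0 * x 1 + x 1 ^ 2)) = 0 := by
    field_simp at h
    linear_combination h
  have hneg : (a + 4 * b + 4 * c) * (x 0 * x 1) -
      3 * b * (x 0 ^ 2 + x 0 * x 1 + x 1 ^ 2) < 0 := by
    -- Since x 0² + x 1² ≥ 2 x 0 x 1, the second product is at least 9b x 0 x 1.
    have := mul_lt_mul_of_pos_right hlt (mul_pos h0 h1)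
    have := mul_nonneg hb.le (sq_nonneg (x 0 - x 1))
    linarith
  linarith [(mul_eq_zero.1 key).resolve_right hneg.ne]

omit [Nonempty (Fin n)] in
-- With x 0 x 1 = 1 all inverses disappear, and the symmetric expression becomes a polynomial in u =
-- x 0 + x 1; expanding about the standard metric u = 2 isolates the factor u - 2.
lemma sum_ricciCoeff_div (hx : ∀ i, 0 < x i) (h : x 0 * x 1 = 1) :
    ricciCoeff n x 0 / x 0 + ricciCoeff n x 1 / x 1 =
      2 * (casimirConst n + 1 / 4 * (bracketCoeff n 0 0 0 + 3 * bracketCoeff n 0 1 0)) -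
      (x 0 + x 1 - 2) / 4 * (bracketCoeff n 0 1 0 * ((x 0 + x 1) ^ 2 + 2 * (x 0 + x 1) + 1) -
        (bracketCoeff n 0 0 0 + 4 * bracketCoeff n 0 1 0 + 4 * casimirConst n)) := by
  have h0 := (hx 0).ne'
  have h1 := (hx 1).ne'
  have i0 : (x 0)⁻¹ = x 1 := inv_eq_of_mul_eq_one_right h
  have i1 : (x 1)⁻¹ = x 0 := by rw [← i0, inv_inv]
  rw [ricciCoeff_zero h0 h1, ricciCoeff_one h0 h1]
  simp only [div_eq_mul_inv, ← inv_pow, i0, i1]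
  linear_combination (bracketCoeff n 0 1 0 / 4 * (x 0 ^ 3 + x 1 ^ 3) +
    3 * bracketCoeff n 0 1 0 / 4 * (x 0 + x 1)) * h

end Coefficients

/-- The exchange of the tensor factors, as an automorphism of `𝔭`. -/
noncomputable def exchangeEnd (hn : 3 ≤ n) : Module.End ℝ (pair hn).compl :=
  compress hn exchange.toLinearMap

lemma incl_exchangeEnd (X : (pair hn).compl) :
    incl hn (exchangeEnd hn X) = exchange (incl hn X) := by
  conv_rhs => rw [← prj_add_prj_incl]
  rw [exchangeEnd, incl_compress]
  change prjP (exchange _) = _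
  rw [prjP, LinearMap.add_apply, LinearMap.add_apply, map_add, exchange_prj, exchange_prj_one,
    add_comm]

lemma exchangeEnd_mul_self : exchangeEnd hn * exchangeEnd hn = 1 :=
  LinearMap.ext fun X => incl_injective hn <| by
    rw [Module.End.mul_apply, incl_exchangeEnd, incl_exchangeEnd, exchange_exchange,
      Module.End.one_apply]

lemma exchangeEnd_mul_diagEnd (x : Fin 2 → ℝ) :
    exchangeEnd hn * diagEnd hn x = diagEnd hn ![x 1, x 0] * exchangeEnd hn :=
  LinearMap.ext fun X => incl_injective hn <| by
    simp only [diagEnd, Module.End.mul_apply, Fin.sum_univ_two, LinearMap.add_apply, map_add,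
      LinearMap.smul_apply, map_smul, incl_exchangeEnd, incl_proj, exchange_prj, exchange_prj_one,
      Matrix.cons_val_zero, Matrix.cons_val_one]
    abel

/-- Exchanging the tensor factors conjugates the endomorphism with coefficients (x 0, x 1) into the
one with (x 1, x 0), and their product is scalar; no count of eigenvalues is needed. -/
lemma det_diagEnd_sq (x : Fin 2 → ℝ) : LinearMap.det (diagEnd hn x) ^ 2 =
    (x 0 * x 1) ^ Module.finrank ℝ (pair hn).compl := by
  have h := congrArg LinearMap.det (exchangeEnd_mul_diagEnd (hn := hn) x)
  have h1 := congrArg LinearMap.det (exchangeEnd_mul_self (hn := hn))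
  have h2 : diagEnd hn x * diagEnd hn ![x 1, x 0] = (x 0 * x 1) • 1 := by
    rw [diagEnd_mul, ← diagEnd_one, diagEnd, diagEnd, Finset.smul_sum]
    refine Finset.sum_congr rfl fun i _ => ?_
    obtain rfl | rfl : i = 0 ∨ i = 1 := by omega
    · simp
    · simp [mul_comm]
  have h3 := congrArg LinearMap.det h2
  rw [LinearMap.det_smul, map_one, mul_one, map_mul] at h3
  rw [map_mul, map_mul, mul_comm] at h
  rw [map_mul, map_one] at h1
  rw [← h3, sq, mul_right_cancel₀ (fun h0 => by simp [h0] at h1) h]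

lemma SameVolume.mul_eq_one (hV : g.SameVolume (standardMetric hn)) (hx : ∀ i, 0 < x i)
    (hg : ∀ X Y, g.form X Y = (standardMetric hn).form (diagEnd hn x X) Y) : x 0 * x 1 = 1 := by
  have h : (standardMetric hn).dual.symm.toLinearMap ∘ₗ g.dual.toLinearMap = diagEnd hn x :=
    LinearMap.ext fun X => (standardMetric hn).dual.injective <| by
      change (standardMetric hn).dual ((standardMetric hn).dual.symm (g.dual X)) = _
      rw [LinearEquiv.apply_symm_apply]
      exact LinearMap.ext (hg X)
  have h1 := det_diagEnd_sq (hn := hn) x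
  rw [← h, show LinearMap.det _ = (1 : ℝ) from hV, one_pow] at h1
  refine (pow_eq_one_iff_of_nonneg (mul_pos (hx 0) (hx 1)).le fun h0 => ?_).1 h1.symm
  obtain ⟨Y, hY⟩ := exists_proj_ne_zero (hn := hn) 0
  exact hY (Module.finrank_zero_iff.1 h0 |>.elim _ _)

lemma diagEnd_of_eq (h01 : x 0 = x 1) : diagEnd hn x = x 0 • 1 := by
  rw [← diagEnd_one, diagEnd, diagEnd, Fin.sum_univ_two, Fin.sum_univ_two, ← h01]
  simp only [Pi.one_apply, one_smul, smul_add]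

/-- A diagonal metric with equal coefficients is a multiple of the standard metric. -/
lemma form_eq_smul_of_eq (h01 : x 0 = x 1)
    (hg : ∀ X Y, g.form X Y = (standardMetric hn).form (diagEnd hn x X) Y) :
    g.form = x 0 • (standardMetric hn).form := by
  refine LinearMap.ext fun X => LinearMap.ext fun Y => ?_
  rw [hg, diagEnd_of_eq h01, LinearMap.smul_apply, map_smul, Module.End.one_apply,
    LinearMap.smul_apply, LinearMap.smul_apply, LinearMap.smul_apply]

lemma ricci_of_eq (hx : ∀ i, 0 < x i) (h01 : x 0 = x 1)
    (hg : ∀ X Y, g.form X Y = (standardMetric hn).form (diagEnd hn x X) Y)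
    (Y Z : (pair hn).compl) : g.ricci Y Z =
      (1 / 4 + (n - 1) / (n * ((n : ℝ) ^ 2 - 2))) * (standardMetric hn).form Y Z := by
  have h := ricciCoeff_of_eq (hn := hn) (hx 0).ne' h01
  rw [ricci_eq_diagEnd hx hg, diagEnd_of_eq ((h 0).trans (h 1).symm), h, LinearMap.smul_apply,
    map_smul, Module.End.one_apply, LinearMap.smul_apply, smul_eq_mul]

theorem standardMetric_isEinsteinWith : (standardMetric hn).IsEinsteinWith
    (1 / 4 + (n - 1) / (n * ((n : ℝ) ^ 2 - 2))) :=
  ricci_of_eq (x := 1) (fun _ => one_pos) rfl standardMetric_form_eq_diagEnd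

include hn in
-- Since 2ρ = 1/2 + c and the eigenvalue is 4b, this is half of `one_add_casimirConst_lt`.
lemma two_mul_einsteinConst_lt : 2 * (1 / 4 + (n - 1) / (n * ((n : ℝ) ^ 2 - 2))) <
    ((n : ℝ) ^ 2 - 4) / (n ^ 2 - 2) := by
  have h := one_add_casimirConst_lt (hn := hn)
  rw [bracketCoeff_zero_one, casimirConst] at h
  have h1 : (2 * n - 2) / (n * ((n : ℝ) ^ 2 - 2)) = 2 * ((n - 1) / (n * ((n : ℝ) ^ 2 - 2))) := by
    ring
  have h2 : ((n : ℝ) ^ 2 - 4) / (4 * (n ^ 2 - 2)) = (((n : ℝ) ^ 2 - 4) / (n ^ 2 - 2)) / 4 := by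
    rw [div_div, mul_comm]
  rw [h1, h2] at h
  linarith

theorem standardMetric_isGStable : (standardMetric hn).IsGStable :=
  ⟨_, _, standardMetric_isEinsteinWith, isLeast_ttSpectrum, two_mul_einsteinConst_lt (hn := hn)⟩

theorem IsDiagonal.isEinstein_iff (hg : IsDiagonal g) :
    g.IsEinstein ↔ ∃ c : ℝ, 0 < c ∧ g.form = c • (standardMetric hn).form := by
  obtain ⟨x, hx, hgx⟩ := hg.exists_diagEnd
  constructor
  · rintro ⟨ρ, hρ⟩
    exact ⟨x 0, hx 0, form_eq_smul_of_eq (eq_of_ricciCoeff_eq (hn := hn) hx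
      ((IsEinsteinWith.ricciCoeff_eq hρ hx hgx 0).trans
        (IsEinsteinWith.ricciCoeff_eq hρ hx hgx 1).symm)) hgx⟩
  · rintro ⟨c, hc, h⟩
    have hgc : ∀ X Y, g.form X Y = (standardMetric hn).form (diagEnd hn (fun _ => c) X) Y := by
      intro X Y
      rw [diagEnd_of_eq (x := fun _ => c) rfl, h]
      simp only [LinearMap.smul_apply, map_smul, Module.End.one_apply]
    refine ⟨(1 / 4 + (n - 1) / (n * ((n : ℝ) ^ 2 - 2))) / c, fun Y Z => ?_⟩
    rw [ricci_of_eq (fun _ => hc) rfl hgc, h, LinearMap.smul_apply, LinearMap.smul_apply,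
      smul_eq_mul, ← mul_assoc, div_mul_cancel₀ _ hc.ne']

/-- Equal volume means x 0 x 1 = 1, so u = x 0 + x 1 ≥ 2. The deficit of scalar curvature is u - 2
times a factor that is positive because (u + 1)² ≥ 9; equality forces u = 2 and both coefficients to
be 1. -/
theorem IsDiagonal.scal_le (hg : IsDiagonal g) (hV : g.SameVolume (standardMetric hn)) :
    g.scal ≤ (standardMetric hn).scal ∧
      (g.scal = (standardMetric hn).scal → g = standardMetric hn) := by
  obtain ⟨x, hx, hgx⟩ := hg.exists_diagEnd
  have hx1 := SameVolume.mul_eq_one hV hx hgx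
  have hd := finrank_pos hn
  have hb := bracketCoeff_pos (hn := hn)
  have hlt := bracketCoeff_lt (hn := hn)
  have hu : 2 ≤ x 0 + x 1 := by
    nlinarith [sq_nonneg (x 0 - x 1), hx 0, hx 1]
  have h1 := scal_eq hx hgx
  have h2 := scal_eq (g := standardMetric hn) (fun _ => one_pos) standardMetric_form_eq_diagEnd
  rw [sum_ricciCoeff_div hx hx1] at h1
  rw [sum_ricciCoeff_div (fun _ => one_pos) (by simp)] at h2
  have hpos : 0 < bracketCoeff n 0 1 0 * ((x 0 + x 1) ^ 2 + 2 * (x 0 + x 1) + 1) -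
      (bracketCoeff n 0 0 0 + 4 * bracketCoeff n 0 1 0 + 4 * casimirConst n) := by
    have : 9 ≤ (x 0 + x 1) ^ 2 + 2 * (x 0 + x 1) + 1 := by nlinarith
    have := mul_le_mul_of_nonneg_left this hb.le
    linarith
  have hdiff : (standardMetric hn).scal - g.scal = (x 0 + x 1 - 2) * ((bracketCoeff n 0 1 0 *
      ((x 0 + x 1) ^ 2 + 2 * (x 0 + x 1) + 1) - (bracketCoeff n 0 0 0 +
        4 * bracketCoeff n 0 1 0 + 4 * casimirConst n)) / 4 *
          (n * (n - 1) ^ 2 * (n + 2) / 4)) := by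
    rw [h1, h2]
    ring
  have hfac := mul_pos (div_pos hpos four_pos) hd
  refine ⟨sub_nonneg.1 (hdiff ▸ mul_nonneg (sub_nonneg.2 hu) hfac.le), fun h => ?_⟩
  rw [h, sub_self] at hdiff
  have h3 := (mul_eq_zero.1 hdiff.symm).resolve_right hfac.ne'
  have h4 : x 0 = 1 := by
    have h5 : x 1 = 2 - x 0 := by linarith
    rw [h5] at hx1
    have : (x 0 - 1) ^ 2 = 0 := by linear_combination -hx1
    exact sub_eq_zero.1 (pow_eq_zero_iff two_ne_zero |>.1 this)
  have h6 := form_eq_smul_of_eq (by linarith) hgx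
  rw [h4, one_smul] at h6
  exact InvMetric.ext h6

end Diagonal

end TensorSO
-- Assembly of the statements.
theorem mainTheorem8 (n : ℕ) (hn : 3 ≤ n) :
    -- `𝔭 = 𝔭₁ ⊕ 𝔭₂`, orthogonal and `Ad(K)`-invariant, with summands of equal dimension
    (TensorSO.p₁ n ⊔ TensorSO.p₂ n = TensorSO.complement n ∧
      (∀ X ∈ TensorSO.p₁ n, ∀ Y ∈ TensorSO.p₂ n,
        killingForm ℝ (LieAlgebra.Orthogonal.so (Fin n × Fin n) ℝ) X Y = 0) ∧
      (∀ k ∈ TensorSO.K n, ∀ X ∈ TensorSO.p₁ n, TensorSO.Ad k X ∈ TensorSO.p₁ n) ∧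
      (∀ k ∈ TensorSO.K n, ∀ X ∈ TensorSO.p₂ n, TensorSO.Ad k X ∈ TensorSO.p₂ n) ∧
      (Module.finrank ℝ (TensorSO.p₁ n) : ℝ) = n * (n - 1) ^ 2 * (n + 2) / 4 ∧
      (Module.finrank ℝ (TensorSO.p₂ n) : ℝ) = n * (n - 1) ^ 2 * (n + 2) / 4) ∧
    -- the structural constants
    (∀ (d₁ d₂ : ℕ) (b₁ : Module.Basis (Fin d₁) ℝ (TensorSO.p₁ n))
        (b₂ : Module.Basis (Fin d₂) ℝ (TensorSO.p₂ n)),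
      IsKillingOrthonormal b₁ → IsKillingOrthonormal b₂ →
      structuralConstant b₁ b₁ b₂ =
        (n : ℝ) * (n - 1) ^ 2 * (n - 2) * (n + 2) ^ 2 / (16 * (n ^ 2 - 2)) ∧
      structuralConstant b₁ b₂ b₂ =
        (n : ℝ) * (n - 1) ^ 2 * (n - 2) * (n + 2) ^ 2 / (16 * (n ^ 2 - 2))) ∧
    -- the Einstein constant, the smallest Lichnerowicz eigenvalue, and `G`-stability
    (TensorSO.standardMetric hn).IsEinsteinWith (1 / 4 + (n - 1) / (n * (n ^ 2 - 2))) ∧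
    IsLeast (TensorSO.standardMetric hn).ttSpectrum (((n : ℝ) ^ 2 - 4) / (n ^ 2 - 2)) ∧
    ((n : ℝ) ^ 2 - 4) / (n ^ 2 - 2) > 2 * (1 / 4 + (n - 1) / (n * (n ^ 2 - 2))) ∧
    (TensorSO.standardMetric hn).IsGStable ∧
    -- if `n ≠ 4`, the invariant metrics are the metrics `x₁ g_B|_𝔭₁ + x₂ g_B|_𝔭₂`
    (n ≠ 4 → ∀ g : (TensorSO.pair hn).InvMetric, TensorSO.IsDiagonal g) ∧
    -- uniqueness and global maximum, among all invariant metrics if `n ≠ 4`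
    (∀ g : (TensorSO.pair hn).InvMetric, (n = 4 → TensorSO.IsDiagonal g) →
      (g.IsEinstein ↔ ∃ c : ℝ, 0 < c ∧ g.form = c • (TensorSO.standardMetric hn).form) ∧
      (g.SameVolume (TensorSO.standardMetric hn) →
        g.scal ≤ (TensorSO.standardMetric hn).scal ∧
        (g.scal = (TensorSO.standardMetric hn).scal → g = TensorSO.standardMetric hn))) := by
  have : Nonempty (Fin n) := ⟨⟨0, by omega⟩⟩
  -- Both dimension cases reduce to diagonal metrics, by hypothesis for n = 4 and by the
  -- classification of invariant forms otherwise.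
  have hdiag : ∀ g : (TensorSO.pair hn).InvMetric, (n = 4 → TensorSO.IsDiagonal g) →
      TensorSO.IsDiagonal g := fun g hg => by
    by_cases h4 : n = 4
    · exact hg h4
    · exact TensorSO.isDiagonal_of_ne_four h4 g
  refine ⟨⟨TensorSO.p₁_sup_p₂ hn, fun X hX Y hY => TensorSO.killingForm_summand hX hY,
    fun k hk X hX => TensorSO.Ad_mem_summand hk 0 hX,
    fun k hk X hX => TensorSO.Ad_mem_summand hk 1 hX,
    TensorSO.finrank_summand 0, TensorSO.finrank_summand 1⟩,
    fun d₁ d₂ b₁ b₂ h₁ h₂ => ⟨?_, ?_⟩, TensorSO.standardMetric_isEinsteinWith,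
    TensorSO.isLeast_ttSpectrum, TensorSO.two_mul_einsteinConst_lt (hn := hn),
    TensorSO.standardMetric_isGStable, TensorSO.isDiagonal_of_ne_four,
    fun g hg => ⟨(hdiag g hg).isEinstein_iff, (hdiag g hg).scal_le⟩⟩
  · have hd := TensorSO.finrank_summand (n := n) 0
    rw [Module.finrank_eq_card_basis (show Module.Basis (Fin d₁) ℝ (TensorSO.summand n 0) from b₁)]
      at hd
    have h := TensorSO.structuralConstant_summand hn 0 0 1 (X := b₁) (Y := b₁) (Z := b₂) h₁ h₁ h₂
    refine h.trans ?_
    rw [hd]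
    simp [MatrixEnd.blockCoeff]
    field_simp
    ring
  · have hd := TensorSO.finrank_summand (n := n) 0
    rw [Module.finrank_eq_card_basis (show Module.Basis (Fin d₁) ℝ (TensorSO.summand n 0) from b₁)]
      at hd
    have h := TensorSO.structuralConstant_summand hn 0 1 1 (X := b₁) (Y := b₂) (Z := b₂) h₁ h₂ h₂
    refine h.trans ?_
    rw [hd]
    simp [MatrixEnd.blockCoeff]
    field_simp
    ring
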